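/- Let $\mathbb{F}_q$ be a finite field of characteristic greater than $3$. A plane conic over $\mathbb{F}_q$ is the curve $x^{T}Ax=0$ in $\mathbb{P}^2$ given by a nonzero symmetric $3\times 3$ matrix $A$ over $\mathbb{F}_q$, up to scaling. Let $\Psi$ be the set of ordered pairs $(\mathcal{A},\mathcal{B})$ of smooth conics over $\mathbb{F}_q$ that intersect transversally (over $\overline{\mathbb{F}}_q$). For $(\mathcal{A},\mathcal{B})\in\Psi$ let $E$ be the set of pairs $(P,\xi)$, defined over $\overline{\mathbb{F}}_q$, where $P$ is a point of $\mathcal{A}$ and $\xi$ is a tangent line to $\mathcal{B}$ with $P\in\xi$. Define $j\colon E\to E$ by $j(P,\xi)=(P',\xi')$, where $P'$ is the second intersection point of $\xi$ with $\mathcal{A}$ and $\xi'$ is the second tangent line to $\mathcal{B}$ through $P'$ (with $P'=P$ if $\xi$ is tangent to $\mathcal{A}$, and $\xi'=\xi$ if $P'\in\mathcal{B}$). The pair satisfies the Poncelet tetragon condition if $j^4(e)=e$ for some $e\in E$; let $\Gamma_4\subseteq\Psi$ be the set of pairs satisfying it. For $(\mathcal{A},\mathcal{B})\in\Psi$ the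 $q$-power Frobenius permutes the four points of $\mathcal{A}\cap\mathcal{B}$ over $\overline{\mathbb{F}}_q$; the cycle type of this permutation, a partition of $4$, is the intersection type of the pair and of the pencil $\{\eta\mathcal{A}+\theta\mathcal{B}:(\eta:\theta)\in\mathbb{P}^1(\mathbb{F}_q)\}$ that it generates. Then $$\frac{|\Gamma_4|}{|\Psi|}=\frac1q+O(q^{-3/2}).$$ Moreover, for each intersection type, the proportion of the pencils of that type among all the pencils generated by pairs in $\Psi$, and the proportion of pairs satisfying the Poncelet tetragon condition, both among all the pairs in $\Psi$ of that type and among the pairs in $\Psi$ contained in any single pencil of that type, are as follows: $$\begin{array}{c|c|c} \text{type} & \text{proportion of pencils} & \text{proportion of pairs satisfying the condition}\\ \hline (1,1,1,1) & 1/24 & 3/q+O(q^{-3/2})\\ (2,1,1) & 1/4 & 1/q+O(q^{-3/2})\\ (2,2) & 1/8 & 3/q+O(q^{-3/2})\\ (3,1) & 1/3 & 0\\ (4) & 1/4 & 1/q+O(q^{-3/2}) \end{array}$$ The constants implied by $O$ are absolute, and the entry $0$ is exact: no pair in $\Psi$ of type $(3,1)$ satisfies the condition. -/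

import Mathlib

open scoped LinearAlgebra.Projectivization

namespace Poncelet

/-- The space of symmetric `3 × 3` matrices over `k`. In characteristic different from `2` a
symmetric matrix `A` is the same thing as the ternary quadratic form `xᵀ A x`. -/
def symMatrices (k : Type*) [Field k] : Submodule k (Matrix (Fin 3) (Fin 3) k) where
  carrier := {A | A.IsSymm}
  add_mem' := fun {_ _} ha hb => Matrix.IsSymm.add ha hb
  zero_mem' := Matrix.isSymm_zero
  smul_mem' := fun c {_} h => Matrix.IsSymm.smul h c

/-- A projective plane conic `xᵀ A x = 0` over `k`: a nonzero symmetric matrix up to a scalar. -/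
abbrev Conic (k : Type*) [Field k] := ℙ k (symMatrices k)

noncomputable section

variable {F : Type*} [Field F]

/-- The geometric points of the projective plane over `F`. -/
abbrev GeomPoint (F : Type*) [Field F] := ℙ (AlgebraicClosure F) (Fin 3 → AlgebraicClosure F)

/-- The geometric lines `ξ₀ x + ξ₁ y + ξ₂ z = 0`, given by their coordinates; the point `P` lies
on the line `ξ` exactly when `P.orthogonal ξ`. -/
abbrev GeomLine (F : Type*) [Field F] := ℙ (AlgebraicClosure F) (Fin 3 → AlgebraicClosure F)

namespace Conic

/-- A matrix of the conic (well defined up to a nonzero scalar), over the algebraic closure. -/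
def geomMatrix (A : Conic F) : Matrix (Fin 3) (Fin 3) (AlgebraicClosure F) :=
  (A.rep : Matrix (Fin 3) (Fin 3) F).map (algebraMap F (AlgebraicClosure F))

/-- Half the gradient at `P` of the equation `xᵀ A x` of the conic; if `P` is a smooth point of
the conic, these are the coordinates of the tangent line at `P`. -/
def polar (A : Conic F) (P : GeomPoint F) : Fin 3 → AlgebraicClosure F :=
  Matrix.mulVec A.geomMatrix P.rep

/-- The geometric point `P` lies on the conic `A`. -/
def Contains (A : Conic F) (P : GeomPoint F) : Prop :=
  P.rep ⬝ᵥ A.polar P = 0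

/-- The conic has no geometric singular point. -/
def IsSmooth (A : Conic F) : Prop :=
  ∀ P : GeomPoint F, A.Contains P → A.polar P ≠ 0

/-- `ξ` is the tangent line to `B` at one of its geometric points; for smooth `B` these lines are
the points of the dual conic of `B`. -/
def IsTangentLine (B : Conic F) (ξ : GeomLine F) : Prop :=
  ∃ Q : GeomPoint F, B.Contains Q ∧
    ∃ h : B.polar Q ≠ 0, ξ = Projectivization.mk (AlgebraicClosure F) (B.polar Q) h

/-- The two conics have distinct tangent lines at each common geometric point. -/
def Transversal (A B : Conic F) : Prop :=
  ∀ P : GeomPoint F, A.Contains P → B.Contains P →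
    LinearIndependent (AlgebraicClosure F) ![A.polar P, B.polar P]

/-- The pencil generated by `A` and `B`: all the conics `η A + θ B` with `(η : θ) ∈ ℙ¹(F)`. -/
def pencil (A B : Conic F) : Set (Conic F) :=
  {C | C.submodule ≤ A.submodule ⊔ B.submodule}

end Conic

/-- The curve `E ⊆ 𝒜 × ℬ*` of all `(P, ξ)` with `P ∈ 𝒜`, `ξ` tangent to `ℬ` and `P ∈ ξ`. -/
def incidenceCurve (A B : Conic F) : Set (GeomPoint F × GeomLine F) :=
  {e | A.Contains e.1 ∧ B.IsTangentLine e.2 ∧ e.1.orthogonal e.2}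

/-- The graph of the operation `j : (P, ξ) ↦ (P', ξ')` on the curve `E`: `P'` is the other point of
intersection of `ξ` and `𝒜` (so that `ξ ∩ 𝒜 = {P, P'}`, with `P' = P` if `ξ` is tangent to `𝒜`),
and `ξ'` is the other tangent line to `ℬ` through `P'` (so that the tangent lines to `ℬ` through
`P'` are `ξ` and `ξ'`, with `ξ' = ξ` if there is only one). -/
def IsStep (A B : Conic F) (e e' : GeomPoint F × GeomLine F) : Prop :=
  (∀ X : GeomPoint F, (A.Contains X ∧ X.orthogonal e.2) ↔ (X = e.1 ∨ X = e'.1)) ∧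
  (∀ ℓ : GeomLine F, (B.IsTangentLine ℓ ∧ e'.1.orthogonal ℓ) ↔ (ℓ = e.2 ∨ ℓ = e'.2))

/-- The Poncelet `n`-gon condition: there is `e ∈ E` with `j^n(e) = e`. -/
def NGonCondition (n : ℕ) (A B : Conic F) : Prop :=
  ∃ e : ℕ → GeomPoint F × GeomLine F,
    e 0 ∈ incidenceCurve A B ∧ (∀ i < n, IsStep A B (e i) (e (i + 1))) ∧ e n = e 0

/-- The `q`-power Frobenius map on geometric points, where `q` is the number of elements of
the finite field `F`. -/
def geomFrobenius [Fintype F] (P : GeomPoint F) : GeomPoint F :=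
  Projectivization.mk (AlgebraicClosure F) (fun i => P.rep i ^ Fintype.card F) (by
    intro h
    apply P.rep_nonzero
    funext i
    exact eq_zero_of_pow_eq_zero (congrFun h i))

/-- `A` and `B` meet in exactly four geometric points, and `τ` is the multiset of the lengths of
the cycles (fixed points included) of the permutation of these points by Frobenius. -/
def HasIntersectionType [Fintype F] (A B : Conic F) (τ : Multiset ℕ) : Prop :=
  ∃ (p : Fin 4 → GeomPoint F) (σ : Equiv.Perm (Fin 4)),
    Function.Injective p ∧
    (∀ X : GeomPoint F, (A.Contains X ∧ B.Contains X) ↔ X ∈ Set.range p) ∧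
    (∀ i, geomFrobenius (p i) = p (σ i)) ∧
    σ.partition.parts = τ

/-- The set `Ψ` of ordered pairs of smooth conics over `F` with transversal intersection. -/
def smoothPairs (F : Type*) [Field F] : Set (Conic F × Conic F) :=
  {x | x.1.IsSmooth ∧ x.2.IsSmooth ∧ x.1.Transversal x.2}

/-- The set `Γₙ` of the pairs in `Ψ` satisfying the Poncelet `n`-gon condition. -/
def ponceletPairs (F : Type*) [Field F] (n : ℕ) : Set (Conic F × Conic F) :=
  {x | x ∈ smoothPairs F ∧ NGonCondition n x.1 x.2}

/-- The pairs in `Ψ` of intersection type `τ`. -/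
def smoothPairsOfType (F : Type*) [Field F] [Fintype F] (τ : Multiset ℕ) :
    Set (Conic F × Conic F) :=
  {x | x ∈ smoothPairs F ∧ HasIntersectionType x.1 x.2 τ}

/-- The pairs in `Ψ` both of whose members belong to the pencil `W`. -/
def smoothPairsIn (W : Set (Conic F)) : Set (Conic F × Conic F) :=
  {x | x ∈ smoothPairs F ∧ x.1 ∈ W ∧ x.2 ∈ W}

/-- The pencils generated by the pairs in `Ψ`. -/
def pencils (F : Type*) [Field F] : Set (Set (Conic F)) :=
  {W | ∃ x ∈ smoothPairs F, W = x.1.pencil x.2}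

/-- The pencils generated by the pairs in `Ψ` of intersection type `τ`. -/
def pencilsOfType (F : Type*) [Field F] [Fintype F] (τ : Multiset ℕ) : Set (Set (Conic F)) :=
  {W | ∃ x ∈ smoothPairsOfType F τ, W = x.1.pencil x.2}

/-- The proportion `|S ∩ T| / |T|` of the elements of the finite set `T` that lie in `S`. -/
def proportion {α : Type*} (S T : Set α) : ℝ :=
  ((S ∩ T).ncard : ℝ) / (T.ncard : ℝ)

/-- Up to an error of at most `C q^(-3/2)`, where `q = |F|`, a proportion `c / q` of the pairs
in `Ψ` of intersection type `τ`, and also of the pairs in `Ψ` inside each single pencil of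
type `τ`, satisfies the Poncelet tetragon condition. -/
def TetragonDensity (F : Type*) [Field F] [Fintype F] (C : ℝ) (τ : Multiset ℕ) (c : ℝ) : Prop :=
  |proportion (ponceletPairs F 4) (smoothPairsOfType F τ) - c / (Fintype.card F : ℝ)|
      ≤ C * (Fintype.card F : ℝ) ^ (-(3 / 2) : ℝ) ∧
  ∀ W ∈ pencilsOfType F τ,
    |proportion (ponceletPairs F 4) (smoothPairsIn W) - c / (Fintype.card F : ℝ)|
      ≤ C * (Fintype.card F : ℝ) ^ (-(3 / 2) : ℝ)

end

end Poncelet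

/-!
Coordinates in which both conics of a transversal pair are diagonal turn `A` into the identity and
the dual of `B` into `D = diag(d₀, d₁, d₂)`. Two points of `A` lie on a common tangent line to `B`
when they are conjugate with respect to `2 D - tr D`. In a tetragon `P₀P₁P₂P₃` both `P₁` and `P₃`
are therefore conjugate to `P₀` and to `P₂`, which forces `2 D - tr D` to be singular:
`dⱼ = dₖ + dₗ` for one of the three indices `j`. Conversely such a relation allows one to
write down a tetragon.

Fix a smooth member `B` of a pencil and another member `C`, and let `C - rⱼ B` be the three
degenerate members. Then `C + x B` and `B` satisfy the condition exactly when
`x = 2 rⱼ - (r₀ + r₁ + r₂)` for some `j`. The degenerate members correspond to the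
three splittings of the four base points into two pairs, so there are `s` such `x` in `F`, where
`s ∈ {0, 1, 3}` is the number of splittings preserved by Frobenius; hence about `s q` of the
`(q + 1 - s) (q - s)` pairs in the pencil satisfy the condition.

Finally, `PGL₃(F)` acts simply transitively on the labelled quadrangles on which Frobenius acts by a
given permutation `σ` of the labels. Their number therefore does not depend on `σ`, so the types of
the pencils are distributed as the cycle types in `S₄`.
-/

open Matrix

namespace Poncelet

section ProportionalVectors

variable {k V : Type*} [Field k] [AddCommGroup V] [Module k V] {x y z : Fin 3 → k}

theorem mem_span_singleton_symm {v w : V} (hw : w ≠ 0) (h : w ∈ k ∙ v) : v ∈ k ∙ w := by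
  obtain ⟨c, rfl⟩ := Submodule.mem_span_singleton.mp h
  exact Submodule.mem_span_singleton.mpr ⟨c⁻¹, inv_smul_smul₀ (smul_ne_zero_iff.mp hw).1 v⟩

theorem cross_eq_zero_iff_mem_span (hx : x ≠ 0) : x ⨯₃ y = 0 ↔ y ∈ k ∙ x := by
  rw [Submodule.mem_span_singleton, ← not_iff_not, ← Ne, crossProduct_ne_zero_iff_linearIndependent,
    LinearIndependent.pair_iff' hx, not_exists]

theorem mem_span_cross (hxy : x ⨯₃ y ≠ 0) (hx : x ⬝ᵥ z = 0) (hy : y ⬝ᵥ z = 0) :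
    z ∈ k ∙ (x ⨯₃ y) := by
  rw [← cross_eq_zero_iff_mem_span hxy, cross_cross_eq_smul_sub_smul, hx, hy, zero_smul, zero_smul,
    sub_zero]

theorem mem_span_pair_of_cross_dot_eq_zero (hxy : x ⨯₃ y ≠ 0) (hz : (x ⨯₃ y) ⬝ᵥ z = 0) :
    z ∈ Submodule.span k {x, y} := by
  obtain ⟨i, hi⟩ := Function.ne_iff.mp hxy
  set w : Fin 3 → k := Pi.single i 1
  have hw : (x ⨯₃ y) ⬝ᵥ w ≠ 0 := by rwa [dotProduct_single_one]
  have cramer : ((x ⨯₃ y) ⬝ᵥ w) • z =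
      ((z ⨯₃ y) ⬝ᵥ w) • x + ((x ⨯₃ z) ⬝ᵥ w) • y + ((x ⨯₃ y) ⬝ᵥ z) • w := by
    ext j
    simp only [vec3_dotProduct, cross_apply, cons_val, Pi.add_apply, Pi.smul_apply, smul_eq_mul]
    fin_cases j <;> simp only [Fin.zero_eta, Fin.mk_one, Fin.reduceFinMk] <;> ring
  rw [hz, zero_smul, add_zero] at cramer
  rw [Submodule.mem_span_pair]
  refine ⟨((x ⨯₃ y) ⬝ᵥ w)⁻¹ * ((z ⨯₃ y) ⬝ᵥ w), ((x ⨯₃ y) ⬝ᵥ w)⁻¹ * ((x ⨯₃ z) ⬝ᵥ w), ?_⟩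
  rw [mul_smul, mul_smul, ← smul_add, ← cramer, inv_smul_smul₀ hw]

theorem mulVec_mem_span_singleton {m n : Type*} [Fintype n] (M : Matrix m n k) {v w : n → k}
    (h : v ∈ k ∙ w) : M *ᵥ v ∈ k ∙ (M *ᵥ w) := by
  obtain ⟨c, rfl⟩ := Submodule.mem_span_singleton.mp h
  exact Submodule.mem_span_singleton.mpr ⟨c, (mulVec_smul M c w).symm⟩

theorem det_eq_zero_of_mulVec_mem_span {n : Type*} [Fintype n] [DecidableEq n]
    {M : Matrix n n k} {v w u : n → k} (hv : v ≠ 0) (hw : w ∉ k ∙ v)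
    (hMv : M *ᵥ v ∈ k ∙ u) (hMw : M *ᵥ w ∈ k ∙ u) : M.det = 0 := by
  rw [← exists_mulVec_eq_zero_iff]
  by_cases h0 : M *ᵥ v = 0
  · exact ⟨v, hv, h0⟩
  · obtain ⟨c, hc⟩ := Submodule.mem_span_singleton.mp
      (Submodule.mem_span_singleton_trans hMw (mem_span_singleton_symm h0 hMv))
    refine ⟨w - c • v, fun h => hw ?_, by rw [mulVec_sub, mulVec_smul, hc, sub_self]⟩
    exact Submodule.mem_span_singleton.mpr ⟨c, (sub_eq_zero.mp h).symm⟩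

end ProportionalVectors

section SymmetricForms

theorem dotProduct_mulVec_comm {R n : Type*} [CommSemiring R] [Fintype n] {M : Matrix n n R}
    (hM : M.IsSymm) (x y : n → R) : x ⬝ᵥ M *ᵥ y = y ⬝ᵥ M *ᵥ x := by
  rw [dotProduct_mulVec, ← mulVec_transpose, hM.eq, dotProduct_comm]

variable {k n : Type*} [Field k] [Fintype n]

/- If `Y ∈ W` were not conjugate to `P`, the second isotropic point on the line through `P` and `Y`
would be a further one. -/
theorem dotProduct_mulVec_eq_zero_of_unique_isotropic [NeZero (2 : k)] {M : Matrix n n k}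
    (hM : M.IsSymm) {W : Submodule k (n → k)} {P Y : n → k} (hPW : P ∈ W) (hP : P ⬝ᵥ M *ᵥ P = 0)
    (h : ∀ X ∈ W, X ⬝ᵥ M *ᵥ X = 0 → X ∈ k ∙ P) (hY : Y ∈ W) : Y ⬝ᵥ M *ᵥ P = 0 := by
  by_contra hYP
  set X : n → k := (2 * (Y ⬝ᵥ M *ᵥ P)) • Y - (Y ⬝ᵥ M *ᵥ Y) • P with hX
  have hXP : X ⬝ᵥ M *ᵥ P = 2 * (Y ⬝ᵥ M *ᵥ P) * (Y ⬝ᵥ M *ᵥ P) := by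
    simp [hX, sub_dotProduct, hP]
  have hXX : X ⬝ᵥ M *ᵥ X = 0 := by
    simp only [hX, mulVec_sub, mulVec_smul, sub_dotProduct, dotProduct_sub, smul_dotProduct,
      dotProduct_smul, smul_eq_mul, hP, dotProduct_mulVec_comm hM P Y]
    ring
  obtain ⟨c, hc⟩ := Submodule.mem_span_singleton.mp
    (h X (W.sub_mem (W.smul_mem _ hY) (W.smul_mem _ hPW)) hXX)
  rw [← hc, smul_dotProduct, hP, smul_zero] at hXP
  exact mul_ne_zero (mul_ne_zero two_ne_zero hYP) hYP hXP.symm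

theorem mem_span_or_mem_span_of_isotropic [NeZero (2 : k)] {M : Matrix n n k} (hM : M.IsSymm)
    {P R X : n → k} (hP : P ⬝ᵥ M *ᵥ P = 0) (hR : R ⬝ᵥ M *ᵥ R = 0) (hPR : P ⬝ᵥ M *ᵥ R ≠ 0)
    (hX : X ∈ Submodule.span k {P, R}) (hXX : X ⬝ᵥ M *ᵥ X = 0) : X ∈ k ∙ P ∨ X ∈ k ∙ R := by
  obtain ⟨a, b, rfl⟩ := Submodule.mem_span_pair.mp hX
  have hab : 2 * a * b * (P ⬝ᵥ M *ᵥ R) = 0 := by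
    rw [← hXX]
    simp only [mulVec_add, mulVec_smul, add_dotProduct, dotProduct_add, smul_dotProduct,
      dotProduct_smul, smul_eq_mul, hP, hR, dotProduct_mulVec_comm hM R P]
    ring
  have hab' : a = 0 ∨ b = 0 := by simpa [hPR, two_ne_zero] using hab
  rcases hab' with rfl | rfl
  · exact .inr (Submodule.mem_span_singleton.mpr ⟨b, by simp⟩)
  · exact .inl (Submodule.mem_span_singleton.mpr ⟨a, by simp⟩)

end SymmetricForms

section PlaneConics

variable {k : Type*} [Field k] {M D : Matrix (Fin 3) (Fin 3) k} {P R X ξ : Fin 3 → k}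

theorem mulVec_mem_span_of_unique_isotropic [NeZero (2 : k)] (hM : M.IsSymm) (hξ : ξ ≠ 0)
    (hP : P ⬝ᵥ M *ᵥ P = 0) (hPξ : P ⬝ᵥ ξ = 0)
    (h : ∀ X, X ⬝ᵥ M *ᵥ X = 0 → X ⬝ᵥ ξ = 0 → X ∈ k ∙ P) : M *ᵥ P ∈ k ∙ ξ := by
  let W : Submodule k (Fin 3 → k) :=
    { carrier := {X | X ⬝ᵥ ξ = 0}
      add_mem' := fun hX hY => by simp_all [add_dotProduct]
      zero_mem' := zero_dotProduct ξ
      smul_mem' := fun c X hX => by simp_all }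
  have hW : ∀ Y ∈ W, Y ⬝ᵥ M *ᵥ P = 0 := fun Y hY =>
    dotProduct_mulVec_eq_zero_of_unique_isotropic hM (W := W) hPξ hP (fun X hX hXX => h X hXX hX) hY
  rw [← cross_eq_zero_iff_mem_span hξ, ← dotProduct_eq_zero_iff]
  intro z
  rw [dotProduct_comm, triple_product_permutation, triple_product_permutation, dotProduct_comm]
  exact hW _ (by simp [W, dotProduct_comm _ ξ])

theorem mem_span_or_mem_span_of_isotropic_of_dot_eq_zero [NeZero (2 : k)] (hM : M.IsSymm)
    (hξ : ξ ≠ 0) (hP : P ⬝ᵥ M *ᵥ P = 0) (hR : R ⬝ᵥ M *ᵥ R = 0) (hPR : P ⬝ᵥ M *ᵥ R ≠ 0)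
    (hPξ : P ⬝ᵥ ξ = 0) (hRξ : R ⬝ᵥ ξ = 0) :
    (X ⬝ᵥ M *ᵥ X = 0 ∧ X ⬝ᵥ ξ = 0) ↔ X ∈ k ∙ P ∨ X ∈ k ∙ R := by
  have hP0 : P ≠ 0 := by rintro rfl; simp at hPR
  have hcross : P ⨯₃ R ≠ 0 := fun h => by
    obtain ⟨c, rfl⟩ := Submodule.mem_span_singleton.mp ((cross_eq_zero_iff_mem_span hP0).mp h)
    simp [mulVec_smul, hP] at hPR
  constructor
  · rintro ⟨hXX, hXξ⟩
    obtain ⟨c, hc⟩ := Submodule.mem_span_singleton.mp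
      (mem_span_singleton_symm hξ (mem_span_cross hcross hPξ hRξ))
    refine mem_span_or_mem_span_of_isotropic hM hP hR hPR
      (mem_span_pair_of_cross_dot_eq_zero hcross ?_) hXX
    rw [← hc, smul_dotProduct, dotProduct_comm, hXξ, smul_zero]
  · simp only [Submodule.mem_span_singleton]
    rintro (⟨c, rfl⟩ | ⟨c, rfl⟩) <;> simp [mulVec_smul, hP, hR, hPξ, hRξ]

theorem mem_span_of_dotProduct_eq_zero (hP0 : P ≠ 0) (hP : P ⬝ᵥ P = 0) (hR : R ⬝ᵥ R = 0)
    (hPR : P ⬝ᵥ R = 0) : R ∈ k ∙ P := by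
  rw [← cross_eq_zero_iff_mem_span hP0]
  by_contra hne
  -- Both `P` and `R` are orthogonal to both of them, hence multiples of the cross product.
  have hP' := mem_span_cross hne hP (by rwa [dotProduct_comm])
  have hR' := mem_span_cross hne hPR hR
  exact hne ((cross_eq_zero_iff_mem_span hP0).mpr
    (Submodule.mem_span_singleton_trans hR' (mem_span_singleton_symm hP0 hP')))

/-- The symmetric form under which two points of the conic `x ⬝ᵥ x = 0` are conjugate exactly when
the chord joining them is tangent to the conic with dual equation `ξ ⬝ᵥ D *ᵥ ξ = 0`. -/
def chordForm (D : Matrix (Fin 3) (Fin 3) k) : Matrix (Fin 3) (Fin 3) k :=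
  (2 : k) • D - D.trace • (1 : Matrix (Fin 3) (Fin 3) k)

theorem chordForm_isSymm (hD : D.IsSymm) : (chordForm D).IsSymm :=
  (hD.smul _).sub (isSymm_one.smul _)

theorem dotProduct_chordForm_mulVec (x y : Fin 3 → k) :
    x ⬝ᵥ chordForm D *ᵥ y = 2 * (x ⬝ᵥ D *ᵥ y) - D.trace * (x ⬝ᵥ y) := by
  simp [chordForm, sub_mulVec, smul_mulVec]

theorem cross_dotProduct_mulVec_cross (hD : D.IsSymm) (hP : P ⬝ᵥ P = 0) (hR : R ⬝ᵥ R = 0) :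
    (P ⨯₃ R) ⬝ᵥ D *ᵥ (P ⨯₃ R) = (P ⬝ᵥ R) * (P ⬝ᵥ chordForm D *ᵥ R) := by
  have h01 := hD.apply 0 1
  have h02 := hD.apply 0 2
  have h12 := hD.apply 1 2
  have gram : (P ⨯₃ R) ⬝ᵥ D *ᵥ (P ⨯₃ R) = (P ⬝ᵥ R) * (P ⬝ᵥ chordForm D *ᵥ R)
      + (D.trace * (R ⬝ᵥ R) - R ⬝ᵥ D *ᵥ R) * (P ⬝ᵥ P) - (P ⬝ᵥ D *ᵥ P) * (R ⬝ᵥ R) := by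
    rw [dotProduct_chordForm_mulVec]
    simp only [mulVec, trace_fin_three, vec3_dotProduct, cross_apply, cons_val, h01, h02, h12]
    ring
  rw [gram, hP, hR]
  ring

end PlaneConics

/-! ### Poncelet polygons -/

section PonceletPolygons

variable {k : Type*} [Field k] {n : ℕ} [NeZero n]

/-- A closed Poncelet `n`-gon with vertices `P i` and sides `ξ i`, inscribed in the conic
`x ⬝ᵥ A *ᵥ x = 0` and circumscribed about the conic with dual equation `ℓ ⬝ᵥ D *ᵥ ℓ = 0`: the side
`ξ i` meets the first conic in `P i` and `P (i + 1)`, and the tangent lines to the second through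
`P (i + 1)` are `ξ i` and `ξ (i + 1)`. Points and lines are given by nonzero coordinate vectors. -/
structure IsPonceletPolygon (A D : Matrix (Fin 3) (Fin 3) k) (P ξ : Fin n → Fin 3 → k) : Prop where
  vertex_ne_zero : ∀ i, P i ≠ 0
  side_ne_zero : ∀ i, ξ i ≠ 0
  side_inter_iff : ∀ i X, (X ⬝ᵥ A *ᵥ X = 0 ∧ X ⬝ᵥ ξ i = 0) ↔ X ∈ k ∙ P i ∨ X ∈ k ∙ P (i + 1)
  tangent_iff : ∀ i ℓ, (ℓ ⬝ᵥ D *ᵥ ℓ = 0 ∧ P (i + 1) ⬝ᵥ ℓ = 0) ↔ ℓ ∈ k ∙ ξ i ∨ ℓ ∈ k ∙ ξ (i + 1)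

namespace IsPonceletPolygon

variable {A D : Matrix (Fin 3) (Fin 3) k} {P ξ : Fin n → Fin 3 → k} {i : Fin n}

theorem of_nondegenerate [NeZero (2 : k)] (hA : A.IsSymm) (hD : D.IsSymm)
    (hP : ∀ i, P i ⬝ᵥ A *ᵥ P i = 0) (hξ : ∀ i, ξ i ⬝ᵥ D *ᵥ ξ i = 0)
    (hPξ : ∀ i, P i ⬝ᵥ ξ i = 0) (hPξ' : ∀ i, P (i + 1) ⬝ᵥ ξ i = 0)
    (hPP : ∀ i, P i ⬝ᵥ A *ᵥ P (i + 1) ≠ 0) (hξξ : ∀ i, ξ i ⬝ᵥ D *ᵥ ξ (i + 1) ≠ 0) :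
    IsPonceletPolygon A D P ξ := by
  have hP0 : ∀ i, P i ≠ 0 := fun i h0 => hPP i (by rw [h0, zero_dotProduct])
  have hξ0 : ∀ i, ξ i ≠ 0 := fun i h0 => hξξ i (by rw [h0, zero_dotProduct])
  refine ⟨hP0, hξ0, fun i X => ?_, fun i ℓ => ?_⟩
  · exact mem_span_or_mem_span_of_isotropic_of_dot_eq_zero hA (hξ0 i) (hP i) (hP _) (hPP i)
      (hPξ i) (hPξ' i)
  · rw [dotProduct_comm (P _)]
    exact mem_span_or_mem_span_of_isotropic_of_dot_eq_zero hD (hP0 (i + 1)) (hξ i) (hξ _) (hξξ i)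
      (by rw [dotProduct_comm, hPξ' i]) (by rw [dotProduct_comm, hPξ])

theorem vertex_isotropic (h : IsPonceletPolygon A D P ξ) (i : Fin n) : P i ⬝ᵥ A *ᵥ P i = 0 :=
  ((h.side_inter_iff i _).mpr (.inl (Submodule.mem_span_singleton_self _))).1

theorem vertex_dot_side (h : IsPonceletPolygon A D P ξ) (i : Fin n) : P i ⬝ᵥ ξ i = 0 :=
  ((h.side_inter_iff i _).mpr (.inl (Submodule.mem_span_singleton_self _))).2

theorem succ_vertex_dot_side (h : IsPonceletPolygon A D P ξ) (i : Fin n) :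
    P (i + 1) ⬝ᵥ ξ i = 0 :=
  ((h.side_inter_iff i _).mpr (.inr (Submodule.mem_span_singleton_self _))).2

theorem side_isotropic (h : IsPonceletPolygon A D P ξ) (i : Fin n) : ξ i ⬝ᵥ D *ᵥ ξ i = 0 :=
  ((h.tangent_iff i _).mpr (.inl (Submodule.mem_span_singleton_self _))).1

theorem mulVec_vertex_mem_of_vertex_mem [NeZero (2 : k)] (hA : A.IsSymm)
    (h : IsPonceletPolygon A D P ξ) (hi : P (i + 1) ∈ k ∙ P i) : A *ᵥ P i ∈ k ∙ ξ i :=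
  mulVec_mem_span_of_unique_isotropic hA (h.side_ne_zero i) (h.vertex_isotropic i)
    (h.vertex_dot_side i) fun X hXX hXξ =>
      ((h.side_inter_iff i X).mp ⟨hXX, hXξ⟩).elim id (Submodule.mem_span_singleton_trans · hi)

variable (h : IsPonceletPolygon 1 D P ξ)
include h

theorem vertex_dot_self (i : Fin n) : P i ⬝ᵥ P i = 0 := by
  simpa only [one_mulVec] using h.vertex_isotropic i

variable [NeZero (2 : k)]

theorem vertex_mem_side_of_vertex_mem (hi : P (i + 1) ∈ k ∙ P i) : P i ∈ k ∙ ξ i := by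
  simpa only [one_mulVec] using h.mulVec_vertex_mem_of_vertex_mem isSymm_one hi

theorem vertex_dot_chordForm_mulVec (hD : D.IsSymm) (i : Fin n) :
    P i ⬝ᵥ chordForm D *ᵥ P (i + 1) = 0 := by
  have hPi := h.vertex_dot_self i
  have hPs := h.vertex_dot_self (i + 1)
  by_cases hi : P (i + 1) ∈ k ∙ P i
  · obtain ⟨b, hb⟩ := Submodule.mem_span_singleton.mp (h.vertex_mem_side_of_vertex_mem hi)
    obtain ⟨c, hc⟩ := Submodule.mem_span_singleton.mp hi
    have hPD : P i ⬝ᵥ D *ᵥ P i = 0 := by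
      simp [← hb, mulVec_smul, h.side_isotropic]
    rw [dotProduct_chordForm_mulVec, ← hc]
    simp [mulVec_smul, hPD, hPi]
  · have hcross : P i ⨯₃ P (i + 1) ≠ 0 := mt (cross_eq_zero_iff_mem_span (h.1 i)).mp hi
    have hdot : P i ⬝ᵥ P (i + 1) ≠ 0 :=
      mt (mem_span_of_dotProduct_eq_zero (h.1 i) hPi hPs) hi
    obtain ⟨c, hc⟩ := Submodule.mem_span_singleton.mp (mem_span_singleton_symm (h.2 i)
      (mem_span_cross hcross (h.vertex_dot_side i) (h.succ_vertex_dot_side i)))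
    refine (mul_eq_zero.mp ?_).resolve_left hdot
    rw [← cross_dotProduct_mulVec_cross hD hPi hPs, ← hc]
    simp [mulVec_smul, h.side_isotropic]

theorem succ_side_mem_of_turning_back (hi : P (i + 1 + 1) ∈ k ∙ P i) : ξ (i + 1) ∈ k ∙ ξ i := by
  by_cases hP : P (i + 1) ∈ k ∙ P i
  · have hPξ := h.vertex_mem_side_of_vertex_mem hP
    have hPξ' := h.vertex_mem_side_of_vertex_mem (i := i + 1)
      (Submodule.mem_span_singleton_trans hi (mem_span_singleton_symm (h.1 _) hP))
    exact Submodule.mem_span_singleton_trans (mem_span_singleton_symm (h.1 _) hPξ')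
      (Submodule.mem_span_singleton_trans hP hPξ)
  · have hcross : P i ⨯₃ P (i + 1) ≠ 0 := mt (cross_eq_zero_iff_mem_span (h.1 i)).mp hP
    obtain ⟨c, hc⟩ := Submodule.mem_span_singleton.mp (mem_span_singleton_symm (h.1 _) hi)
    have hPξ : P i ⬝ᵥ ξ (i + 1) = 0 := by
      rw [← hc, smul_dotProduct, h.succ_vertex_dot_side, smul_zero]
    exact Submodule.mem_span_singleton_trans (mem_span_cross hcross hPξ (h.vertex_dot_side _))
      (mem_span_singleton_symm (h.2 i)
        (mem_span_cross hcross (h.vertex_dot_side i) (h.succ_vertex_dot_side i)))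

theorem mulVec_side_mem_of_turning_back (hD : D.IsSymm) (hi : P (i + 1 + 1) ∈ k ∙ P i) :
    D *ᵥ ξ i ∈ k ∙ P (i + 1) := by
  refine mulVec_mem_span_of_unique_isotropic hD (h.1 _) (h.side_isotropic i)
    (by rw [dotProduct_comm, h.succ_vertex_dot_side]) fun ℓ hℓ hℓP => ?_
  rcases (h.tangent_iff i ℓ).mp ⟨hℓ, by rwa [dotProduct_comm]⟩ with hmem | hmem
  · exact hmem
  · exact Submodule.mem_span_singleton_trans hmem (h.succ_side_mem_of_turning_back hi)

theorem mem_side_of_turning_back {ℓ : Fin 3 → k} (hi : P (i + 1 + 1) ∈ k ∙ P i)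
    (hℓ : ℓ ⬝ᵥ D *ᵥ ℓ = 0) (hPℓ : P (i + 1) ⬝ᵥ ℓ = 0) : ℓ ∈ k ∙ ξ i :=
  ((h.tangent_iff i ℓ).mp ⟨hℓ, hPℓ⟩).elim id
    (Submodule.mem_span_singleton_trans · (h.succ_side_mem_of_turning_back hi))

theorem chordForm_mulVec_mem_of_turning_back (hD : D.IsSymm) (hi : P (i + 1 + 1) ∈ k ∙ P i) :
    chordForm D *ᵥ P (i + 1) ∈ k ∙ P i := by
  by_cases hL : chordForm D *ᵥ P (i + 1) = 0
  · rw [hL]; exact Submodule.zero_mem _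
  refine mem_span_singleton_symm (h.1 i) ?_
  rw [← one_mulVec (P i)]
  refine mulVec_mem_span_of_unique_isotropic isSymm_one hL (h.vertex_isotropic i)
    (h.vertex_dot_chordForm_mulVec hD i) fun X hXX hXL => ?_
  rw [one_mulVec] at hXX
  have hPs := h.vertex_dot_self (i + 1)
  by_cases hX : X ∈ k ∙ P (i + 1)
  · obtain ⟨c, rfl⟩ := Submodule.mem_span_singleton.mp hX
    rcases eq_or_ne c 0 with rfl | hc
    · rw [zero_smul]; exact Submodule.zero_mem _
    · have hPD : P (i + 1) ⬝ᵥ D *ᵥ P (i + 1) = 0 := by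
        rw [smul_dotProduct, dotProduct_chordForm_mulVec, hPs] at hXL
        simpa [hc, two_ne_zero] using hXL
      obtain ⟨b, hb⟩ := Submodule.mem_span_singleton.mp (h.mem_side_of_turning_back hi hPD hPs)
      refine Submodule.smul_mem _ _ (mem_span_of_dotProduct_eq_zero (h.1 i) (h.vertex_dot_self i)
        hPs ?_)
      rw [← hb, dotProduct_smul, h.vertex_dot_side, smul_zero]
  · -- The line joining `P (i + 1)` and `X` is tangent, hence it is the side `ξ i`.
    have hcross : P (i + 1) ⨯₃ X ≠ 0 := mt (cross_eq_zero_iff_mem_span (h.1 _)).mp hX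
    have hℓ : P (i + 1) ⨯₃ X ∈ k ∙ ξ i := by
      refine h.mem_side_of_turning_back hi ?_ (dot_self_cross _ _)
      rw [cross_dotProduct_mulVec_cross hD hPs hXX,
        dotProduct_mulVec_comm (chordForm_isSymm hD), hXL, mul_zero]
    obtain ⟨c, hc⟩ := Submodule.mem_span_singleton.mp (mem_span_singleton_symm hcross hℓ)
    refine ((h.side_inter_iff i X).mp ⟨by rwa [one_mulVec], ?_⟩).resolve_right hX
    rw [← hc, dotProduct_smul, dot_cross_self, smul_zero]

end IsPonceletPolygon

end PonceletPolygons

section Quadrilaterals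

variable {k : Type*} [Field k] [NeZero (2 : k)] {D : Matrix (Fin 3) (Fin 3) k}
  {P ξ : Fin 4 → Fin 3 → k}

namespace IsPonceletPolygon

theorem chordForm_mulVec_mem_span_cross (hD : D.IsSymm) (h : IsPonceletPolygon 1 D P ξ)
    (h02 : P 2 ∉ k ∙ P 0) :
    chordForm D *ᵥ P 1 ∈ k ∙ (P 0 ⨯₃ P 2) ∧ chordForm D *ᵥ P 3 ∈ k ∙ (P 0 ⨯₃ P 2) := by
  have hcross : P 0 ⨯₃ P 2 ≠ 0 := mt (cross_eq_zero_iff_mem_span (h.1 0)).mp h02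
  have hsymm := dotProduct_mulVec_comm (chordForm_isSymm hD)
  exact ⟨mem_span_cross hcross (h.vertex_dot_chordForm_mulVec hD 0)
      (by rw [hsymm]; exact h.vertex_dot_chordForm_mulVec hD 1),
    mem_span_cross hcross (by rw [hsymm]; exact h.vertex_dot_chordForm_mulVec hD 3)
      (h.vertex_dot_chordForm_mulVec hD 2)⟩

theorem exists_isotropic_eigenvector (hD : D.IsSymm) (hdet : D.det ≠ 0)
    (h : IsPonceletPolygon 1 D P ξ) (h02 : P 2 ∈ k ∙ P 0) (h13 : P 3 ∈ k ∙ P 1) :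
    ∃ x, x ≠ 0 ∧ x ⬝ᵥ x = 0 ∧ D *ᵥ x ∈ k ∙ x := by
  have h0 : D *ᵥ ξ 0 ∈ k ∙ P 1 := h.mulVec_side_mem_of_turning_back (i := 0) hD h02
  have h1 : D *ᵥ ξ 1 ∈ k ∙ P 0 := Submodule.mem_span_singleton_trans
    (h.mulVec_side_mem_of_turning_back (i := 1) hD h13) h02
  have hξ : ξ 1 ∈ k ∙ ξ 0 := h.succ_side_mem_of_turning_back (i := 0) h02
  have hDξ : D *ᵥ ξ 1 ≠ 0 := fun hD0 => hdet (exists_mulVec_eq_zero_iff.mp ⟨_, h.2 1, hD0⟩)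
  have h01 : D *ᵥ ξ 1 ∈ k ∙ P 1 :=
    Submodule.mem_span_singleton_trans (mulVec_mem_span_singleton D hξ) h0
  have h10 : P 1 ∈ k ∙ P 0 :=
    Submodule.mem_span_singleton_trans (mem_span_singleton_symm hDξ h01) h1
  have hPξ : P 0 ∈ k ∙ ξ 0 := h.vertex_mem_side_of_vertex_mem (i := 0) h10
  exact ⟨P 0, h.1 0, h.vertex_dot_self 0, Submodule.mem_span_singleton_trans
    (mulVec_mem_span_singleton D hPξ) (Submodule.mem_span_singleton_trans h0 h10)⟩

theorem det_chordForm_eq_zero (hD : D.IsSymm) (hdet : D.det ≠ 0)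
    (hiso : ∀ x, x ≠ 0 → x ⬝ᵥ x = 0 → D *ᵥ x ∉ k ∙ x) (h : IsPonceletPolygon 1 D P ξ) :
    (chordForm D).det = 0 := by
  by_cases h02 : P 2 ∈ k ∙ P 0 <;> by_cases h13 : P 3 ∈ k ∙ P 1
  · obtain ⟨x, hx0, hx, hDx⟩ := h.exists_isotropic_eigenvector hD hdet h02 h13
    exact absurd hDx (hiso x hx0 hx)
  · have h20 : P 0 ∈ k ∙ P 2 := mem_span_singleton_symm (h.1 2) h02
    have h1 := h.chordForm_mulVec_mem_of_turning_back (i := 0) hD h02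
    have h3 := h.chordForm_mulVec_mem_of_turning_back (i := 2) hD h20
    exact det_eq_zero_of_mulVec_mem_span (h.1 1) h13 h1
      (Submodule.mem_span_singleton_trans h3 h02)
  · have h31 : P 1 ∈ k ∙ P 3 := mem_span_singleton_symm (h.1 3) h13
    have h2 := h.chordForm_mulVec_mem_of_turning_back (i := 1) hD h13
    have h0 := h.chordForm_mulVec_mem_of_turning_back (i := 3) hD h31
    exact det_eq_zero_of_mulVec_mem_span (h.1 0) h02
      (Submodule.mem_span_singleton_trans h0 h13) h2
  · obtain ⟨h1, h3⟩ := h.chordForm_mulVec_mem_span_cross hD h02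
    exact det_eq_zero_of_mulVec_mem_span (h.1 1) h13 h1 h3

end IsPonceletPolygon

variable {β : Fin 3 → k}

omit [NeZero (2 : k)] in
theorem diagonal_mulVec_notMem_of_isotropic (hβ : Function.Injective β) {x : Fin 3 → k}
    (hx0 : x ≠ 0) (hx : x ⬝ᵥ x = 0) : diagonal β *ᵥ x ∉ k ∙ x := by
  intro hmem
  obtain ⟨c, hc⟩ := Submodule.mem_span_singleton.mp hmem
  obtain ⟨i, hi⟩ := Function.ne_iff.mp hx0
  have hβi : ∀ j, x j ≠ 0 → c = β j := fun j hj => by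
    have := congrFun hc j
    rw [mulVec_diagonal, Pi.smul_apply, smul_eq_mul] at this
    exact mul_right_cancel₀ hj this
  have hj : ∀ j, j ≠ i → x j = 0 := fun j hji => by
    by_contra hxj
    exact hji (hβ ((hβi j hxj).symm.trans (hβi i hi)))
  rw [dotProduct, Finset.sum_eq_single i (fun j _ hji => by rw [hj j hji, mul_zero]) (by simp)]
    at hx
  exact hi (mul_self_eq_zero.mp hx)

omit [NeZero (2 : k)] in
theorem det_chordForm_diagonal_eq_zero_iff :
    (chordForm (diagonal β)).det = 0 ↔ ∃ i, 2 * β i = ∑ j, β j := by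
  have h : chordForm (diagonal β) = diagonal fun i => 2 * β i - ∑ j, β j := by
    ext i j
    rcases eq_or_ne i j with rfl | hij <;> simp [chordForm, trace_diagonal, *]
  rw [h, det_diagonal, Finset.prod_eq_zero_iff]
  simp [sub_eq_zero]

theorem isPonceletPolygon_one_diagonal {ι : k} (hι : ι * ι = -1) (hβ0 : ∀ i, β i ≠ 0)
    (hβ : β 0 = β 1 + β 2) :
    IsPonceletPolygon 1 (diagonal β) ![![ι, 1, 0], ![ι, 0, 1], ![-ι, 1, 0], ![-ι, 0, 1]]
      ![![1, -ι, -ι], ![1, ι, -ι], ![1, ι, ι], ![1, -ι, ι]] := by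
  have hιβ (b : k) : ι * (b * ι) = -b := by linear_combination b * hι
  have h0 : β 0 + -β 1 + -β 2 = 0 := by rw [hβ]; ring
  have h1 : β 0 + β 1 + -β 2 ≠ 0 := by
    convert mul_ne_zero two_ne_zero (hβ0 1) using 1; rw [hβ]; ring
  have h2 : β 0 + -β 1 + β 2 ≠ 0 := by
    convert mul_ne_zero two_ne_zero (hβ0 2) using 1; rw [hβ]; ring
  refine .of_nondegenerate isSymm_one (isSymm_diagonal _) ?_ ?_ ?_ ?_ ?_ ?_ <;> intro i <;>
    fin_cases i <;>
    simp [dotProduct, Fin.sum_univ_three, mulVec_diagonal, hι, hιβ, h0, h1, h2]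

end Quadrilaterals

section ChangeOfCoordinates

variable {k : Type*} [Field k]

theorem mulVec_dotProduct_mulVec_mulVec {R m n : Type*} [CommSemiring R] [Fintype m] [Fintype n]
    (N : Matrix m n R) (C : Matrix m m R) (x y : n → R) :
    (N *ᵥ x) ⬝ᵥ C *ᵥ (N *ᵥ y) = x ⬝ᵥ (Nᵀ * C * N) *ᵥ y := by
  rw [← mulVec_mulVec, ← mulVec_mulVec, dotProduct_mulVec x, vecMul_transpose]

theorem mulVec_mem_span_singleton_iff {n : Type*} [Fintype n] [DecidableEq n] {N : Matrix n n k}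
    (hN : IsUnit N) {v w : n → k} : N *ᵥ v ∈ k ∙ (N *ᵥ w) ↔ v ∈ k ∙ w := by
  refine ⟨fun h => ?_, mulVec_mem_span_singleton N⟩
  obtain ⟨c, hc⟩ := Submodule.mem_span_singleton.mp h
  rw [← mulVec_smul] at hc
  exact Submodule.mem_span_singleton.mpr ⟨c, mulVec_injective_iff_isUnit.mpr hN hc⟩

theorem mulVec_ne_zero_iff {n : Type*} [Fintype n] [DecidableEq n] {N : Matrix n n k}
    (hN : IsUnit N) {v : n → k} : N *ᵥ v ≠ 0 ↔ v ≠ 0 :=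
  (mulVec_injective_iff_isUnit.mpr hN).ne_iff' (mulVec_zero N)

theorem isPonceletPolygon_mulVec_iff {n : ℕ} [NeZero n] {A D N : Matrix (Fin 3) (Fin 3) k}
    (hN : IsUnit N) {P ξ : Fin n → Fin 3 → k} :
    IsPonceletPolygon A D (fun i => N *ᵥ P i) (fun i => N⁻¹ᵀ *ᵥ ξ i) ↔
      IsPonceletPolygon (Nᵀ * A * N) (N⁻¹ * D * N⁻¹ᵀ) P ξ := by
  have hN' : IsUnit N⁻¹ᵀ := by rwa [isUnit_transpose, isUnit_nonsing_inv_iff]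
  have hdot (x y : Fin 3 → k) : (N *ᵥ x) ⬝ᵥ (N⁻¹ᵀ *ᵥ y) = x ⬝ᵥ y := by
    rw [dotProduct_mulVec, vecMul_transpose, mulVec_mulVec,
      nonsing_inv_mul _ ((isUnit_iff_isUnit_det N).mp hN), one_mulVec]
  have hdual (x y : Fin 3 → k) :
      (N⁻¹ᵀ *ᵥ x) ⬝ᵥ D *ᵥ (N⁻¹ᵀ *ᵥ y) = x ⬝ᵥ (N⁻¹ * D * N⁻¹ᵀ) *ᵥ y := by
    rw [mulVec_dotProduct_mulVec_mulVec, transpose_transpose]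
  have hall {M : Matrix (Fin 3) (Fin 3) k} (hM : IsUnit M) {p : (Fin 3 → k) → Prop} :
      (∀ x, p x) ↔ ∀ x, p (M *ᵥ x) := (mulVec_surjective_iff_isUnit.mpr hM).forall
  constructor
  · rintro ⟨hP, hξ, hside, htangent⟩
    refine ⟨fun i => (mulVec_ne_zero_iff hN).mp (hP i), fun i => (mulVec_ne_zero_iff hN').mp (hξ i),
      fun i X => ?_, fun i ℓ => ?_⟩
    · simpa only [mulVec_dotProduct_mulVec_mulVec, hdot, mulVec_mem_span_singleton_iff hN] using
        hside i (N *ᵥ X)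
    · simpa only [hdual, hdot, mulVec_mem_span_singleton_iff hN'] using htangent i (N⁻¹ᵀ *ᵥ ℓ)
  · rintro ⟨hP, hξ, hside, htangent⟩
    refine ⟨fun i => (mulVec_ne_zero_iff hN).mpr (hP i),
      fun i => (mulVec_ne_zero_iff hN').mpr (hξ i), fun i => (hall hN).mpr fun X => ?_,
      fun i => (hall hN').mpr fun ℓ => ?_⟩
    · simpa only [mulVec_dotProduct_mulVec_mulVec, hdot, mulVec_mem_span_singleton_iff hN] using
        hside i X
    · simpa only [hdual, hdot, mulVec_mem_span_singleton_iff hN'] using htangent i ℓ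

end ChangeOfCoordinates

variable {F : Type*} [Field F]

local notation "Ω" => AlgebraicClosure F

instance algebraicClosure_neZero {n : ℕ} [n.AtLeastTwo] [NeZero (ofNat(n) : F)] :
    NeZero (ofNat(n) : Ω) :=
  ⟨by rw [← map_ofNat (algebraMap F Ω)]; exact (map_ne_zero _).mpr (NeZero.ne _)⟩

section ConicEquations

namespace Conic

theorem geomMatrix_isSymm (A : Conic F) : A.geomMatrix.IsSymm :=
  IsSymm.map A.rep.2 _

theorem exists_geomMatrix_mk (M : symMatrices F) (hM : M ≠ 0) :
    ∃ c : Ω, c ≠ 0 ∧ geomMatrix (.mk F M hM) =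
      c • (M : Matrix (Fin 3) (Fin 3) F).map (algebraMap F Ω) := by
  obtain ⟨c, hc⟩ := Projectivization.exists_smul_eq_mk_rep F M hM
  refine ⟨algebraMap F Ω c, by simp, ext fun i j => ?_⟩
  rw [geomMatrix, ← hc]
  exact map_mul (algebraMap F Ω) _ _

theorem contains_mk {A : Conic F} {x : Fin 3 → Ω} (hx : x ≠ 0) :
    A.Contains (.mk Ω x hx) ↔ x ⬝ᵥ A.geomMatrix *ᵥ x = 0 := by
  obtain ⟨c, hc⟩ := Projectivization.exists_smul_eq_mk_rep Ω x hx
  rw [Contains, polar, ← hc, Units.smul_def]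
  simp [mulVec_smul]

theorem isSmooth_iff {A : Conic F} : A.IsSmooth ↔ A.geomMatrix.det ≠ 0 := by
  rw [Ne, ← exists_mulVec_eq_zero_iff]
  constructor
  · rintro h ⟨x, hx, h0⟩
    obtain ⟨c, hc⟩ := Projectivization.exists_smul_eq_mk_rep Ω x hx
    refine h (.mk Ω x hx) ((contains_mk hx).mpr (by rw [h0, dotProduct_zero])) ?_
    rw [polar, ← hc, Units.smul_def, mulVec_smul, h0, smul_zero]
  · exact fun h P _ h0 => h ⟨P.rep, P.rep_nonzero, h0⟩

theorem transversal_iff {A B : Conic F} : A.Transversal B ↔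
    ∀ x : Fin 3 → Ω, x ≠ 0 → x ⬝ᵥ A.geomMatrix *ᵥ x = 0 → x ⬝ᵥ B.geomMatrix *ᵥ x = 0 →
      LinearIndependent Ω ![A.geomMatrix *ᵥ x, B.geomMatrix *ᵥ x] := by
  refine ⟨fun h x hx hA hB => ?_, fun h P => h P.rep P.rep_nonzero⟩
  obtain ⟨c, hc⟩ := Projectivization.exists_smul_eq_mk_rep Ω x hx
  have hli := h _ ((contains_mk hx).mpr hA) ((contains_mk hx).mpr hB)
  rw [polar, polar, ← hc, Units.smul_def, mulVec_smul, mulVec_smul,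
    LinearIndependent.pair_iff] at hli
  rw [LinearIndependent.pair_iff]
  intro s t hst
  apply hli
  rw [smul_comm s, smul_comm t, ← smul_add, hst, smul_zero]

theorem isTangentLine_mk {B : Conic F} (hB : B.IsSmooth) {ξ : Fin 3 → Ω} (hξ : ξ ≠ 0) :
    B.IsTangentLine (.mk Ω ξ hξ) ↔ ξ ⬝ᵥ B.geomMatrix⁻¹ *ᵥ ξ = 0 := by
  have hdet : IsUnit B.geomMatrix.det := isUnit_iff_ne_zero.mpr (isSmooth_iff.mp hB)
  have hdual (x : Fin 3 → Ω) : (B.geomMatrix *ᵥ x) ⬝ᵥ B.geomMatrix⁻¹ *ᵥ (B.geomMatrix *ᵥ x) =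
      x ⬝ᵥ B.geomMatrix *ᵥ x := by
    rw [mulVec_mulVec, nonsing_inv_mul _ hdet, one_mulVec, dotProduct_comm]
  constructor
  · rintro ⟨Q, hQ, h, hξQ⟩
    obtain ⟨c, hc⟩ := (Projectivization.mk_eq_mk_iff' Ω _ _ hξ h).mp hξQ
    rw [← hc, mulVec_smul, smul_dotProduct, dotProduct_smul, polar, hdual]
    simp [show Q.rep ⬝ᵥ B.geomMatrix *ᵥ Q.rep = 0 from hQ]
  · intro h
    have hBξ : B.geomMatrix *ᵥ (B.geomMatrix⁻¹ *ᵥ ξ) = ξ := by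
      rw [mulVec_mulVec, mul_nonsing_inv _ hdet, one_mulVec]
    have hx0 : B.geomMatrix⁻¹ *ᵥ ξ ≠ 0 := fun h0 => hξ (by rw [← hBξ, h0, mulVec_zero])
    have hx : B.Contains (.mk Ω _ hx0) := by
      rw [contains_mk, hBξ, dotProduct_comm, h]
    obtain ⟨c, hc⟩ := Projectivization.exists_smul_eq_mk_rep Ω _ hx0
    refine ⟨_, hx, hB _ hx, (Projectivization.mk_eq_mk_iff' Ω _ _ hξ _).mpr ⟨c⁻¹, ?_⟩⟩
    rw [polar, ← hc, Units.smul_def, mulVec_smul, hBξ, inv_smul_smul₀ c.ne_zero]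

end Conic

variable {A B : Conic F}

theorem forall_mk {p : ℙ Ω (Fin 3 → Ω) → Prop} :
    (∀ X, p X) ↔ ∀ (x : Fin 3 → Ω) (hx : x ≠ 0), p (.mk Ω x hx) :=
  ⟨fun h _ _ => h _, fun h => Projectivization.ind h⟩

theorem isStep_mk (hB : B.IsSmooth) {P R ξ η : Fin 3 → Ω} (hP : P ≠ 0) (hR : R ≠ 0) (hξ : ξ ≠ 0)
    (hη : η ≠ 0) :
    IsStep A B (.mk Ω P hP, .mk Ω ξ hξ) (.mk Ω R hR, .mk Ω η hη) ↔
      (∀ X, (X ⬝ᵥ A.geomMatrix *ᵥ X = 0 ∧ X ⬝ᵥ ξ = 0) ↔ X ∈ Ω ∙ P ∨ X ∈ Ω ∙ R) ∧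
      (∀ ℓ, (ℓ ⬝ᵥ B.geomMatrix⁻¹ *ᵥ ℓ = 0 ∧ R ⬝ᵥ ℓ = 0) ↔ ℓ ∈ Ω ∙ ξ ∨ ℓ ∈ Ω ∙ η) := by
  have hmem {p : (Fin 3 → Ω) → Prop} (hp : p 0) :
      (∀ X, X ≠ 0 → p X) ↔ ∀ X, p X :=
    ⟨fun h X => (eq_or_ne X 0).elim (fun h0 => h0 ▸ hp) (h X), fun h X _ => h X⟩
  rw [IsStep, forall_mk, forall_mk]
  simp only [Conic.contains_mk, Conic.isTangentLine_mk hB, Projectivization.orthogonal_mk,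
    Projectivization.mk_eq_mk_iff', ← Submodule.mem_span_singleton]
  exact and_congr (hmem (by simp)) (hmem (by simp))

theorem nGonCondition_iff {n : ℕ} [NeZero n] (hB : B.IsSmooth) :
    NGonCondition n A B ↔ ∃ P ξ : Fin n → Fin 3 → Ω,
      IsPonceletPolygon A.geomMatrix B.geomMatrix⁻¹ P ξ := by
  constructor
  · rintro ⟨e, -, he, hn⟩
    have hsucc (i : Fin n) : e ((i + 1 : Fin n) : ℕ) = e (i + 1) := by
      rw [Fin.val_add, Fin.val_one', Nat.add_mod_mod]
      rcases Nat.lt_or_eq_of_le (Nat.succ_le_of_lt i.2) with hi | hi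
      · rw [Nat.mod_eq_of_lt hi]
      · rw [← Nat.succ_eq_add_one, hi, Nat.mod_self, hn]
    have hstep (i : Fin n) : IsStep A B
        (.mk Ω (e i).1.rep (Projectivization.rep_nonzero _),
          .mk Ω (e i).2.rep (Projectivization.rep_nonzero _))
        (.mk Ω (e ((i + 1 : Fin n) : ℕ)).1.rep (Projectivization.rep_nonzero _),
          .mk Ω (e ((i + 1 : Fin n) : ℕ)).2.rep (Projectivization.rep_nonzero _)) := by
      simpa only [Projectivization.mk_rep, hsucc] using he i i.2
    exact ⟨fun i => (e i).1.rep, fun i => (e i).2.rep, fun _ => Projectivization.rep_nonzero _,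
      fun _ => Projectivization.rep_nonzero _, fun i => ((isStep_mk hB _ _ _ _).mp (hstep i)).1,
      fun i => ((isStep_mk hB _ _ _ _).mp (hstep i)).2⟩
  · rintro ⟨P, ξ, h⟩
    let e (i : ℕ) : GeomPoint F × GeomLine F :=
      (.mk Ω _ (h.vertex_ne_zero (Fin.ofNat n i)), .mk Ω _ (h.side_ne_zero (Fin.ofNat n i)))
    refine ⟨e, ⟨?_, ?_, ?_⟩, fun i _ => ?_, ?_⟩
    · exact (Conic.contains_mk _).mpr (h.vertex_isotropic _)
    · exact (Conic.isTangentLine_mk hB _).mpr (h.side_isotropic _)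
    · exact (Projectivization.orthogonal_mk _ _).mpr (h.vertex_dot_side _)
    · have hi : Fin.ofNat n (i + 1) = Fin.ofNat n i + 1 := by
        ext; simp [Fin.val_add]
      simp only [e, hi]
      exact (isStep_mk hB _ _ _ _).mpr ⟨h.side_inter_iff _, h.tangent_iff _⟩
    · simp [e]

variable {N : Matrix (Fin 3) (Fin 3) (AlgebraicClosure F)} {a b : Fin 3 → AlgebraicClosure F}

theorem nGonCondition_iff_of_conj {n : ℕ} [NeZero n] (hN : IsUnit N) (hB : B.IsSmooth) :
    NGonCondition n A B ↔ ∃ P ξ : Fin n → Fin 3 → Ω,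
      IsPonceletPolygon (Nᵀ * A.geomMatrix * N) (Nᵀ * B.geomMatrix * N)⁻¹ P ξ := by
  have hN' : IsUnit N⁻¹ᵀ := by rwa [isUnit_transpose, isUnit_nonsing_inv_iff]
  rw [nGonCondition_iff hB, Matrix.mul_inv_rev, Matrix.mul_inv_rev,
    ← transpose_nonsing_inv, ← Matrix.mul_assoc,
    (mulVec_surjective_iff_isUnit.mpr hN).comp_left.exists]
  refine exists_congr fun P => ?_
  rw [(mulVec_surjective_iff_isUnit.mpr hN').comp_left.exists]
  exact exists_congr fun ξ => isPonceletPolygon_mulVec_iff hN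

theorem Conic.isSmooth_of_conj_eq_diagonal (hB : Nᵀ * B.geomMatrix * N = diagonal b)
    (hb : ∀ i, b i ≠ 0) : B.IsSmooth := by
  have hdet : (Nᵀ * B.geomMatrix * N).det ≠ 0 := by
    rw [hB, det_diagonal]
    exact Finset.prod_ne_zero_iff.mpr fun i _ => hb i
  rw [det_mul, det_mul] at hdet
  exact isSmooth_iff.mpr (right_ne_zero_of_mul (left_ne_zero_of_mul hdet))

theorem nGonCondition_iff_of_diagonal {n : ℕ} [NeZero n] (hN : IsUnit N)
    (hA : Nᵀ * A.geomMatrix * N = diagonal a) (ha : ∀ i, a i ≠ 0)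
    (hB : Nᵀ * B.geomMatrix * N = diagonal b) (hb : ∀ i, b i ≠ 0) :
    NGonCondition n A B ↔
      ∃ P ξ : Fin n → Fin 3 → Ω, IsPonceletPolygon 1 (diagonal fun i => a i / b i) P ξ := by
  have hsqrt (i : Fin 3) : ∃ s : Ω, s ^ 2 = (a i)⁻¹ := IsAlgClosed.exists_pow_nat_eq _ two_pos
  choose s hs using hsqrt
  have hs0 (i) : s i ≠ 0 := fun h0 =>
    inv_ne_zero (ha i) (by rw [← hs, h0, zero_pow two_ne_zero])
  have hunit : IsUnit (N * diagonal s) :=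
    hN.mul (isUnit_diagonal.mpr (Pi.isUnit_iff.mpr fun i => (hs0 i).isUnit))
  have hconj {C : Matrix (Fin 3) (Fin 3) Ω} {c : Fin 3 → Ω} (hC : Nᵀ * C * N = diagonal c) :
      (N * diagonal s)ᵀ * C * (N * diagonal s) = diagonal fun i => c i / a i := by
    calc (N * diagonal s)ᵀ * C * (N * diagonal s)
        = diagonal s * (Nᵀ * C * N) * diagonal s := by
          rw [transpose_mul, diagonal_transpose]; simp only [Matrix.mul_assoc]
      _ = diagonal fun i => c i / a i := by
          rw [hC, diagonal_mul_diagonal, diagonal_mul_diagonal]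
          refine congrArg diagonal (funext fun i => ?_)
          rw [div_eq_mul_inv, ← hs]; ring
  have hinv : (diagonal fun i => b i / a i)⁻¹ = diagonal fun i => a i / b i := by
    refine inv_eq_right_inv ?_
    rw [diagonal_mul_diagonal, ← diagonal_one]
    exact congrArg diagonal (funext fun i => (div_mul_div_cancel₀ (ha i)).trans
      (div_self (hb i)))
  rw [nGonCondition_iff_of_conj hunit (Conic.isSmooth_of_conj_eq_diagonal hB hb), hconj hA,
    hconj hB, hinv]
  simp only [div_self (ha _), diagonal_one]

theorem tetragonCondition_iff_of_diagonal [NeZero (2 : F)] (hN : IsUnit N)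
    (hA : Nᵀ * A.geomMatrix * N = diagonal a) (ha : ∀ i, a i ≠ 0)
    (hB : Nᵀ * B.geomMatrix * N = diagonal b) (hb : ∀ i, b i ≠ 0)
    (hab : Function.Injective fun i => a i / b i) :
    NGonCondition 4 A B ↔ ∃ i, 2 * (a i / b i) = ∑ j, a j / b j := by
  constructor
  · rw [nGonCondition_iff_of_diagonal hN hA ha hB hb, ← det_chordForm_diagonal_eq_zero_iff]
    rintro ⟨P, ξ, h⟩
    refine h.det_chordForm_eq_zero (isSymm_diagonal _) ?_
      fun x => diagonal_mulVec_notMem_of_isotropic hab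
    rw [det_diagonal]
    exact Finset.prod_ne_zero_iff.mpr fun i _ => div_ne_zero (ha i) (hb i)
  · rintro ⟨i, hi⟩
    set π := Equiv.swap 0 i
    have hconj {C : Matrix (Fin 3) (Fin 3) Ω} {c : Fin 3 → Ω} (hC : Nᵀ * C * N = diagonal c) :
        (N.submatrix (Equiv.refl _) π)ᵀ * C * N.submatrix (Equiv.refl _) π = diagonal (c ∘ π) := by
      rw [← submatrix_diagonal_equiv, ← hC]
      ext; simp [mul_apply]
    have hNπ : IsUnit (N.submatrix (Equiv.refl _) π) := (isUnit_submatrix_equiv _ _).mpr hN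
    rw [nGonCondition_iff_of_diagonal hNπ (hconj hA) (fun _ => ha _) (hconj hB) (fun _ => hb _)]
    obtain ⟨ι, hι⟩ := IsAlgClosed.exists_pow_nat_eq (-1 : Ω) two_pos
    refine ⟨_, _, isPonceletPolygon_one_diagonal (by rw [← sq, hι])
      (fun i => div_ne_zero (ha _) (hb _)) ?_⟩
    rw [← Equiv.sum_comp π, Fin.sum_univ_three] at hi
    simp only [Function.comp_apply, π, Equiv.swap_apply_left] at hi ⊢
    linear_combination hi

end ConicEquations

/-! ### Quadrangles and the conics through them -/

section Frames

variable {k : Type*} [Field k]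

/-- The matrix whose columns `u 0 + u 1`, `u 0 + u 2`, `u 0 + u 3` are, when the vectors `u i` add
up to `0`, the vertices of the diagonal triangle of the quadrangle `u`. -/
def frameMatrix (u : Fin 4 → Fin 3 → k) : Matrix (Fin 3) (Fin 3) k :=
  of fun i j => u 0 i + u j.succ i

/-- Four points of the plane in general position, with coordinate vectors normalised so that they
add up to `0`. The characteristic is then different from `2`. -/
structure IsFrame (u : Fin 4 → Fin 3 → k) : Prop where
  sum_eq_zero : ∑ i, u i = 0
  det_ne_zero : (frameMatrix u).det ≠ 0

/-- The coordinates of the points of a frame, up to the factor `2`, in its diagonal triangle. -/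
def signVec (k : Type*) [Field k] : Fin 4 → Fin 3 → k :=
  ![![1, 1, 1], ![1, -1, -1], ![-1, 1, -1], ![-1, -1, 1]]

/-- The symmetric matrices of the conics through the points `u i`. -/
def conicsThrough {ι : Type*} (u : ι → Fin 3 → k) : Submodule k (Matrix (Fin 3) (Fin 3) k) where
  carrier := {C | C.IsSymm ∧ ∀ i, u i ⬝ᵥ C *ᵥ u i = 0}
  add_mem' := fun hA hB => ⟨hA.1.add hB.1, fun i => by
    rw [add_mulVec, dotProduct_add, hA.2, hB.2, add_zero]⟩
  zero_mem' := ⟨isSymm_zero, fun i => by rw [zero_mulVec, dotProduct_zero]⟩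
  smul_mem' := fun c _ hC => ⟨hC.1.smul c, fun i => by
    rw [smul_mulVec, dotProduct_smul, hC.2, smul_zero]⟩

/-- The values of a quadratic form at the vertices of the diagonal triangle of a frame; the matrix
of a conic through the frame is diagonal in this triangle, with these entries. -/
def frameCoord (u : Fin 4 → Fin 3 → k) : Matrix (Fin 3) (Fin 3) k →ₗ[k] Fin 3 → k where
  toFun C j := (u 0 + u j.succ) ⬝ᵥ C *ᵥ (u 0 + u j.succ)
  map_add' A B := funext fun j => by simp only [add_mulVec, dotProduct_add, Pi.add_apply]
  map_smul' c C := funext fun j => by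
    simp only [smul_mulVec, dotProduct_smul, Pi.smul_apply, RingHom.id_apply]

/-- The index of the pair of opposite sides of a quadrangle containing the side `i j`. -/
def pairIndex : Fin 4 → Fin 4 → Fin 3 :=
  ![![0, 0, 1, 2], ![0, 0, 2, 1], ![1, 2, 0, 0], ![2, 1, 0, 0]]

variable {u : Fin 4 → Fin 3 → k}

theorem sum_signVec : ∑ i, signVec k i = 0 := by
  ext j
  fin_cases j <;> simp [Fin.sum_univ_four, signVec]

theorem signVec_mul_self (i : Fin 4) (j : Fin 3) : signVec k i j * signVec k i j = 1 := by
  fin_cases i <;> fin_cases j <;> simp [signVec]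

theorem exists_mem_span_signVec {y : Fin 3 → k} (h0 : y 0 ^ 2 = y 2 ^ 2) (h1 : y 1 ^ 2 = y 2 ^ 2) :
    ∃ i, y ∈ k ∙ signVec k i := by
  have hsign (i : Fin 4) (hi0 : y 2 * signVec k i 0 = y 0 * signVec k i 2)
      (hi1 : y 2 * signVec k i 1 = y 1 * signVec k i 2) : y ∈ k ∙ signVec k i := by
    have hi2 := signVec_mul_self (k := k) i 2
    refine Submodule.mem_span_singleton.mpr ⟨y 2 * signVec k i 2, funext fun j => ?_⟩
    rw [Pi.smul_apply, smul_eq_mul]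
    fin_cases j <;> simp only [Fin.zero_eta, Fin.mk_one, Fin.reduceFinMk]
    · linear_combination signVec k i 2 * hi0 + y 0 * hi2
    · linear_combination signVec k i 2 * hi1 + y 1 * hi2
    · linear_combination y 2 * hi2
  rcases sq_eq_sq_iff_eq_or_eq_neg.mp h0 with h0 | h0 <;>
    rcases sq_eq_sq_iff_eq_or_eq_neg.mp h1 with h1 | h1
  · exact ⟨0, hsign 0 (by simp [signVec, h0]) (by simp [signVec, h1])⟩
  · exact ⟨2, hsign 2 (by simp [signVec, h0]) (by simp [signVec, h1])⟩
  · exact ⟨1, hsign 1 (by simp [signVec, h0]) (by simp [signVec, h1])⟩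
  · exact ⟨3, hsign 3 (by simp [signVec, h0]) (by simp [signVec, h1])⟩

theorem frameMatrix_mulVec_signVec (hu : ∑ i, u i = 0) (i : Fin 4) :
    frameMatrix u *ᵥ signVec k i = (2 : k) • u i := by
  ext j
  have h := congrFun hu j
  simp only [Fin.sum_univ_four, Pi.add_apply, Pi.zero_apply] at h
  fin_cases i <;>
  simp only [frameMatrix, signVec, mulVec, vec3_dotProduct, of_apply, Fin.zero_eta, Fin.mk_one,
    Fin.reduceFinMk, cons_val_zero, cons_val_one, cons_val, Fin.succ_zero_eq_one,
    Fin.succ_one_eq_two, Fin.reduceSucc, Pi.smul_apply, smul_eq_mul] <;>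
  first | linear_combination h | linear_combination -h

theorem frameCoord_pairIndex (hu : ∑ i, u i = 0) (C : Matrix (Fin 3) (Fin 3) k) {i j : Fin 4}
    (hij : i ≠ j) : frameCoord u C (pairIndex i j) = (u i + u j) ⬝ᵥ C *ᵥ (u i + u j) := by
  have hside : u i + u j = u 0 + u (pairIndex i j).succ ∨
      u i + u j = -(u 0 + u (pairIndex i j).succ) := by
    rw [Fin.sum_univ_four] at hu
    fin_cases i <;> fin_cases j <;> first | exact absurd rfl hij | skip
    all_goals simp only [pairIndex, Fin.zero_eta, Fin.mk_one, Fin.reduceFinMk, cons_val_zero,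
      cons_val_one, cons_val, Fin.succ_zero_eq_one, Fin.succ_one_eq_two, Fin.reduceSucc, true_or]
    all_goals first
      | (left; exact add_comm _ _)
      | (right; linear_combination (exp := 1) hu)
  rcases hside with h | h <;> rw [h]
  · rfl
  · rw [mulVec_neg, neg_dotProduct_neg]
    rfl

theorem frameCoord_pairIndex_eq_two_mul (hu : ∑ i, u i = 0) {C : Matrix (Fin 3) (Fin 3) k}
    (hC : C ∈ conicsThrough u) {i j : Fin 4} (hij : i ≠ j) :
    frameCoord u C (pairIndex i j) = 2 * (u i ⬝ᵥ C *ᵥ u j) := by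
  rw [frameCoord_pairIndex hu C hij, mulVec_add, dotProduct_add, add_dotProduct, add_dotProduct,
    hC.2, hC.2, dotProduct_mulVec_comm hC.1 (u j)]
  ring

theorem sum_frameCoord (hu : ∑ i, u i = 0) {C : Matrix (Fin 3) (Fin 3) k}
    (hC : C ∈ conicsThrough u) : ∑ j, frameCoord u C j = 0 := by
  have h0 : ∑ j : Fin 3, u 0 ⬝ᵥ C *ᵥ u j.succ = 0 := by
    have h : ∑ i, u 0 ⬝ᵥ C *ᵥ u i = 0 := by
      rw [← dotProduct_sum, ← mulVec_sum, hu, mulVec_zero, dotProduct_zero]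
    rwa [Fin.sum_univ_succ, hC.2 0, zero_add] at h
  have hpair (j : Fin 3) : frameCoord u C j = 2 * (u 0 ⬝ᵥ C *ᵥ u j.succ) := by
    rw [← frameCoord_pairIndex_eq_two_mul hu hC (Fin.succ_ne_zero j).symm]
    fin_cases j <;> rfl
  rw [Finset.sum_congr rfl fun j _ => hpair j, ← Finset.mul_sum, h0, mul_zero]

theorem transpose_mul_mul_apply {R m n : Type*} [CommSemiring R] [Fintype m] (N : Matrix m n R)
    (C : Matrix m m R) (i j : n) : (Nᵀ * C * N) i j = N.col i ⬝ᵥ C *ᵥ N.col j := by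
  rw [Matrix.mul_assoc, mul_apply]
  simp only [dotProduct, mulVec, mul_apply, transpose_apply, col_apply]

namespace IsFrame

theorem two_ne_zero (hu : IsFrame u) : (2 : k) ≠ 0 := by
  intro h2
  have h := frameMatrix_mulVec_signVec hu.sum_eq_zero 0
  rw [h2, zero_smul] at h
  refine hu.det_ne_zero (exists_mulVec_eq_zero_iff.mp ⟨_, fun h0 => ?_, h⟩)
  exact one_ne_zero (congrFun h0 0)

theorem isUnit_frameMatrix (hu : IsFrame u) : IsUnit (frameMatrix u) :=
  (isUnit_iff_isUnit_det _).mpr hu.det_ne_zero.isUnit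

section Pencil

variable {A B C : Matrix (Fin 3) (Fin 3) k}

theorem conj_eq_diagonal (hu : IsFrame u) (hC : C ∈ conicsThrough u) :
    (frameMatrix u)ᵀ * C * frameMatrix u = diagonal (frameCoord u C) := by
  have hcol (j : Fin 3) : (frameMatrix u).col j = u 0 + u j.succ := rfl
  ext i j
  rw [transpose_mul_mul_apply, hcol, hcol]
  rcases eq_or_ne i j with rfl | hij
  · rw [diagonal_apply_eq]
    rfl
  · rw [diagonal_apply_ne _ hij]
    apply mul_left_cancel₀ hu.two_ne_zero
    have hpair {i j : Fin 4} (h : i ≠ j) := frameCoord_pairIndex_eq_two_mul hu.sum_eq_zero hC h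
    have h0i := hpair (Fin.succ_ne_zero i)
    have h0j := hpair (Fin.succ_ne_zero j).symm
    have hij' := hpair ((Fin.succ_injective 3).ne hij)
    have hsum := sum_frameCoord hu.sum_eq_zero hC
    rw [Fin.sum_univ_three] at hsum
    simp only [mulVec_add, dotProduct_add, add_dotProduct, hC.2, zero_add, mul_add, mul_zero,
      ← h0i, ← h0j, ← hij']
    fin_cases i <;> fin_cases j <;> first | exact absurd rfl hij | skip
    all_goals
      simp only [pairIndex, Fin.zero_eta, Fin.mk_one, Fin.reduceFinMk, Fin.succ_zero_eq_one,
        Fin.succ_one_eq_two, Fin.reduceSucc, cons_val_zero, cons_val_one, cons_val]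
      linear_combination hsum

theorem det_ne_zero_iff (hu : IsFrame u) (hC : C ∈ conicsThrough u) :
    C.det ≠ 0 ↔ ∀ j, frameCoord u C j ≠ 0 := by
  have hdet := congrArg det (hu.conj_eq_diagonal hC)
  rw [det_mul, det_mul, det_transpose, det_diagonal] at hdet
  have hprod : (∀ j, frameCoord u C j ≠ 0) ↔ ∏ j, frameCoord u C j ≠ 0 := by
    simp [Finset.prod_ne_zero_iff]
  rw [hprod, ← hdet]
  simp [hu.det_ne_zero]

theorem eq_zero_of_frameCoord_eq_zero (hu : IsFrame u) (hC : C ∈ conicsThrough u) {i j : Fin 3}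
    (hij : i ≠ j) (hi : frameCoord u C i = 0) (hj : frameCoord u C j = 0) : C = 0 := by
  have hsum := sum_frameCoord hu.sum_eq_zero hC
  rw [Fin.sum_univ_three] at hsum
  have h0 : frameCoord u C = 0 := by
    ext l
    fin_cases i <;> fin_cases j <;> fin_cases l <;> simp_all
  have hconj := hu.conj_eq_diagonal hC
  rwa [h0, diagonal_zero', hu.isUnit_frameMatrix.mul_left_eq_zero,
    ((isUnit_transpose _).mpr hu.isUnit_frameMatrix).mul_right_eq_zero] at hconj

theorem frameCoord_mul_ne (hu : IsFrame u) (hA : A ∈ conicsThrough u) (hB : B ∈ conicsThrough u)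
    (hAB : LinearIndependent k ![A, B]) {i j : Fin 3} (hij : i ≠ j) :
    frameCoord u A i * frameCoord u B j ≠ frameCoord u A j * frameCoord u B i := by
  intro h
  have hzero (l : Fin 3) (hl : l = i ∨ l = j) : frameCoord u B l = 0 := by
    have hmem : frameCoord u B l • A + -frameCoord u A l • B ∈ conicsThrough u :=
      add_mem (Submodule.smul_mem _ _ hA) (Submodule.smul_mem _ _ hB)
    refine (LinearIndependent.pair_iff.mp hAB _ _
      (hu.eq_zero_of_frameCoord_eq_zero hmem hij ?_ ?_)).1 <;>
    rcases hl with rfl | rfl <;>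
    simp only [map_add, map_smul, Pi.add_apply, Pi.smul_apply, smul_eq_mul]
    all_goals first | ring1 | linear_combination h | linear_combination -h
  exact hAB.ne_zero 1 (hu.eq_zero_of_frameCoord_eq_zero hB hij (hzero i (.inl rfl))
    (hzero j (.inr rfl)))

theorem exists_mem_span_of_isotropic (hu : IsFrame u) (hA : A ∈ conicsThrough u)
    (hB : B ∈ conicsThrough u) (hAB : LinearIndependent k ![A, B]) {x : Fin 3 → k}
    (hxA : x ⬝ᵥ A *ᵥ x = 0) (hxB : x ⬝ᵥ B *ᵥ x = 0) : ∃ i, x ∈ k ∙ u i := by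
  obtain ⟨y, rfl⟩ := mulVec_surjective_iff_isUnit.mpr hu.isUnit_frameMatrix x
  rw [mulVec_dotProduct_mulVec_mulVec, hu.conj_eq_diagonal ‹_›] at hxA hxB
  simp only [dotProduct, mulVec_diagonal, Fin.sum_univ_three] at hxA hxB
  have hsumA := sum_frameCoord hu.sum_eq_zero hA
  have hsumB := sum_frameCoord hu.sum_eq_zero hB
  rw [Fin.sum_univ_three] at hsumA hsumB
  have hminor := sub_ne_zero.mpr (hu.frameCoord_mul_ne hA hB hAB zero_ne_one)
  obtain ⟨i, hi⟩ : ∃ i, y ∈ k ∙ signVec k i := by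
    refine exists_mem_span_signVec (mul_left_cancel₀ hminor ?_) (mul_left_cancel₀ hminor ?_)
    · linear_combination frameCoord u B 1 * (hxA - y 2 ^ 2 * hsumA)
        - frameCoord u A 1 * (hxB - y 2 ^ 2 * hsumB)
    · linear_combination frameCoord u A 0 * (hxB - y 2 ^ 2 * hsumB)
        - frameCoord u B 0 * (hxA - y 2 ^ 2 * hsumA)
  refine ⟨i, ?_⟩
  have h := mulVec_mem_span_singleton (frameMatrix u) hi
  rwa [frameMatrix_mulVec_signVec hu.sum_eq_zero,
    Submodule.span_singleton_smul_eq hu.two_ne_zero.isUnit] at h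

theorem eq_zero_of_mulVec_eq_zero (hu : IsFrame u) (hC : C ∈ conicsThrough u) {i : Fin 4}
    (h : C *ᵥ u i = 0) : C = 0 := by
  have hdiag : diagonal (frameCoord u C) *ᵥ signVec k i = 0 := by
    rw [← hu.conj_eq_diagonal hC, ← mulVec_mulVec, frameMatrix_mulVec_signVec hu.sum_eq_zero,
      mulVec_smul, ← mulVec_mulVec, h, mulVec_zero, smul_zero]
  have hcoord (j : Fin 3) : frameCoord u C j = 0 := by
    have hj := congrFun hdiag j
    rw [mulVec_diagonal, Pi.zero_apply] at hj
    linear_combination signVec k i j * hj - frameCoord u C j * signVec_mul_self (k := k) i j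
  exact hu.eq_zero_of_frameCoord_eq_zero hC zero_ne_one (hcoord 0) (hcoord 1)

theorem linearIndependent_mulVec (hu : IsFrame u) (hA : A ∈ conicsThrough u)
    (hB : B ∈ conicsThrough u) (hAB : LinearIndependent k ![A, B]) (i : Fin 4) :
    LinearIndependent k ![A *ᵥ u i, B *ᵥ u i] := by
  refine LinearIndependent.pair_iff.mpr fun s t hst => LinearIndependent.pair_iff.mp hAB s t ?_
  refine hu.eq_zero_of_mulVec_eq_zero (i := i)
    (add_mem (Submodule.smul_mem _ _ hA) (Submodule.smul_mem _ _ hB)) ?_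
  rw [add_mulVec, smul_mulVec, smul_mulVec, hst]

theorem span_pair_eq_conicsThrough (hu : IsFrame u) (hA : A ∈ conicsThrough u)
    (hB : B ∈ conicsThrough u) (hAB : LinearIndependent k ![A, B]) :
    Submodule.span k {A, B} = conicsThrough u := by
  refine le_antisymm (Submodule.span_le.mpr (by simp [Set.pair_subset_iff, hA, hB]))
    fun C hC => ?_
  have hminor := sub_ne_zero.mpr (hu.frameCoord_mul_ne hA hB hAB zero_ne_one)
  set D := frameCoord u A 0 * frameCoord u B 1 - frameCoord u A 1 * frameCoord u B 0
  -- Cramer's rule for the first two coordinates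
  refine Submodule.mem_span_pair.mpr
    ⟨(frameCoord u C 0 * frameCoord u B 1 - frameCoord u C 1 * frameCoord u B 0) / D,
      (frameCoord u A 0 * frameCoord u C 1 - frameCoord u A 1 * frameCoord u C 0) / D, ?_⟩
  rw [← sub_eq_zero]
  refine hu.eq_zero_of_frameCoord_eq_zero (sub_mem (add_mem (Submodule.smul_mem _ _ hA)
    (Submodule.smul_mem _ _ hB)) hC) zero_ne_one ?_ ?_ <;>
  · simp only [map_sub, map_add, map_smul, Pi.sub_apply, Pi.add_apply, Pi.smul_apply, smul_eq_mul]
    field_simp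
    ring

end Pencil

theorem eq_of_sum_smul_eq_zero (hu : IsFrame u) {c : Fin 4 → k} (h : ∑ i, c i • u i = 0)
    (i j : Fin 4) : c i = c j := by
  have hsign : ∑ i, c i • signVec k i = 0 := by
    apply mulVec_injective_iff_isUnit.mpr hu.isUnit_frameMatrix
    simp only [mulVec_sum, mulVec_smul, frameMatrix_mulVec_signVec hu.sum_eq_zero,
      smul_comm _ (2 : k), ← Finset.smul_sum, h, smul_zero, mulVec_zero]
  have h0 := congrFun hsign 0
  have h1 := congrFun hsign 1
  have h2 := congrFun hsign 2
  simp only [Fin.sum_univ_four, signVec, Pi.add_apply, Pi.smul_apply, smul_eq_mul, Pi.zero_apply,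
    cons_val_zero, cons_val_one, cons_val] at h0 h1 h2
  have hconst (i : Fin 4) : c i = c 0 := by
    apply mul_left_cancel₀ hu.two_ne_zero
    fin_cases i <;> simp only [Fin.zero_eta, Fin.mk_one, Fin.reduceFinMk]
    · linear_combination -h1 - h2
    · linear_combination -h0 - h2
    · linear_combination -h0 - h1
  rw [hconst i, hconst j]

theorem exists_smul_eq {v : Fin 4 → Fin 3 → k} (hu : IsFrame u) (hv : ∑ i, v i = 0)
    (h : ∀ i, v i ∈ k ∙ u i) : ∃ c : k, ∀ i, c • u i = v i := by
  simp only [Submodule.mem_span_singleton] at h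
  choose c hc using h
  refine ⟨c 0, fun i => ?_⟩
  rw [← hc, hu.eq_of_sum_smul_eq_zero (c := c) (by simpa only [hc] using hv) 0 i]

theorem notMem_span (hu : IsFrame u) {i j : Fin 4} (hij : i ≠ j) : u j ∉ k ∙ u i := by
  intro h
  obtain ⟨c, hc⟩ := Submodule.mem_span_singleton.mp h
  obtain ⟨l, hli, hlj⟩ : ∃ l, l ≠ i ∧ l ≠ j :=
    (by decide : ∀ i j : Fin 4, ∃ l, l ≠ i ∧ l ≠ j) i j
  have hsum : ∑ m, (Pi.single j 1 - Pi.single i c : Fin 4 → k) m • u m = 0 := by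
    simp [sub_smul, Finset.sum_sub_distrib, Pi.single_apply, ite_smul, hc]
  simpa [hij, hij.symm, hli, hlj] using hu.eq_of_sum_smul_eq_zero hsum j l

theorem ne_zero (hu : IsFrame u) (i : Fin 4) : u i ≠ 0 := by
  intro h
  obtain ⟨j, hj⟩ := exists_ne i
  exact hu.notMem_span hj (h ▸ zero_mem _)

theorem smul (hu : IsFrame u) {c : k} (hc : c ≠ 0) : IsFrame fun i => c • u i := by
  refine ⟨by rw [← Finset.smul_sum, hu.sum_eq_zero, smul_zero], ?_⟩
  have hmatrix : frameMatrix (fun i => c • u i) = c • frameMatrix u := by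
    ext i j
    simp [frameMatrix, mul_add]
  rw [hmatrix, det_smul]
  exact mul_ne_zero (pow_ne_zero _ hc) hu.det_ne_zero

end IsFrame

theorem isFrame_iff_forall_dotProduct_eq_zero [NeZero (2 : k)] (hu : ∑ i, u i = 0) :
    IsFrame u ↔ ∀ f : Fin 3 → k, (∀ i, f ⬝ᵥ u i = 0) → f = 0 := by
  have hker (f : Fin 3 → k) : f ᵥ* frameMatrix u = 0 ↔ ∀ i, f ⬝ᵥ u i = 0 := by
    constructor
    · intro h i
      have h2 : f ⬝ᵥ ((2 : k) • u i) = 0 := by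
        rw [← frameMatrix_mulVec_signVec hu, dotProduct_mulVec, h, zero_dotProduct]
      rw [dotProduct_smul, smul_eq_mul] at h2
      exact (mul_eq_zero.mp h2).resolve_left two_ne_zero
    · intro h
      ext j
      change f ⬝ᵥ (u 0 + u j.succ) = 0
      rw [dotProduct_add, h, h, add_zero]
  have hdet : (frameMatrix u).det ≠ 0 ↔ ∀ f : Fin 3 → k, (∀ i, f ⬝ᵥ u i = 0) → f = 0 := by
    rw [Ne, ← exists_vecMul_eq_zero_iff]
    simp only [hker, not_exists, not_and', not_not, ne_eq]
  exact ⟨fun h => hdet.mp h.det_ne_zero, fun h => ⟨hu, hdet.mpr h⟩⟩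

namespace IsFrame

theorem comp (hu : IsFrame u) (π : Equiv.Perm (Fin 4)) : IsFrame (u ∘ π) := by
  have : NeZero (2 : k) := ⟨hu.two_ne_zero⟩
  refine (isFrame_iff_forall_dotProduct_eq_zero ((Equiv.sum_comp π u).trans hu.sum_eq_zero)).mpr
    fun f hf => ?_
  refine (isFrame_iff_forall_dotProduct_eq_zero hu.sum_eq_zero).mp hu f fun i => ?_
  simpa using hf (π.symm i)

end IsFrame

end Frames

section SimultaneousDiagonalisation

variable {k : Type*} [Field k]

theorem eq_of_relative_eigenvector_of_dotProduct_eq_zero [IsAlgClosed k] {n : Type*} [Fintype n]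
    {A B : Matrix n n k} (hA : A.IsSymm)
    (haniso : ∀ x, x ≠ 0 → ∀ c : k, B *ᵥ x = c • A *ᵥ x → x ⬝ᵥ A *ᵥ x ≠ 0) {v w : n → k} {c : k}
    (hv : v ≠ 0) (hvc : B *ᵥ v = c • A *ᵥ v) (hwc : B *ᵥ w = c • A *ᵥ w)
    (hvw : v ⬝ᵥ A *ᵥ w = 0) : w = 0 := by
  by_contra hw
  have hvA := haniso v hv c hvc
  obtain ⟨s, hs⟩ := IsAlgClosed.exists_pow_nat_eq (-(v ⬝ᵥ A *ᵥ v) / (w ⬝ᵥ A *ᵥ w)) two_pos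
  rw [eq_div_iff (haniso w hw c hwc)] at hs
  refine haniso (v + s • w) (fun h0 => hvA ?_) c ?_ ?_
  · have h := congrArg (fun x => v ⬝ᵥ A *ᵥ x) h0
    simpa only [mulVec_add, mulVec_smul, dotProduct_add, dotProduct_smul, hvw, smul_zero, add_zero,
      mulVec_zero, dotProduct_zero] using h
  · rw [mulVec_add, mulVec_smul, hvc, hwc, mulVec_add, mulVec_smul, smul_add, smul_comm s]
  · simp only [mulVec_add, mulVec_smul, dotProduct_add, dotProduct_smul, add_dotProduct,
      smul_dotProduct, hvw, dotProduct_mulVec_comm hA w v, zero_add, smul_eq_mul]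
    linear_combination hs

variable {n : ℕ} {A B : Matrix (Fin n) (Fin n) k}

theorem exists_relative_eigenvector_of_dotProduct_eq_zero [IsAlgClosed k] (hA : A.IsSymm)
    (hB : B.IsSymm) (hAu : IsUnit A) {m : ℕ} (hm : m < n) {v : Fin m → Fin n → k} {c : Fin m → k}
    (hv : ∀ i, B *ᵥ v i = c i • A *ᵥ v i) :
    ∃ x, x ≠ 0 ∧ (∃ d : k, B *ᵥ x = d • A *ᵥ x) ∧ ∀ i, v i ⬝ᵥ A *ᵥ x = 0 := by
  have hdet : IsUnit A.det := (isUnit_iff_isUnit_det A).mp hAu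
  set V := LinearMap.ker (toLin' (of v * A))
  have hV (x : Fin n → k) : x ∈ V ↔ ∀ i, v i ⬝ᵥ A *ᵥ x = 0 := by
    rw [LinearMap.mem_ker, toLin'_apply, ← mulVec_mulVec, funext_iff]
    rfl
  have hmaps (x : Fin n → k) (hx : x ∈ V) : toLin' (A⁻¹ * B) x ∈ V := by
    rw [hV] at hx ⊢
    intro i
    rw [toLin'_apply, mulVec_mulVec, mul_nonsing_inv_cancel_left _ _ hdet,
      dotProduct_mulVec_comm hB, hv, dotProduct_smul, dotProduct_mulVec_comm hA, hx, smul_zero]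
  have : Nontrivial V := Submodule.nontrivial_iff_ne_bot.mpr
    (LinearMap.ker_ne_bot_of_finrank_lt (by simpa using hm))
  obtain ⟨d, hd⟩ := Module.End.exists_eigenvalue ((toLin' (A⁻¹ * B)).restrict hmaps)
  obtain ⟨x, hx, hx0⟩ := hd.exists_hasEigenvector
  have hxd : (A⁻¹ * B) *ᵥ (x : Fin n → k) = d • (x : Fin n → k) :=
    congrArg Subtype.val (Module.End.mem_eigenspace_iff.mp hx)
  refine ⟨x, by simpa using hx0, ⟨d, ?_⟩, (hV x).mp x.2⟩
  rw [← mulVec_smul, ← hxd, mulVec_mulVec, mul_nonsing_inv_cancel_left _ _ hdet]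

theorem exists_orthogonal_relative_eigenvectors [IsAlgClosed k] (hA : A.IsSymm) (hB : B.IsSymm)
    (hAu : IsUnit A) {m : ℕ} (hm : m ≤ n) :
    ∃ (v : Fin m → Fin n → k) (c : Fin m → k), (∀ i, v i ≠ 0) ∧
      (∀ i, B *ᵥ v i = c i • A *ᵥ v i) ∧ Pairwise fun i j => v i ⬝ᵥ A *ᵥ v j = 0 := by
  induction m with
  | zero => exact ⟨0, 0, fun i => i.elim0, fun i => i.elim0, fun i => i.elim0⟩
  | succ m ih =>
    obtain ⟨v, c, hv0, hv, horth⟩ := ih (Nat.le_of_succ_le hm)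
    obtain ⟨x, hx0, ⟨d, hx⟩, hvx⟩ :=
      exists_relative_eigenvector_of_dotProduct_eq_zero hA hB hAu hm hv
    refine ⟨Fin.cons x v, Fin.cons d c, Fin.cases hx0 hv0, Fin.cases hx hv, fun i j hij => ?_⟩
    cases i using Fin.cases with
    | zero =>
      cases j using Fin.cases with
      | zero => exact absurd rfl hij
      | succ j => exact (dotProduct_mulVec_comm hA _ _).trans (hvx j)
    | succ i =>
      cases j using Fin.cases with
      | zero => exact hvx i
      | succ j => exact horth fun h => hij (congrArg Fin.succ h)

theorem exists_conj_eq_diagonal [IsAlgClosed k] (hA : A.IsSymm) (hB : B.IsSymm) (hAu : IsUnit A)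
    (haniso : ∀ x, x ≠ 0 → ∀ c : k, B *ᵥ x = c • A *ᵥ x → x ⬝ᵥ A *ᵥ x ≠ 0) :
    ∃ (N : Matrix (Fin n) (Fin n) k) (a c : Fin n → k), (∀ i, a i ≠ 0) ∧ Function.Injective c ∧
      Nᵀ * A * N = diagonal a ∧ Nᵀ * B * N = diagonal fun i => c i * a i := by
  obtain ⟨v, c, hv0, hv, horth⟩ := exists_orthogonal_relative_eigenvectors hA hB hAu le_rfl
  refine ⟨(of v)ᵀ, fun i => v i ⬝ᵥ A *ᵥ v i, c, fun i => haniso _ (hv0 i) _ (hv i),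
    fun i j hij => ?_, ?_, ?_⟩
  · by_contra hne
    exact hv0 j (eq_of_relative_eigenvector_of_dotProduct_eq_zero hA haniso (hv0 i) (hv i)
      (hij ▸ hv j) (horth hne))
  all_goals
    ext i j
    rw [transpose_mul_mul_apply]
    change v i ⬝ᵥ _ *ᵥ v j = _
    rcases eq_or_ne i j with rfl | hij
    · rw [diagonal_apply_eq]
      try rw [hv, dotProduct_smul, smul_eq_mul]
    · rw [diagonal_apply_ne _ hij]
      try rw [hv, dotProduct_smul]
      rw [horth hij]
      try rw [smul_zero]

end SimultaneousDiagonalisation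

section FrameExistence

variable {k : Type*} [Field k] {N A B C : Matrix (Fin 3) (Fin 3) k}

theorem isFrame_mulVec_signVec [NeZero (2 : k)] (hN : IsUnit N) :
    IsFrame fun i => N *ᵥ signVec k i := by
  refine ⟨by rw [← mulVec_sum, sum_signVec, mulVec_zero], ?_⟩
  have hmatrix : frameMatrix (fun i => N *ᵥ signVec k i) = (2 : k) • N := by
    ext i j
    simp only [frameMatrix, of_apply, ← Pi.add_apply, ← mulVec_add]
    fin_cases j <;> simp [mulVec, dotProduct, Fin.sum_univ_three, signVec] <;> ring
  rw [hmatrix, det_smul]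
  exact mul_ne_zero (pow_ne_zero _ two_ne_zero) ((isUnit_iff_isUnit_det N).mp hN).ne_zero

theorem mem_conicsThrough_mulVec_signVec (hC : C.IsSymm) {e : Fin 3 → k}
    (hNC : Nᵀ * C * N = diagonal e) (he : ∑ i, e i = 0) :
    C ∈ conicsThrough fun i => N *ᵥ signVec k i := by
  refine ⟨hC, fun i => ?_⟩
  rw [mulVec_dotProduct_mulVec_mulVec, hNC, ← he, dotProduct]
  refine Finset.sum_congr rfl fun j _ => ?_
  rw [mulVec_diagonal]
  linear_combination e j * signVec_mul_self (k := k) i j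

theorem exists_isFrame [IsAlgClosed k] [NeZero (2 : k)] (hA : A.IsSymm) (hB : B.IsSymm)
    (hAu : IsUnit A)
    (hAB : ∀ x, x ≠ 0 → x ⬝ᵥ A *ᵥ x = 0 → x ⬝ᵥ B *ᵥ x = 0 →
      LinearIndependent k ![A *ᵥ x, B *ᵥ x]) :
    ∃ u : Fin 4 → Fin 3 → k, IsFrame u ∧ A ∈ conicsThrough u ∧ B ∈ conicsThrough u := by
  obtain ⟨N, a, c, ha, hc, hNA, hNB⟩ := exists_conj_eq_diagonal hA hB hAu fun x hx c hc h0 => by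
    have hind := hAB x hx h0 (by rw [hc, dotProduct_smul, h0, smul_zero])
    exact one_ne_zero (LinearIndependent.pair_iff.mp hind (-c) 1 (by rw [hc]; simp)).2
  -- The forms `∑ i, e i * y i ^ 2` and `∑ i, c i * e i * y i ^ 2` vanish at all sign vectors.
  set e : Fin 3 → k := ![c 1 - c 2, c 2 - c 0, c 0 - c 1] with he
  have he0 (i : Fin 3) : e i ≠ 0 := by
    fin_cases i <;> exact sub_ne_zero.mpr (hc.ne (by decide))
  choose s hs using fun i => IsAlgClosed.exists_pow_nat_eq (e i / a i) two_pos
  have hconj {C : Matrix (Fin 3) (Fin 3) k} {d : Fin 3 → k}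
      (hC : Nᵀ * C * N = diagonal fun i => d i * a i) :
      (N * diagonal s)ᵀ * C * (N * diagonal s) = diagonal fun i => d i * e i := by
    rw [transpose_mul, diagonal_transpose, ← Matrix.mul_assoc, Matrix.mul_assoc (diagonal s),
      Matrix.mul_assoc (diagonal s), hC, diagonal_mul_diagonal, diagonal_mul_diagonal]
    congr 1 with i
    have hsi : s i ^ 2 * a i = e i := by rw [hs, div_mul_cancel₀ _ (ha i)]
    linear_combination d i * hsi
  have hconjA : (N * diagonal s)ᵀ * A * (N * diagonal s) = diagonal e := by
    simpa only [one_mul] using hconj (d := fun _ => 1) (by simpa only [one_mul] using hNA)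
  have hunit : IsUnit (N * diagonal s) := by
    refine (isUnit_iff_isUnit_det _).mpr (isUnit_iff_ne_zero.mpr fun h0 => ?_)
    have hdet := congrArg det hconjA
    rw [det_mul, h0, mul_zero, det_diagonal] at hdet
    exact Finset.prod_ne_zero_iff.mpr (fun i _ => he0 i) hdet.symm
  refine ⟨_, isFrame_mulVec_signVec hunit, mem_conicsThrough_mulVec_signVec hA hconjA ?_,
    mem_conicsThrough_mulVec_signVec hB (hconj hNB) ?_⟩ <;>
  · simp only [he, Fin.sum_univ_three, cons_val_zero, cons_val_one, cons_val]
    ring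

end FrameExistence

section BaseChange

variable {K : Type*} (L : Type*) [Field K] [Field L] [Algebra K L] {m n : Type*}

theorem map_mem_span_pair_iff {A B C : Matrix m n K} :
    C.map (algebraMap K L) ∈ Submodule.span L {A.map (algebraMap K L), B.map (algebraMap K L)} ↔
      C ∈ Submodule.span K {A, B} := by
  simp only [Submodule.mem_span_pair]
  constructor
  · rintro ⟨y, z, h⟩
    obtain ⟨r, hr⟩ := (Algebra.linearMap K L).exists_leftInverse_of_injective
      (LinearMap.ker_eq_bot.mpr (algebraMap K L).injective)
    refine ⟨r y, r z, ext fun i j => ?_⟩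
    have hij := congrArg r (congrFun (congrFun h i) j)
    have hcomm (w : L) (x : K) : r (w * algebraMap K L x) = r w * x := by
      rw [mul_comm, ← Algebra.smul_def, map_smul, smul_eq_mul, mul_comm]
    simpa only [Matrix.add_apply, Matrix.smul_apply, map_apply, smul_eq_mul, map_add, hcomm,
      show ∀ x, r (algebraMap K L x) = x from DFunLike.congr_fun hr] using hij
  · rintro ⟨y, z, rfl⟩
    refine ⟨algebraMap K L y, algebraMap K L z, ext fun i j => ?_⟩
    simp [-algebraMap_smul]

end BaseChange

namespace Conic

variable {A B C : Conic F}

theorem geomMatrix_ne_zero (A : Conic F) : A.geomMatrix ≠ 0 := by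
  refine fun h => A.rep_nonzero (Subtype.ext (map_injective (algebraMap F Ω).injective ?_))
  exact h.trans (Matrix.map_zero _ (map_zero _)).symm

theorem mem_pencil_iff :
    C ∈ A.pencil B ↔ C.geomMatrix ∈ Submodule.span Ω {A.geomMatrix, B.geomMatrix} := by
  rw [geomMatrix, geomMatrix, geomMatrix, map_mem_span_pair_iff, pencil, Set.mem_ofPred_eq,
    C.submodule_eq, A.submodule_eq, B.submodule_eq, Submodule.span_singleton_le_iff_mem,
    ← Submodule.span_insert]
  simp only [Submodule.mem_span_pair, Subtype.ext_iff]
  rfl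

theorem eq_of_geomMatrix_mem_span (h : A.geomMatrix ∈ Ω ∙ B.geomMatrix) : A = B := by
  rw [← Set.pair_eq_singleton, ← mem_pencil_iff, pencil, Set.mem_ofPred_eq, sup_idem,
    A.submodule_eq, B.submodule_eq, Submodule.span_singleton_le_iff_mem,
    Submodule.mem_span_singleton] at h
  rwa [← A.mk_rep, ← B.mk_rep, Projectivization.mk_eq_mk_iff']

theorem linearIndependent_geomMatrix (hAB : A ≠ B) :
    LinearIndependent Ω ![A.geomMatrix, B.geomMatrix] :=
  (LinearIndependent.pair_iff' A.geomMatrix_ne_zero).mpr fun _ hc => hAB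
    (eq_of_geomMatrix_mem_span (Submodule.mem_span_singleton.mpr ⟨_, hc⟩)).symm

end Conic

section FramePencil

/-- The conics over `F` through the points of a frame. -/
def framePencil (u : Fin 4 → Fin 3 → Ω) : Set (Conic F) :=
  {C | C.geomMatrix ∈ conicsThrough u}

variable {u : Fin 4 → Fin 3 → AlgebraicClosure F} {A B : Conic F}

theorem isSmooth_iff_frameCoord (hu : IsFrame u) (hA : A ∈ framePencil u) :
    A.IsSmooth ↔ ∀ j, frameCoord u A.geomMatrix j ≠ 0 := by
  rw [Conic.isSmooth_iff, hu.det_ne_zero_iff hA]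

theorem transversal_of_mem_framePencil (hu : IsFrame u) (hA : A ∈ framePencil u)
    (hB : B ∈ framePencil u) (hAB : A ≠ B) : A.Transversal B := by
  have hind := Conic.linearIndependent_geomMatrix hAB
  refine Conic.transversal_iff.mpr fun x hx hxA hxB => ?_
  obtain ⟨i, hi⟩ := hu.exists_mem_span_of_isotropic hA hB hind hxA hxB
  obtain ⟨c, rfl⟩ := Submodule.mem_span_singleton.mp hi
  have hc : c ≠ 0 := by
    rintro rfl
    exact hx (zero_smul _ _)
  have hi := LinearIndependent.pair_iff.mp (hu.linearIndependent_mulVec hA hB hind i)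
  refine LinearIndependent.pair_iff.mpr fun s t hst => hi s t ?_
  rw [mulVec_smul, mulVec_smul, smul_comm s, smul_comm t, ← smul_add] at hst
  exact (smul_eq_zero.mp hst).resolve_left hc

theorem mem_smoothPairs_iff (hu : IsFrame u) (hA : A ∈ framePencil u) (hB : B ∈ framePencil u) :
    (A, B) ∈ smoothPairs F ↔ A.IsSmooth ∧ B.IsSmooth ∧ A ≠ B := by
  refine and_congr_right fun _ => and_congr_right fun _ => ⟨?_, fun hAB =>
    transversal_of_mem_framePencil hu hA hB hAB⟩
  rintro hT rfl
  have hind := Conic.transversal_iff.mp hT (u 0) (hu.ne_zero 0) (hA.2 0) (hA.2 0)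
  exact one_ne_zero (LinearIndependent.pair_iff.mp hind 1 (-1) (by simp)).1

theorem contains_and_contains_iff (hu : IsFrame u) (hA : A ∈ framePencil u)
    (hB : B ∈ framePencil u) (hAB : A ≠ B) (X : GeomPoint F) :
    (A.Contains X ∧ B.Contains X) ↔
      X ∈ Set.range fun i => Projectivization.mk Ω (u i) (hu.ne_zero i) := by
  constructor
  · rintro ⟨hXA, hXB⟩
    obtain ⟨i, hi⟩ := hu.exists_mem_span_of_isotropic hA hB
      (Conic.linearIndependent_geomMatrix hAB) hXA hXB
    refine ⟨i, ?_⟩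
    conv_rhs => rw [← X.mk_rep]
    rw [Projectivization.mk_eq_mk_iff']
    exact Submodule.mem_span_singleton.mp (mem_span_singleton_symm X.rep_nonzero hi)
  · rintro ⟨i, rfl⟩
    exact ⟨(Conic.contains_mk _).mpr (hA.2 i), (Conic.contains_mk _).mpr (hB.2 i)⟩

theorem pencil_eq_framePencil (hu : IsFrame u) (hA : A ∈ framePencil u) (hB : B ∈ framePencil u)
    (hAB : A ≠ B) : A.pencil B = framePencil u := by
  ext C
  rw [Conic.mem_pencil_iff,
    hu.span_pair_eq_conicsThrough hA hB (Conic.linearIndependent_geomMatrix hAB)]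
  rfl

end FramePencil

/-! ### Frobenius and the base points of a pencil -/

section FrameMaps

variable {k : Type*} [Field k]

theorem conicsThrough_le {ι κ : Type*} {u : ι → Fin 3 → k} {v : κ → Fin 3 → k}
    (h : ∀ i, ∃ j, v i ∈ k ∙ u j) : conicsThrough u ≤ conicsThrough v := by
  refine fun C hC => ⟨hC.1, fun i => ?_⟩
  obtain ⟨j, hj⟩ := h i
  obtain ⟨c, hc⟩ := Submodule.mem_span_singleton.mp hj
  rw [← hc, mulVec_smul, dotProduct_smul, smul_dotProduct, hC.2, smul_zero, smul_zero]

theorem IsFrame.map {K : Type*} [Field K] {u : Fin 4 → Fin 3 → k} (hu : IsFrame u) (φ : k →+* K) :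
    IsFrame fun i => φ ∘ u i := by
  constructor
  · ext j
    have hj := congrArg φ (congrFun hu.sum_eq_zero j)
    simpa only [Finset.sum_apply, Function.comp_apply, map_sum, Pi.zero_apply, map_zero] using hj
  · have hmatrix : frameMatrix (fun i => φ ∘ u i) = (frameMatrix u).map φ := by
      ext i j
      exact (map_add φ _ _).symm
    rw [hmatrix, ← RingHom.mapMatrix_apply, ← RingHom.map_det, map_ne_zero]
    exact hu.det_ne_zero

theorem IsFrame.exists_perm_smul_eq {u v : Fin 4 → Fin 3 → k} (hu : IsFrame u) (hv : IsFrame v)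
    (h : ∀ i, ∃ j, v i ∈ k ∙ u j) :
    ∃ (π : Equiv.Perm (Fin 4)) (c : k), c ≠ 0 ∧ ∀ i, v i = c • u (π i) := by
  choose π hπ using h
  have hinj : Function.Injective π := by
    intro i j hij
    by_contra hne
    have hmem := mem_span_singleton_symm (hv.ne_zero i) (hπ i)
    rw [hij] at hmem
    exact hv.notMem_span hne ((Submodule.span_singleton_le_iff_mem _ _).mpr hmem (hπ j))
  let e : Equiv.Perm (Fin 4) := Equiv.ofBijective π (Finite.injective_iff_bijective.mp hinj)
  obtain ⟨c, hc⟩ := (hu.comp e).exists_smul_eq hv.sum_eq_zero hπ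
  refine ⟨e, c, ?_, fun i => (hc i).symm⟩
  rintro rfl
  exact hv.ne_zero 0 (by rw [← hc, zero_smul])

end FrameMaps

section Frobenius

theorem exists_algebraMap_eq_of_pow_card {L : Type*} [Fintype F] [Field L] [Algebra F L] {x : L}
    (hx : x ^ Fintype.card F = x) : ∃ y : F, algebraMap F L y = x := by
  set p : Polynomial F := .X ^ Fintype.card F - .X
  have hsplits : p.Splits := by
    rw [Polynomial.splits_iff_card_roots, FiniteField.roots_X_pow_card_sub_X,
      FiniteField.X_pow_card_sub_X_natDegree_eq F Fintype.one_lt_card, ← Finset.card_def,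
      Finset.card_univ]
  have hroot : x ∈ (p.map (algebraMap F L)).roots := by
    rw [Polynomial.mem_roots (Polynomial.map_ne_zero
      (FiniteField.X_pow_card_sub_X_ne_zero F Fintype.one_lt_card))]
    simp [hx]
  rw [hsplits.roots_map_of_injective (algebraMap F L).injective, Multiset.mem_map] at hroot
  exact hroot.imp fun _ h => h.2

theorem Conic.map_dotProduct_geomMatrix_mulVec (φ : Ω →ₐ[F] Ω) (C : Conic F) (x y : Fin 3 → Ω) :
    φ (x ⬝ᵥ C.geomMatrix *ᵥ y) = (φ ∘ x) ⬝ᵥ C.geomMatrix *ᵥ (φ ∘ y) := by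
  simp only [dotProduct, mulVec, map_sum, map_mul, Function.comp_apply, geomMatrix, map_apply,
    AlgHom.commutes]

variable [Fintype F]

/-- The `q`-power Frobenius permutes the vectors `u i` by `σ`. -/
def IsTwisted (σ : Equiv.Perm (Fin 4)) (u : Fin 4 → Fin 3 → Ω) : Prop :=
  ∀ i j, u i j ^ Fintype.card F = u (σ i) j

/-- The action of a permutation of the points of a quadrangle on its pairs of opposite sides. -/
def pairPerm (σ : Equiv.Perm (Fin 4)) (j : Fin 3) : Fin 3 := pairIndex (σ 0) (σ j.succ)

variable {u : Fin 4 → Fin 3 → AlgebraicClosure F} {σ : Equiv.Perm (Fin 4)} {A B : Conic F}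

theorem frameCoord_pow_card (hu : ∑ i, u i = 0) (hσ : IsTwisted σ u) (C : Conic F) (j : Fin 3) :
    frameCoord u C.geomMatrix j ^ Fintype.card F = frameCoord u C.geomMatrix (pairPerm σ j) := by
  let φ := FiniteField.frobeniusAlgHom F Ω
  have hφ (i : Fin 4) : φ ∘ u i = u (σ i) := funext (hσ i)
  have hadd (x y : Fin 3 → Ω) : φ ∘ (x + y) = φ ∘ x + φ ∘ y := funext fun _ => map_add φ _ _
  rw [pairPerm, frameCoord_pairIndex hu _ (σ.injective.ne (Fin.succ_ne_zero j).symm), ← hφ, ← hφ,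
    ← hadd]
  exact C.map_dotProduct_geomMatrix_mulVec φ _ _

theorem exists_isTwisted_smul {c : Ω} (hc : c ≠ 0)
    (h : ∀ i j, u i j ^ Fintype.card F = c * u (σ i) j) :
    ∃ d : Ω, d ≠ 0 ∧ IsTwisted σ fun i => d • u i := by
  have hq := Fintype.one_lt_card (α := F)
  obtain ⟨d, hd⟩ := IsAlgClosed.exists_pow_nat_eq c⁻¹ (Nat.sub_pos_of_lt hq)
  refine ⟨d, ?_, fun i j => ?_⟩
  · rintro rfl
    rw [zero_pow (Nat.sub_pos_of_lt hq).ne'] at hd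
    exact inv_ne_zero hc hd.symm
  · have hdq : d ^ Fintype.card F = c⁻¹ * d := by
      rw [← hd, ← pow_succ, Nat.sub_add_cancel hq.le]
    change (d * u i j) ^ Fintype.card F = d * u (σ i) j
    rw [mul_pow, h, hdq]
    field_simp

theorem exists_isTwisted [NeZero (2 : F)] (h : (A, B) ∈ smoothPairs F) :
    ∃ (σ : Equiv.Perm (Fin 4)) (u : Fin 4 → Fin 3 → Ω), IsFrame u ∧ IsTwisted σ u ∧
      A ∈ framePencil u ∧ B ∈ framePencil u := by
  obtain ⟨u, hu, hA, hB⟩ := exists_isFrame A.geomMatrix_isSymm B.geomMatrix_isSymm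
    ((isUnit_iff_isUnit_det _).mpr (Conic.isSmooth_iff.mp h.1).isUnit)
    (Conic.transversal_iff.mp h.2.2)
  have hAB : A ≠ B := ((mem_smoothPairs_iff hu hA hB).mp h).2.2
  let φ := FiniteField.frobeniusAlgHom F Ω
  have hφ {C : Conic F} (hC : C.geomMatrix ∈ conicsThrough u) (i : Fin 4) :
      (φ ∘ u i) ⬝ᵥ C.geomMatrix *ᵥ (φ ∘ u i) = 0 := by
    rw [← C.map_dotProduct_geomMatrix_mulVec, hC.2, map_zero]
  obtain ⟨σ, c, hc, hσ⟩ := hu.exists_perm_smul_eq (hu.map φ.toRingHom) fun i =>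
    hu.exists_mem_span_of_isotropic hA hB (Conic.linearIndependent_geomMatrix hAB) (hφ hA i)
      (hφ hB i)
  obtain ⟨d, hd, hdσ⟩ := exists_isTwisted_smul hc fun i j => congrFun (hσ i) j
  have hle : conicsThrough u ≤ conicsThrough fun i => d • u i :=
    conicsThrough_le fun i => ⟨i, Submodule.smul_mem _ _ (Submodule.mem_span_singleton_self _)⟩
  exact ⟨σ, _, hu.smul hd, hdσ, hle hA, hle hB⟩

end Frobenius

section IntersectionType

theorem isConj_of_range_eq {α X : Type*} {f : X → X} {p q : α → X} {σ τ : Equiv.Perm α}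
    (hp : Function.Injective p) (hq : Function.Injective q) (h : Set.range p = Set.range q)
    (hσ : ∀ i, f (p i) = p (σ i)) (hτ : ∀ i, f (q i) = q (τ i)) : IsConj σ τ := by
  let e : Equiv.Perm α :=
    (Equiv.ofInjective p hp).trans ((Equiv.setCongr h).trans (Equiv.ofInjective q hq).symm)
  have he (i : α) : q (e i) = p i := Equiv.apply_ofInjective_symm hq _
  refine isConj_iff.mpr ⟨e, mul_inv_eq_iff_eq_mul.mpr (Equiv.ext fun i => hq ?_)⟩
  rw [Equiv.Perm.mul_apply, Equiv.Perm.mul_apply, he, ← hτ, he, hσ]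

variable [Fintype F]

theorem geomFrobenius_mk {x y : Fin 3 → Ω} (hx : x ≠ 0) (hy : y ≠ 0)
    (h : ∀ j, x j ^ Fintype.card F = y j) : geomFrobenius (.mk Ω x hx) = .mk Ω y hy := by
  rw [geomFrobenius, Projectivization.mk_eq_mk_iff']
  obtain ⟨c, hc⟩ := Projectivization.exists_smul_eq_mk_rep Ω x hx
  refine ⟨(c : Ω) ^ Fintype.card F, funext fun j => ?_⟩
  rw [← hc, Pi.smul_apply, Units.smul_def, Pi.smul_apply, ← h, smul_eq_mul, smul_eq_mul, mul_pow]

theorem hasIntersectionType_iff {u : Fin 4 → Fin 3 → Ω} {σ : Equiv.Perm (Fin 4)} {A B : Conic F}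
    (hu : IsFrame u) (hσ : IsTwisted σ u) (hA : A ∈ framePencil u) (hB : B ∈ framePencil u)
    (hAB : A ≠ B) {τ : Multiset ℕ} : HasIntersectionType A B τ ↔ σ.partition.parts = τ := by
  set p : Fin 4 → GeomPoint F := fun i => .mk Ω (u i) (hu.ne_zero i)
  have hpinj : Function.Injective p := by
    intro i j hij
    by_contra hne
    exact hu.notMem_span (Ne.symm hne) (Submodule.mem_span_singleton.mpr
      ((Projectivization.mk_eq_mk_iff' _ _ _ _ _).mp hij))
  have hpσ (i : Fin 4) : geomFrobenius (p i) = p (σ i) := geomFrobenius_mk _ _ (hσ i)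
  have hmem := contains_and_contains_iff hu hA hB hAB
  constructor
  · rintro ⟨p', σ', hinj', hmem', hσ', rfl⟩
    have hrange : Set.range p = Set.range p' := Set.ext fun X => (hmem X).symm.trans (hmem' X)
    rw [Equiv.Perm.partition_eq_of_isConj.mp (isConj_of_range_eq hpinj hinj' hrange hpσ hσ')]
  · exact fun h => ⟨p, σ, hpinj, hmem, hpσ, h⟩

end IntersectionType

section LineThrough

variable {K V : Type*} [Field K] [AddCommGroup V] [Module K V] {P Q : ℙ K V}

theorem linearIndependent_rep (hPQ : P ≠ Q) : LinearIndependent K ![P.rep, Q.rep] := by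
  have h := Projectivization.independent_iff.mp
    ((Projectivization.independent_pair_iff_ne P Q).mpr hPQ)
  rwa [show Projectivization.rep ∘ ![P, Q] = ![P.rep, Q.rep] from List.ofFn_injective rfl] at h

theorem rep_add_smul_ne_zero (hPQ : P ≠ Q) (x : K) : P.rep + x • Q.rep ≠ 0 := fun h =>
  one_ne_zero (LinearIndependent.pair_iff.mp (linearIndependent_rep hPQ) 1 x
    (by rwa [one_smul])).1

/-- The point with coordinate `x` on the line through the points `P` and `Q` of a projective space,
where `P` has coordinate `0` and `Q` has coordinate `∞`. -/
noncomputable def linePoint (hPQ : P ≠ Q) (x : K) : ℙ K V :=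
  .mk K (P.rep + x • Q.rep) (rep_add_smul_ne_zero hPQ x)

theorem linePoint_injective (hPQ : P ≠ Q) : Function.Injective (linePoint hPQ) := by
  intro x y h
  obtain ⟨a, ha⟩ := (Projectivization.mk_eq_mk_iff' _ _ _ _ _).mp h
  obtain ⟨h1, h2⟩ := LinearIndependent.pair_iff.mp (linearIndependent_rep hPQ) (a - 1) (a * y - x)
    (by linear_combination (norm := module) ha)
  rw [sub_eq_zero.mp h1, one_mul, sub_eq_zero] at h2
  exact h2.symm

theorem range_linePoint (hPQ : P ≠ Q) :
    Set.range (linePoint hPQ) = {R | R.submodule ≤ P.submodule ⊔ Q.submodule} \ {Q} := by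
  have hind := linearIndependent_rep hPQ
  ext R
  rw [Set.mem_sdiff, Set.mem_ofPred_eq, R.submodule_eq, P.submodule_eq, Q.submodule_eq,
    Submodule.span_singleton_le_iff_mem, ← Submodule.span_insert, Submodule.mem_span_pair,
    Set.mem_singleton_iff]
  constructor
  · rintro ⟨x, rfl⟩
    obtain ⟨c, hc⟩ := Projectivization.exists_smul_eq_mk_rep K _ (rep_add_smul_ne_zero hPQ x)
    refine ⟨⟨c, c * x, ?_⟩, fun hQ => ?_⟩
    · rw [linePoint, ← hc, Units.smul_def, smul_add, smul_smul]
    · conv_rhs at hQ => rw [← Q.mk_rep]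
      obtain ⟨a, ha⟩ := (Projectivization.mk_eq_mk_iff' _ _ _ _ _).mp hQ
      refine one_ne_zero (LinearIndependent.pair_iff.mp hind 1 (x - a) ?_).1
      linear_combination (norm := module) -ha
  · rintro ⟨⟨y, z, hR⟩, hRQ⟩
    have hy : y ≠ 0 := by
      rintro rfl
      rw [zero_smul, zero_add] at hR
      refine hRQ ?_
      rw [← R.mk_rep, ← Q.mk_rep, Projectivization.mk_eq_mk_iff']
      exact ⟨z, hR⟩
    refine ⟨y⁻¹ * z, ?_⟩
    conv_rhs => rw [← R.mk_rep]
    rw [linePoint, Projectivization.mk_eq_mk_iff']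
    exact ⟨y⁻¹, by rw [← hR, smul_add, smul_smul, smul_smul, inv_mul_cancel₀ hy, one_smul]⟩

end LineThrough

section PencilMembers

variable {u : Fin 4 → Fin 3 → AlgebraicClosure F} {A B C : Conic F}

/-- The member `C + x B` of the pencil generated by the conics `C` and `B`. -/
noncomputable abbrev member (hCB : C ≠ B) (x : F) : Conic F := linePoint hCB x

theorem exists_geomMatrix_member (hCB : C ≠ B) (x : F) :
    ∃ c : Ω, c ≠ 0 ∧
      (member hCB x).geomMatrix = c • (C.geomMatrix + algebraMap F Ω x • B.geomMatrix) := by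
  obtain ⟨c, hc, h⟩ := Conic.exists_geomMatrix_mk _ (rep_add_smul_ne_zero hCB x)
  refine ⟨c, hc, h.trans (congrArg _ (ext fun i j => ?_))⟩
  exact (map_add (algebraMap F Ω) _ _).trans (congrArg _ (map_mul (algebraMap F Ω) _ _))

theorem exists_frameCoord_member (u : Fin 4 → Fin 3 → Ω) (hCB : C ≠ B) (x : F) :
    ∃ c : Ω, c ≠ 0 ∧ ∀ j, frameCoord u (member hCB x).geomMatrix j =
      c * (frameCoord u C.geomMatrix j + algebraMap F Ω x * frameCoord u B.geomMatrix j) := by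
  obtain ⟨c, hc, h⟩ := exists_geomMatrix_member hCB x
  refine ⟨c, hc, fun j => ?_⟩
  rw [h, map_smul, map_add, map_smul]
  rfl

theorem member_mem_framePencil (hB : B ∈ framePencil u) (hC : C ∈ framePencil u) (hCB : C ≠ B)
    (x : F) : member hCB x ∈ framePencil u := by
  obtain ⟨c, -, h⟩ := exists_geomMatrix_member hCB x
  rw [framePencil, Set.mem_ofPred_eq, h]
  exact Submodule.smul_mem _ _ (add_mem hC (Submodule.smul_mem _ _ hB))

/-- The ratios of the coordinates of two conics through a frame. -/
noncomputable def ratio (u : Fin 4 → Fin 3 → Ω) (C B : Conic F) (j : Fin 3) : Ω :=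
  frameCoord u C.geomMatrix j / frameCoord u B.geomMatrix j

theorem ratio_injective (hu : IsFrame u) (hB : B ∈ framePencil u) (hC : C ∈ framePencil u)
    (hCB : C ≠ B) (hBs : B.IsSmooth) : Function.Injective (ratio u C B) := by
  intro i j hij
  have hb := (isSmooth_iff_frameCoord hu hB).mp hBs
  by_contra hne
  exact hu.frameCoord_mul_ne hC hB (Conic.linearIndependent_geomMatrix hCB) hne
    ((div_eq_div_iff (hb i) (hb j)).mp hij)

theorem ncard_not_injective_frameCoord_le (hu : IsFrame u) :
    {B ∈ framePencil u | ¬ Function.Injective (frameCoord u B.geomMatrix)}.ncard ≤ 3 := by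
  have hcase (B : Conic F) (hB : ¬ Function.Injective (frameCoord u B.geomMatrix)) :
      ∃ i : Fin 3, frameCoord u B.geomMatrix (i + 1) = frameCoord u B.geomMatrix (i + 2) := by
    obtain ⟨i, j, hij, hne⟩ := Function.not_injective_iff.mp hB
    have hindex : ∀ i j : Fin 3, i ≠ j → ∃ l, i = l + 1 ∧ j = l + 2 ∨ j = l + 1 ∧ i = l + 2 := by
      decide
    obtain ⟨l, ⟨rfl, rfl⟩ | ⟨rfl, rfl⟩⟩ := hindex i j hne
    exacts [⟨l, hij⟩, ⟨l, hij.symm⟩]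
  choose! f hf using hcase
  have hcard : (Set.univ : Set (Fin 3)).ncard ≤ 3 := by simp
  refine le_trans (Set.ncard_le_ncard_of_injOn f (fun _ _ => Set.mem_univ _) ?_) hcard
  rintro A ⟨hA, hA'⟩ B ⟨hB, hB'⟩ hAB
  by_contra hne
  refine hu.frameCoord_mul_ne hA hB (Conic.linearIndependent_geomMatrix hne)
    (show f A + 1 ≠ f A + 2 by simp) ?_
  rw [hf A hA', hAB, hf B hB']

theorem isSmooth_member_iff (hu : IsFrame u) (hB : B ∈ framePencil u) (hC : C ∈ framePencil u)
    (hCB : C ≠ B) (hBs : B.IsSmooth) (x : F) :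
    (member hCB x).IsSmooth ↔ ∀ j, algebraMap F Ω x ≠ -ratio u C B j := by
  rw [isSmooth_iff_frameCoord hu (member_mem_framePencil hB hC hCB x)]
  obtain ⟨c, hc, hx⟩ := exists_frameCoord_member u hCB x
  refine forall_congr' fun j => not_congr ?_
  have hb := (isSmooth_iff_frameCoord hu hB).mp hBs j
  rw [hx, mul_eq_zero, or_iff_right hc, add_eq_zero_iff_neg_eq, ratio, ← neg_div, eq_comm,
    eq_div_iff hb]

theorem tetragonCondition_member_iff (hu : IsFrame u) (hB : B ∈ framePencil u)
    (hC : C ∈ framePencil u) (hCB : C ≠ B) (hBs : B.IsSmooth) {x : F}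
    (hx : (member hCB x).IsSmooth) :
    NGonCondition 4 (member hCB x) B ↔
      ∃ j, algebraMap F Ω x = 2 * ratio u C B j - ∑ i, ratio u C B i := by
  have : NeZero (2 : F) :=
    ⟨fun h => hu.two_ne_zero (by rw [← map_ofNat (algebraMap F Ω), h, map_zero])⟩
  have hA := member_mem_framePencil hB hC hCB x
  have ha := (isSmooth_iff_frameCoord hu hA).mp hx
  have hb := (isSmooth_iff_frameCoord hu hB).mp hBs
  obtain ⟨c, hc, hcoord⟩ := exists_frameCoord_member u hCB x
  have hr (j : Fin 3) : frameCoord u (member hCB x).geomMatrix j / frameCoord u B.geomMatrix j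
      = c * (ratio u C B j + algebraMap F Ω x) := by
    rw [hcoord, ratio, mul_div_assoc, add_div, mul_div_cancel_right₀ _ (hb j)]
  rw [tetragonCondition_iff_of_diagonal hu.isUnit_frameMatrix (hu.conj_eq_diagonal hA) ha
    (hu.conj_eq_diagonal hB) hb]
  · refine exists_congr fun j => ?_
    simp only [hr, Fin.sum_univ_three]
    constructor
    · intro h
      apply mul_left_cancel₀ hc
      linear_combination -h
    · intro h
      linear_combination -c * h
  · intro i j hij
    simp only [hr] at hij
    exact ratio_injective hu hB hC hCB hBs (add_right_cancel (mul_left_cancel₀ hc hij))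

end PencilMembers

/-! ### Counting the pairs in a pencil -/

section FiberCounting

variable {α β : Type*} [Finite α] {S : Set (α × β)} {T : Set β} {n : ℕ}

theorem ncard_eq_sum_fiber [Fintype β] : S.ncard = ∑ b, {a | (a, b) ∈ S}.ncard := by
  have e : S ≃ Σ b, {a | (a, b) ∈ S} :=
    { toFun := fun x => ⟨x.1.2, ⟨x.1.1, x.2⟩⟩
      invFun := fun y => ⟨(y.2.1, y.1), y.2.2⟩
      left_inv := fun _ => rfl
      right_inv := fun _ => rfl }
  rw [← Nat.card_coe_set_eq, Nat.card_congr e, Nat.card_sigma]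
  rfl

variable [Finite β]

theorem ncard_mul_le_ncard (h : ∀ b ∈ T, n ≤ {a | (a, b) ∈ S}.ncard) :
    T.ncard * n ≤ S.ncard := by
  classical
  have := Fintype.ofFinite β
  rw [ncard_eq_sum_fiber, Set.ncard_eq_toFinset_card', ← smul_eq_mul]
  exact (Finset.card_nsmul_le_sum _ _ _ fun b hb => h b (Set.mem_toFinset.mp hb)).trans
    (Finset.sum_le_sum_of_subset (Finset.subset_univ _))

theorem ncard_le_ncard_mul (hST : ∀ x ∈ S, x.2 ∈ T) (h : ∀ b ∈ T, {a | (a, b) ∈ S}.ncard ≤ n) :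
    S.ncard ≤ T.ncard * n := by
  classical
  have := Fintype.ofFinite β
  rw [ncard_eq_sum_fiber, Set.ncard_eq_toFinset_card', ← smul_eq_mul,
    ← Finset.sum_subset (Finset.subset_univ T.toFinset)]
  · exact Finset.sum_le_card_nsmul _ _ _ fun b hb => h b (Set.mem_toFinset.mp hb)
  · intro b _ hb
    refine (Set.ncard_eq_zero).mpr (Set.eq_empty_of_forall_notMem fun a ha => hb ?_)
    exact Set.mem_toFinset.mpr (hST _ ha)

end FiberCounting

section FixedPairs

/-- The number of pairs of opposite sides of a quadrangle fixed by a permutation of its points. -/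
def fixedPairs (σ : Equiv.Perm (Fin 4)) : ℕ := (Finset.univ.filter fun j => pairPerm σ j = j).card

theorem fixedPairs_le (σ : Equiv.Perm (Fin 4)) : fixedPairs σ ≤ 3 :=
  (Finset.card_le_univ _).trans_eq (Fintype.card_fin 3)

theorem pairPerm_injective (σ : Equiv.Perm (Fin 4)) : Function.Injective (pairPerm σ) := by
  revert σ
  decide

theorem ncard_setOf_exists_algebraMap_eq [Fintype F] {L ι : Type*} [Field L] [Algebra F L]
    [Fintype ι] [DecidableEq ι] {m : ι → L} (hm : Function.Injective m) {π : ι → ι}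
    (hπ : ∀ j, m j ^ Fintype.card F = m (π j)) :
    {x : F | ∃ j, algebraMap F L x = m j}.ncard =
      (Finset.univ.filter fun j => π j = j).card := by
  have himage : algebraMap F L '' {x | ∃ j, algebraMap F L x = m j} =
      m '' (Finset.univ.filter fun j => π j = j : Finset ι) := by
    ext y
    simp only [Set.mem_image, Set.mem_ofPred_eq, Finset.coe_filter, Finset.mem_univ, true_and]
    constructor
    · rintro ⟨x, ⟨j, hj⟩, rfl⟩
      exact ⟨j, hm (by rw [← hπ, ← hj, ← map_pow, FiniteField.pow_card]), hj.symm⟩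
    · rintro ⟨j, hj, rfl⟩
      obtain ⟨x, hx⟩ := exists_algebraMap_eq_of_pow_card (F := F) (x := m j) (by rw [hπ, hj])
      exact ⟨x, ⟨j, hx⟩, hx⟩
  rw [← Set.ncard_image_of_injective _ (algebraMap F L).injective, himage,
    Set.ncard_image_of_injective _ hm, Set.ncard_coe_finset]

theorem two_mul_sub_sum_ne_neg {k : Type*} [Field k] {b r : Fin 3 → k} (hb : Function.Injective b)
    (hr : Function.Injective r) (hsum : ∑ i, b i = 0) (hrb : ∑ i, r i * b i = 0) (i j : Fin 3) :
    2 * r j - ∑ l, r l ≠ -r i := by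
  have hshift (f : Fin 3 → k) : ∑ l, f l = f i + f (i + 1) + f (i + 2) := by
    rw [← Equiv.sum_comp (Equiv.addLeft i) f, Fin.sum_univ_three]
    simp
  have hj : ∀ i j : Fin 3, j = i ∨ j = i + 1 ∨ j = i + 2 := by decide
  have hne : i + 1 ≠ i + 2 := by simp
  rw [hshift] at hsum hrb ⊢
  intro h
  rcases hj i j with rfl | rfl | rfl
  · refine mul_ne_zero (sub_ne_zero.mpr (hr.ne hne)) (sub_ne_zero.mpr (hb.ne hne)) ?_
    linear_combination 2 * hrb - 2 * r j * hsum + (b (j + 1) + b (j + 2)) * h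
  · exact hr.ne hne (by linear_combination h)
  · exact hr.ne hne (by linear_combination -h)

end FixedPairs

section PairsInPencil

variable {u : Fin 4 → Fin 3 → AlgebraicClosure F} {B C : Conic F}

theorem sum_ratio_mul_frameCoord (hu : IsFrame u) (hB : B ∈ framePencil u)
    (hC : C ∈ framePencil u) (hBs : B.IsSmooth) :
    ∑ j, ratio u C B j * frameCoord u B.geomMatrix j = 0 := by
  rw [← sum_frameCoord hu.sum_eq_zero hC]
  exact Finset.sum_congr rfl fun j _ => div_mul_cancel₀ _ ((isSmooth_iff_frameCoord hu hB).mp hBs j)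

theorem fiber_smoothPairsIn (hu : IsFrame u) (hB : B ∈ framePencil u) (hC : C ∈ framePencil u)
    (hCB : C ≠ B) (hBs : B.IsSmooth) :
    {A | (A, B) ∈ smoothPairsIn (framePencil u)} =
      member hCB '' {x | ∃ j, algebraMap F Ω x = -ratio u C B j}ᶜ := by
  ext A
  constructor
  · rintro ⟨h, hA, -⟩
    obtain ⟨hAs, -, hAB⟩ := (mem_smoothPairs_iff hu hA hB).mp h
    obtain ⟨x, rfl⟩ : A ∈ Set.range (member hCB) := by
      rw [range_linePoint hCB]
      exact ⟨(pencil_eq_framePencil hu hC hB hCB).ge hA, hAB⟩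
    exact ⟨x, not_exists.mpr ((isSmooth_member_iff hu hB hC hCB hBs x).mp hAs), rfl⟩
  · rintro ⟨x, hx, rfl⟩
    have hA := member_mem_framePencil hB hC hCB x
    have hne : member hCB x ≠ B := ((range_linePoint hCB).le ⟨x, rfl⟩).2
    exact ⟨(mem_smoothPairs_iff hu hA hB).mpr
      ⟨(isSmooth_member_iff hu hB hC hCB hBs x).mpr (not_exists.mp hx), hBs, hne⟩, hA, hB⟩

theorem fiber_ponceletPairs (hu : IsFrame u) (hB : B ∈ framePencil u) (hC : C ∈ framePencil u)
    (hCB : C ≠ B) (hBs : B.IsSmooth) :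
    {A | (A, B) ∈ ponceletPairs F 4 ∩ smoothPairsIn (framePencil u)} =
      member hCB '' ({x | ∃ j, algebraMap F Ω x = 2 * ratio u C B j - ∑ i, ratio u C B i} \
        {x | ∃ j, algebraMap F Ω x = -ratio u C B j}) := by
  have hinter : {A | (A, B) ∈ ponceletPairs F 4 ∩ smoothPairsIn (framePencil u)} =
      {A | (A, B) ∈ smoothPairsIn (framePencil u)} ∩ {A | NGonCondition 4 A B} := by
    ext A
    exact ⟨fun h => ⟨h.2, h.1.2⟩, fun h => ⟨⟨h.1.1, h.2⟩, h.1⟩⟩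
  rw [hinter, fiber_smoothPairsIn hu hB hC hCB hBs, ← Set.image_inter_preimage, Set.sdiff_eq,
    Set.inter_comm]
  congr 1
  ext x
  refine and_congr_left fun hx => tetragonCondition_member_iff hu hB hC hCB hBs ?_
  exact (isSmooth_member_iff hu hB hC hCB hBs x).mpr (not_exists.mp hx)

theorem nontrivial_framePencil (hu : IsFrame u) (hW : (smoothPairsIn (framePencil u)).Nonempty) :
    (framePencil u).Nontrivial := by
  obtain ⟨⟨A, B⟩, h, hA, hB⟩ := hW
  exact ⟨A, hA, B, hB, ((mem_smoothPairs_iff hu hA hB).mp h).2.2⟩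

variable [Fintype F] {σ : Equiv.Perm (Fin 4)}

theorem ratio_pow_card (hu : IsFrame u) (hσ : IsTwisted σ u) (C B : Conic F) (j : Fin 3) :
    ratio u C B j ^ Fintype.card F = ratio u C B (pairPerm σ j) := by
  rw [ratio, div_pow, frameCoord_pow_card hu.sum_eq_zero hσ, frameCoord_pow_card hu.sum_eq_zero hσ,
    ratio]

theorem ncard_neg_ratio (hu : IsFrame u) (hσ : IsTwisted σ u) (hB : B ∈ framePencil u)
    (hC : C ∈ framePencil u) (hCB : C ≠ B) (hBs : B.IsSmooth) :
    {x : F | ∃ j, algebraMap F Ω x = -ratio u C B j}.ncard = fixedPairs σ := by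
  refine ncard_setOf_exists_algebraMap_eq
    (neg_injective.comp (ratio_injective hu hB hC hCB hBs)) fun j => ?_
  rw [Function.comp_apply, Function.comp_apply, ← ratio_pow_card hu hσ]
  exact map_neg (FiniteField.frobeniusAlgHom F Ω) _

theorem ncard_tetragon_ratio (hu : IsFrame u) (hσ : IsTwisted σ u) (hB : B ∈ framePencil u)
    (hC : C ∈ framePencil u) (hCB : C ≠ B) (hBs : B.IsSmooth) :
    {x : F | ∃ j, algebraMap F Ω x = 2 * ratio u C B j - ∑ i, ratio u C B i}.ncard =
      fixedPairs σ := by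
  refine ncard_setOf_exists_algebraMap_eq (fun i j hij => ratio_injective hu hB hC hCB hBs
    (mul_left_cancel₀ hu.two_ne_zero (sub_left_injective hij))) fun j => ?_
  let φ := FiniteField.frobeniusAlgHom F Ω
  have hφ (j : Fin 3) : φ (ratio u C B j) = ratio u C B (pairPerm σ j) := ratio_pow_card hu hσ C B j
  have hbij := Finite.injective_iff_bijective.mp (pairPerm_injective σ)
  change φ _ = _
  rw [map_sub, map_mul, map_ofNat, map_sum]
  simp only [hφ]
  rw [hbij.sum_comp (ratio u C B)]

theorem ncard_fiber_smoothPairsIn (hu : IsFrame u) (hσ : IsTwisted σ u)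
    (hW : (framePencil u).Nontrivial) (hB : B ∈ framePencil u) (hBs : B.IsSmooth) :
    {A | (A, B) ∈ smoothPairsIn (framePencil u)}.ncard + fixedPairs σ = Fintype.card F := by
  obtain ⟨C, hC, hCB⟩ := hW.exists_ne B
  rw [fiber_smoothPairsIn hu hB hC hCB hBs,
    Set.ncard_image_of_injective _ (linePoint_injective hCB),
    ← ncard_neg_ratio hu hσ hB hC hCB hBs, Set.ncard_compl_add_ncard, Nat.card_eq_fintype_card]

theorem ncard_fiber_ponceletPairs_le (hu : IsFrame u) (hσ : IsTwisted σ u)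
    (hW : (framePencil u).Nontrivial) (hB : B ∈ framePencil u) (hBs : B.IsSmooth) :
    {A | (A, B) ∈ ponceletPairs F 4 ∩ smoothPairsIn (framePencil u)}.ncard ≤ fixedPairs σ := by
  obtain ⟨C, hC, hCB⟩ := hW.exists_ne B
  rw [fiber_ponceletPairs hu hB hC hCB hBs,
    Set.ncard_image_of_injective _ (linePoint_injective hCB),
    ← ncard_tetragon_ratio hu hσ hB hC hCB hBs]
  exact Set.ncard_le_ncard Set.sdiff_subset

theorem ncard_fiber_ponceletPairs (hu : IsFrame u) (hσ : IsTwisted σ u)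
    (hW : (framePencil u).Nontrivial) (hB : B ∈ framePencil u) (hBs : B.IsSmooth)
    (hinj : Function.Injective (frameCoord u B.geomMatrix)) :
    {A | (A, B) ∈ ponceletPairs F 4 ∩ smoothPairsIn (framePencil u)}.ncard = fixedPairs σ := by
  obtain ⟨C, hC, hCB⟩ := hW.exists_ne B
  rw [fiber_ponceletPairs hu hB hC hCB hBs,
    Set.ncard_image_of_injective _ (linePoint_injective hCB), sdiff_eq_left.mpr,
    ncard_tetragon_ratio hu hσ hB hC hCB hBs]
  refine Set.disjoint_left.mpr ?_
  rintro x ⟨j, hj⟩ ⟨i, hi⟩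
  exact two_mul_sub_sum_ne_neg hinj (ratio_injective hu hB hC hCB hBs)
    (sum_frameCoord hu.sum_eq_zero hB) (sum_ratio_mul_frameCoord hu hB hC hBs) i j
    (hj.symm.trans hi)

theorem ncard_smooth_framePencil (hu : IsFrame u) (hσ : IsTwisted σ u)
    (hW : (smoothPairsIn (framePencil u)).Nonempty) :
    {B ∈ framePencil u | B.IsSmooth}.ncard + fixedPairs σ = Fintype.card F + 1 := by
  obtain ⟨⟨A, B⟩, h, hA, hB⟩ := hW
  obtain ⟨-, hBs, hAB⟩ := (mem_smoothPairs_iff hu hA hB).mp h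
  have hinsert : {A ∈ framePencil u | A.IsSmooth} =
      insert B {A | (A, B) ∈ smoothPairsIn (framePencil u)} := by
    ext D
    by_cases hDB : D = B
    · simp [hDB, hB, hBs]
    · simp only [Set.mem_ofPred_eq, Set.mem_insert_iff, hDB, false_or]
      exact ⟨fun hD => ⟨(mem_smoothPairs_iff hu hD.1 hB).mpr ⟨hD.2, hBs, hDB⟩, hD.1, hB⟩,
        fun hD => ⟨hD.2.1, hD.1.1⟩⟩
  have hnotMem : B ∉ {A | (A, B) ∈ smoothPairsIn (framePencil u)} := fun h =>
    ((mem_smoothPairs_iff hu hB hB).mp h.1).2.2 rfl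
  rw [hinsert, Set.ncard_insert_of_notMem hnotMem,
    ← ncard_fiber_smoothPairsIn hu hσ ⟨A, hA, B, hB, hAB⟩ hB hBs, add_right_comm]

theorem ncard_smoothPairsIn (hu : IsFrame u) (hσ : IsTwisted σ u)
    (hW : (smoothPairsIn (framePencil u)).Nonempty) :
    ((smoothPairsIn (framePencil u)).ncard : ℝ) =
      (Fintype.card F + 1 - fixedPairs σ) * (Fintype.card F - fixedPairs σ) := by
  set T := {B ∈ framePencil u | B.IsSmooth}
  have hnontrivial := nontrivial_framePencil hu hW
  have hT : (T.ncard : ℝ) = Fintype.card F + 1 - fixedPairs σ :=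
    eq_sub_of_add_eq (mod_cast ncard_smooth_framePencil hu hσ hW)
  obtain ⟨⟨A, B⟩, hAB, -, hB⟩ := hW
  set n := {A | (A, B) ∈ smoothPairsIn (framePencil u)}.ncard
  have hn : n + fixedPairs σ = Fintype.card F :=
    ncard_fiber_smoothPairsIn hu hσ hnontrivial hB hAB.2.1
  have hfiber (D : Conic F) (hD : D ∈ T) : {A | (A, D) ∈ smoothPairsIn (framePencil u)}.ncard = n :=
    Nat.add_right_cancel ((ncard_fiber_smoothPairsIn hu hσ hnontrivial hD.1 hD.2).trans hn.symm)
  have hcard : (smoothPairsIn (framePencil u)).ncard = T.ncard * n :=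
    le_antisymm (ncard_le_ncard_mul (fun x hx => ⟨hx.2.2, hx.1.2.1⟩) fun D hD => (hfiber D hD).le)
      (ncard_mul_le_ncard fun D hD => (hfiber D hD).ge)
  rw [hcard, Nat.cast_mul, hT, ← hn, Nat.cast_add, add_sub_cancel_right]

theorem ncard_ponceletPairs_inter_smoothPairsIn_le (hu : IsFrame u) (hσ : IsTwisted σ u)
    (hW : (smoothPairsIn (framePencil u)).Nonempty) :
    ((ponceletPairs F 4 ∩ smoothPairsIn (framePencil u)).ncard : ℝ) ≤
      fixedPairs σ * (Fintype.card F + 1 - fixedPairs σ) := by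
  have hT : ({B ∈ framePencil u | B.IsSmooth}.ncard : ℝ) =
      Fintype.card F + 1 - fixedPairs σ :=
    eq_sub_of_add_eq (mod_cast ncard_smooth_framePencil hu hσ hW)
  rw [← hT, mul_comm]
  exact_mod_cast ncard_le_ncard_mul (T := {B ∈ framePencil u | B.IsSmooth})
    (fun x hx => ⟨hx.2.2.2, hx.1.1.2.1⟩) fun B hB =>
      ncard_fiber_ponceletPairs_le hu hσ (nontrivial_framePencil hu hW) hB.1 hB.2

theorem le_ncard_ponceletPairs_inter_smoothPairsIn (hu : IsFrame u) (hσ : IsTwisted σ u)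
    (hW : (smoothPairsIn (framePencil u)).Nonempty) :
    fixedPairs σ * (Fintype.card F + 1 - fixedPairs σ - 3 : ℝ) ≤
      (ponceletPairs F 4 ∩ smoothPairsIn (framePencil u)).ncard := by
  set T := {B ∈ framePencil u | B.IsSmooth}
  set N := {B ∈ framePencil u | ¬ Function.Injective (frameCoord u B.geomMatrix)}
  have hT : (T.ncard : ℝ) = Fintype.card F + 1 - fixedPairs σ :=
    eq_sub_of_add_eq (mod_cast ncard_smooth_framePencil hu hσ hW)
  have hTN : (T.ncard : ℝ) - 3 ≤ (T \ N).ncard := by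
    have h := (Set.ncard_le_ncard_sdiff_add_ncard T N).trans
      (Nat.add_le_add_left (ncard_not_injective_frameCoord_le hu) _)
    exact sub_le_iff_le_add.mpr (mod_cast h)
  have hfiber (B : Conic F) (hB : B ∈ T \ N) : fixedPairs σ ≤
      {A | (A, B) ∈ ponceletPairs F 4 ∩ smoothPairsIn (framePencil u)}.ncard :=
    (ncard_fiber_ponceletPairs hu hσ (nontrivial_framePencil hu hW) hB.1.1 hB.1.2
      (not_not.mp fun h => hB.2 ⟨hB.1.1, h⟩)).ge
  calc fixedPairs σ * (Fintype.card F + 1 - fixedPairs σ - 3 : ℝ)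
      ≤ fixedPairs σ * (T \ N).ncard := by rw [← hT]; gcongr
    _ ≤ _ := by rw [mul_comm]; exact_mod_cast ncard_mul_le_ncard hfiber

end PairsInPencil

/-! ### Counting the pencils -/

section PermutationsOfFour

theorem partition_parts_cases : ∀ σ : Equiv.Perm (Fin 4), σ.partition.parts = {1, 1, 1, 1} ∨
    σ.partition.parts = {2, 1, 1} ∨ σ.partition.parts = {2, 2} ∨ σ.partition.parts = {3, 1} ∨
    σ.partition.parts = {4} := by
  decide

theorem isConj_of_parts_eq {σ ρ : Equiv.Perm (Fin 4)}
    (h : σ.partition.parts = ρ.partition.parts) : IsConj σ ρ :=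
  Equiv.Perm.partition_eq_of_isConj.mpr (Nat.Partition.ext h)

end PermutationsOfFour

section PermutedByEndomorphism

theorem exists_injective_semiconj_of_isConj {ι X : Type*} {f : X → X} {σ ρ : Equiv.Perm ι}
    (h : IsConj σ ρ) (hσ : ∃ t : ι → X, Function.Injective t ∧ Function.Semiconj t σ f) :
    ∃ t : ι → X, Function.Injective t ∧ Function.Semiconj t ρ f := by
  obtain ⟨t, ht, hσ⟩ := hσ
  obtain ⟨π, rfl⟩ := isConj_iff.mp h
  refine ⟨t ∘ π.symm, ht.comp π.symm.injective, fun i => ?_⟩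
  rw [Function.comp_apply, Function.comp_apply, ← hσ]
  simp

theorem injective_vec_four {α : Type*} {a b c d : α} (hab : a ≠ b) (hac : a ≠ c) (had : a ≠ d)
    (hbc : b ≠ c) (hbd : b ≠ d) (hcd : c ≠ d) : Function.Injective ![a, b, c, d] := by
  intro i j hij
  fin_cases i <;> fin_cases j <;> simp_all

variable {L : Type*} [Field L] (φ : L →+* L) {a : L}

theorem exists_semiconj_one [NeZero (2 : L)] [NeZero (3 : L)] :
    ∃ t : Fin 4 → L, Function.Injective t ∧ Function.Semiconj t (1 : Equiv.Perm (Fin 4)) φ := by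
  have h2 : (2 : L) ≠ 0 := two_ne_zero
  have h3 : (3 : L) ≠ 0 := three_ne_zero
  refine ⟨![0, 1, 2, 3], injective_vec_four ?_ ?_ ?_ ?_ ?_ ?_, fun i => ?_⟩
  on_goal 7 => fin_cases i <;> simp [map_ofNat]
  all_goals grind

theorem exists_semiconj_swap (ha : φ (φ a) = a) (ha' : φ a ≠ a) :
    ∃ t : Fin 4 → L, Function.Injective t ∧
      Function.Semiconj t (Equiv.swap 0 1 : Equiv.Perm (Fin 4)) φ := by
  refine ⟨![a, φ a, 0, 1], injective_vec_four ha'.symm ?_ ?_ ?_ ?_ zero_ne_one, fun i => ?_⟩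
  on_goal 5 => fin_cases i <;> simp [ha, Equiv.swap_apply_def]
  all_goals grind

theorem exists_semiconj_swap_mul_swap [NeZero (2 : L)] (ha : φ (φ a) = a) (ha' : φ a ≠ a) :
    ∃ t : Fin 4 → L, Function.Injective t ∧
      Function.Semiconj t (Equiv.swap 0 1 * Equiv.swap 2 3 : Equiv.Perm (Fin 4)) φ := by
  have h2 : (2 : L) ≠ 0 := two_ne_zero
  refine ⟨![a, φ a, a + 1, φ a + 1], injective_vec_four ha'.symm ?_ ?_ ?_ ?_ ?_, fun i => ?_⟩
  on_goal 6 => fin_cases i <;> simp [ha, Equiv.swap_apply_def]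
  all_goals grind

theorem exists_semiconj_threeCycle (ha : φ (φ (φ a)) = a) (ha' : φ a ≠ a) :
    ∃ t : Fin 4 → L, Function.Injective t ∧
      Function.Semiconj t (Equiv.swap 0 1 * Equiv.swap 1 2 : Equiv.Perm (Fin 4)) φ := by
  refine ⟨![a, φ a, φ (φ a), 0], injective_vec_four ha'.symm ?_ ?_ ?_ ?_ ?_, fun i => ?_⟩
  on_goal 6 => fin_cases i <;> simp [ha, Equiv.swap_apply_def]
  all_goals grind

theorem exists_semiconj_finRotate (ha : φ (φ (φ (φ a))) = a) (ha' : φ (φ a) ≠ a) :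
    ∃ t : Fin 4 → L, Function.Injective t ∧ Function.Semiconj t (finRotate 4) φ := by
  refine ⟨![a, φ a, φ (φ a), φ (φ (φ a))], injective_vec_four ?_ ha'.symm ?_ ?_ ?_ ?_, fun i => ?_⟩
  on_goal 6 => fin_cases i <;> simp [ha]
  all_goals grind

end PermutedByEndomorphism

section PermutedByFrobenius

variable [Fintype F]

theorem ncard_setOf_pow_card_pow_eq {n : ℕ} (hn : n ≠ 0) :
    {t : Ω | t ^ Fintype.card F ^ n = t}.ncard = Fintype.card F ^ n := by
  obtain ⟨p, hp⟩ := CharP.exists F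
  have hpq : p ∣ Fintype.card F := by
    rw [← CharP.cast_eq_zero_iff F p, Nat.cast_card_eq_zero]
  have hq := Fintype.one_lt_card (α := F)
  set P : Polynomial F := .X ^ Fintype.card F ^ n - .X
  have hP : P ≠ 0 := FiniteField.X_pow_card_pow_sub_X_ne_zero F hn hq
  have hroots : {t : Ω | t ^ Fintype.card F ^ n = t} = P.rootSet Ω := by
    ext t
    simp [Polynomial.mem_rootSet, hP, P, sub_eq_zero]
  rw [hroots, ← Nat.card_coe_set_eq, Nat.card_eq_fintype_card, Polynomial.card_rootSet_eq_natDegree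
    (galois_poly_separable p _ (dvd_pow hpq hn)) (IsAlgClosed.splits _)]
  exact FiniteField.X_pow_card_pow_sub_X_natDegree_eq F hn hq

theorem exists_pow_card_pow_eq {n d : ℕ} (hd : d ≠ 0) (hdn : d < n) :
    ∃ t : Ω, t ^ Fintype.card F ^ n = t ∧ t ^ Fintype.card F ^ d ≠ t := by
  have hq := Fintype.one_lt_card (α := F)
  by_contra! h
  have hfinite : {t : Ω | t ^ Fintype.card F ^ d = t}.Finite :=
    Set.finite_of_ncard_ne_zero (by rw [ncard_setOf_pow_card_pow_eq hd]; positivity)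
  have hle := Set.ncard_le_ncard (Set.ofPred_subset_ofPred.mpr h) hfinite
  rw [ncard_setOf_pow_card_pow_eq hd, ncard_setOf_pow_card_pow_eq (by lia)] at hle
  exact hle.not_gt (Nat.pow_lt_pow_right hq hdn)

theorem exists_injective_pow_card_eq [NeZero (2 : F)] [NeZero (3 : F)] (σ : Equiv.Perm (Fin 4)) :
    ∃ t : Fin 4 → Ω, Function.Injective t ∧ ∀ i, t i ^ Fintype.card F = t (σ i) := by
  let φ := (FiniteField.frobeniusAlgHom F Ω).toRingHom
  have hφ (n : ℕ) (z : Ω) : φ^[n] z = z ^ Fintype.card F ^ n := by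
    induction n with
    | zero => simp
    | succ n ih => rw [Function.iterate_succ_apply', ih, pow_succ, pow_mul]; rfl
  have hexists {n d : ℕ} (hd : d ≠ 0) (hdn : d < n) : ∃ a : Ω, φ^[n] a = a ∧ φ^[d] a ≠ a := by
    simpa only [hφ] using exists_pow_card_pow_eq hd hdn
  obtain ⟨a, ha, ha'⟩ := hexists (n := 2) (d := 1) (by decide) (by decide)
  obtain ⟨b, hb, hb'⟩ := hexists (n := 3) (d := 1) (by decide) (by decide)
  obtain ⟨c, hc, hc'⟩ := hexists (n := 4) (d := 2) (by decide) (by decide)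
  suffices h : ∃ t : Fin 4 → Ω, Function.Injective t ∧ Function.Semiconj t σ φ from
    h.imp fun t ht => ⟨ht.1, fun i => (ht.2 i).symm⟩
  rcases partition_parts_cases σ with h | h | h | h | h
  · exact exists_injective_semiconj_of_isConj (isConj_of_parts_eq (by rw [h]; decide))
      (exists_semiconj_one φ)
  · exact exists_injective_semiconj_of_isConj (isConj_of_parts_eq (by rw [h]; decide))
      (exists_semiconj_swap φ ha ha')
  · exact exists_injective_semiconj_of_isConj (isConj_of_parts_eq (by rw [h]; decide))
      (exists_semiconj_swap_mul_swap φ ha ha')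
  · exact exists_injective_semiconj_of_isConj (isConj_of_parts_eq (by rw [h]; decide))
      (exists_semiconj_threeCycle φ hb hb')
  · exact exists_injective_semiconj_of_isConj (isConj_of_parts_eq (by rw [h]; decide))
      (exists_semiconj_finRotate φ hc hc')

end PermutedByFrobenius

section ConicFrame

variable {k : Type*} [Field k]

/-- The points of the conic `x z = y ^ 2` with parameters `t i`, with the coordinates scaled so that
their sum is `0`. -/
def conicFrame (t : Fin 4 → k) (i : Fin 4) : Fin 3 → k := fun m =>
  t i ^ (m : ℕ) / ∏ j ∈ Finset.univ.erase i, (t i - t j)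

variable {t : Fin 4 → k}

/- Lagrange interpolation at the nodes `t i` of the polynomials `X ^ m`, `m < 3`, whose coefficient
of degree `3` vanishes. -/
theorem sum_conicFrame (ht : Function.Injective t) : ∑ i, conicFrame t i = 0 := by
  ext m
  have hdeg : (.X ^ (m : ℕ) : Polynomial k).degree < (Finset.univ : Finset (Fin 4)).card := by
    rw [Polynomial.degree_X_pow]
    exact_mod_cast m.2.trans (by simp)
  have hsum := Lagrange.coeff_eq_sum ht.injOn hdeg
  rw [Polynomial.coeff_X_pow, if_neg (by simpa using m.2.ne')] at hsum
  simpa [conicFrame] using hsum.symm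

theorem isFrame_conicFrame [NeZero (2 : k)] (ht : Function.Injective t) :
    IsFrame (conicFrame t) := by
  refine (isFrame_iff_forall_dotProduct_eq_zero (sum_conicFrame ht)).mpr fun f hf => ?_
  refine eq_zero_of_forall_index_sum_mul_pow_eq_zero
    (ht.comp (Fin.castSucc_injective 3)) fun i => ?_
  have hprod : ∏ j ∈ Finset.univ.erase i.castSucc, (t i.castSucc - t j) ≠ 0 :=
    Finset.prod_ne_zero_iff.mpr fun j hj => sub_ne_zero.mpr (ht.ne (Finset.ne_of_mem_erase hj).symm)
  have hi := hf i.castSucc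
  simp only [dotProduct, conicFrame, mul_div_assoc', ← Finset.sum_div] at hi
  exact (div_eq_zero_iff.mp hi).resolve_right hprod

/-- The matrix of a conic that cuts the conic `x z = y ^ 2` at the points whose parameters are the
roots of the polynomial `p` of degree at most `4`. -/
def quarticMatrix {R : Type*} [CommRing R] (p : Polynomial R) : Matrix (Fin 3) (Fin 3) R :=
  !![2 * p.coeff 0, p.coeff 1, 0; p.coeff 1, 2 * p.coeff 2, p.coeff 3; 0, p.coeff 3, 2 * p.coeff 4]

theorem quarticMatrix_isSymm {R : Type*} [CommRing R] (p : Polynomial R) :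
    (quarticMatrix p).IsSymm := by
  ext i j
  fin_cases i <;> fin_cases j <;> rfl

theorem quarticMatrix_map {R S : Type*} [CommRing R] [CommRing S] (φ : R →+* S)
    (p : Polynomial R) : (quarticMatrix p).map φ = quarticMatrix (p.map φ) := by
  ext i j
  fin_cases i <;> fin_cases j <;> simp [quarticMatrix, map_ofNat φ 2]

theorem quarticMatrix_mem_conicsThrough {p : Polynomial k} (hp : p.natDegree ≤ 4)
    (hpt : ∀ i, p.eval (t i) = 0) : quarticMatrix p ∈ conicsThrough (conicFrame t) := by
  refine ⟨quarticMatrix_isSymm p, fun i => ?_⟩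
  have heval := hpt i
  rw [Polynomial.eval_eq_sum_range' (Nat.lt_succ_of_le hp)] at heval
  simp only [Finset.sum_range_succ, Finset.sum_range_zero] at heval
  simp only [quarticMatrix, conicFrame, mulVec, vec3_dotProduct, of_apply, cons_val_zero,
    cons_val_one, cons_val, Fin.val_zero, Fin.val_one, Fin.val_two]
  linear_combination 2 * (∏ j ∈ Finset.univ.erase i, (t i - t j))⁻¹ ^ 2 * heval

/-- The matrix of the conic `x z = y ^ 2`. -/
def parabolaMatrix (R : Type*) [CommRing R] : Matrix (Fin 3) (Fin 3) R :=
  !![0, 0, 1; 0, -2, 0; 1, 0, 0]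

theorem parabolaMatrix_isSymm (R : Type*) [CommRing R] : (parabolaMatrix R).IsSymm := by
  ext i j
  fin_cases i <;> fin_cases j <;> rfl

theorem parabolaMatrix_map {R S : Type*} [CommRing R] [CommRing S] (φ : R →+* S) :
    (parabolaMatrix R).map φ = parabolaMatrix S := by
  ext i j
  fin_cases i <;> fin_cases j <;> simp [parabolaMatrix, map_ofNat φ 2]

theorem det_parabolaMatrix (R : Type*) [CommRing R] : (parabolaMatrix R).det = 2 := by
  simp [parabolaMatrix, det_fin_three]

theorem parabolaMatrix_mem_conicsThrough : parabolaMatrix k ∈ conicsThrough (conicFrame t) := by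
  refine ⟨parabolaMatrix_isSymm k, fun i => ?_⟩
  simp only [parabolaMatrix, conicFrame, mulVec, vec3_dotProduct, of_apply, cons_val_zero,
    cons_val_one, cons_val, Fin.val_zero, Fin.val_one, Fin.val_two]
  ring

end ConicFrame

section TwistedConicFrame

theorem exists_mem_framePencil {u : Fin 4 → Fin 3 → Ω} {M : Matrix (Fin 3) (Fin 3) F}
    (hM : M ≠ 0) (hsymm : M.IsSymm) (h : M.map (algebraMap F Ω) ∈ conicsThrough u) :
    ∃ C ∈ framePencil u, ∃ c : Ω, c ≠ 0 ∧ C.geomMatrix = c • M.map (algebraMap F Ω) := by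
  obtain ⟨c, hc, hgeom⟩ :=
    Conic.exists_geomMatrix_mk ⟨M, hsymm⟩ fun h0 => hM (congrArg Subtype.val h0)
  refine ⟨_, ?_, c, hc, hgeom⟩
  rw [framePencil, Set.mem_ofPred_eq, hgeom]
  exact Submodule.smul_mem _ c h

variable [Fintype F] {t : Fin 4 → AlgebraicClosure F} {σ : Equiv.Perm (Fin 4)}

theorem isTwisted_conicFrame (hσ : ∀ i, t i ^ Fintype.card F = t (σ i)) :
    IsTwisted σ (conicFrame t) := by
  intro i m
  let φ := FiniteField.frobeniusAlgHom F Ω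
  have hφ (z : Ω) : z ^ Fintype.card F = φ z := rfl
  simp only [hφ] at hσ ⊢
  simp only [conicFrame, map_div₀, map_pow, map_prod, map_sub, hσ]
  congr 1
  exact Finset.prod_equiv σ (by simp) fun _ _ => rfl

theorem exists_map_eq_prod_X_sub_C (hσ : ∀ i, t i ^ Fintype.card F = t (σ i)) :
    ∃ p : Polynomial F, p.map (algebraMap F Ω) = ∏ i, (.X - .C (t i)) := by
  let φ := (FiniteField.frobeniusAlgHom F Ω).toRingHom
  have hφ (z : Ω) : φ z = z ^ Fintype.card F := rfl
  have hinvariant : (∏ i, (.X - .C (t i)) : Polynomial Ω).map φ = ∏ i, (.X - .C (t i)) := by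
    simp only [Polynomial.map_prod, Polynomial.map_sub, Polynomial.map_X, Polynomial.map_C, hφ, hσ]
    exact Equiv.prod_comp σ fun i => Polynomial.X - Polynomial.C (t i)
  refine (Polynomial.mem_lifts _).mp ((Polynomial.lifts_iff_coeff_lifts _).mpr fun n => ?_)
  refine exists_algebraMap_eq_of_pow_card ?_
  rw [← hφ, ← Polynomial.coeff_map, hinvariant]

theorem exists_pair_framePencil_conicFrame [NeZero (2 : F)]
    (hσ : ∀ i, t i ^ Fintype.card F = t (σ i)) :
    ∃ B ∈ framePencil (conicFrame t), ∃ C ∈ framePencil (conicFrame t), C ≠ B ∧ B.IsSmooth := by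
  obtain ⟨p, hp⟩ := exists_map_eq_prod_X_sub_C hσ
  have hmonic : (p.map (algebraMap F Ω)).Monic :=
    hp ▸ Polynomial.monic_prod_X_sub_C _ _
  have hdeg : (p.map (algebraMap F Ω)).natDegree = 4 := by
    rw [hp, Polynomial.natDegree_finsetProd_X_sub_C_eq_card]
    rfl
  have hcoeff : p.coeff 4 = 1 := by
    apply (algebraMap F Ω).injective
    rw [← Polynomial.coeff_map, ← hdeg, map_one]
    exact hmonic
  have hquartic : quarticMatrix p 2 2 = 2 := by simp [quarticMatrix, hcoeff]
  obtain ⟨B, hB, b, hb, hgB⟩ := exists_mem_framePencil (u := conicFrame t) (M := parabolaMatrix F)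
    (fun h => two_ne_zero (α := F) (by rw [← det_parabolaMatrix, h, det_zero]))
    (parabolaMatrix_isSymm F)
    (parabolaMatrix_map (algebraMap F Ω) ▸ parabolaMatrix_mem_conicsThrough)
  obtain ⟨C, hC, c, hc, hgC⟩ := exists_mem_framePencil (u := conicFrame t) (M := quarticMatrix p)
    (fun h => two_ne_zero (α := F) (by rw [← hquartic, h, Matrix.zero_apply]))
    (quarticMatrix_isSymm p)
    (quarticMatrix_map (algebraMap F Ω) p ▸ quarticMatrix_mem_conicsThrough hdeg.le fun i => by
      rw [hp, Polynomial.eval_prod]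
      exact Finset.prod_eq_zero (Finset.mem_univ i) (by simp))
  refine ⟨B, hB, C, hC, ?_, ?_⟩
  · rintro rfl
    have h22 := congrFun (congrFun (hgC.symm.trans hgB) 2) 2
    simp [hquartic, parabolaMatrix, hc, NeZero.ne] at h22
  · rw [Conic.isSmooth_iff, hgB, det_smul, parabolaMatrix_map, det_parabolaMatrix]
    exact mul_ne_zero (pow_ne_zero _ hb) two_ne_zero

end TwistedConicFrame

section MovingFrames

variable {k : Type*} [Field k] {u : Fin 4 → Fin 3 → k}

theorem frameMatrix_mulVec (N : Matrix (Fin 3) (Fin 3) k) (u : Fin 4 → Fin 3 → k) :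
    frameMatrix (fun i => N *ᵥ u i) = N * frameMatrix u := by
  ext i j
  rw [frameMatrix, of_apply, ← Pi.add_apply, ← mulVec_add]
  rfl

theorem IsFrame.mulVec (hu : IsFrame u) {N : Matrix (Fin 3) (Fin 3) k} (hN : IsUnit N) :
    IsFrame fun i => N *ᵥ u i where
  sum_eq_zero := by rw [← mulVec_sum, hu.sum_eq_zero, mulVec_zero]
  det_ne_zero := by
    rw [frameMatrix_mulVec, det_mul]
    exact mul_ne_zero ((isUnit_iff_isUnit_det N).mp hN).ne_zero hu.det_ne_zero

theorem IsFrame.eq_of_mulVec_eq (hu : IsFrame u) {M N : Matrix (Fin 3) (Fin 3) k}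
    (h : ∀ i, M *ᵥ u i = N *ᵥ u i) : M = N := by
  refine hu.isUnit_frameMatrix.mul_right_cancel ?_
  rw [← frameMatrix_mulVec, ← frameMatrix_mulVec, funext h]

theorem IsFrame.exists_mulVec_eq {v : Fin 4 → Fin 3 → k} (hu : IsFrame u) (hv : IsFrame v) :
    ∃ N : GL (Fin 3) k, ∀ i, (N : Matrix (Fin 3) (Fin 3) k) *ᵥ u i = v i := by
  refine ⟨hv.isUnit_frameMatrix.unit * hu.isUnit_frameMatrix.unit⁻¹, fun i => ?_⟩
  apply smul_right_injective _ hu.two_ne_zero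
  simp only [← mulVec_smul, ← frameMatrix_mulVec_signVec hu.sum_eq_zero,
    ← frameMatrix_mulVec_signVec hv.sum_eq_zero, Units.val_mul, mulVec_mulVec, Matrix.mul_assoc,
    IsUnit.val_inv_mul, Matrix.mul_one, IsUnit.unit_spec]

theorem conj_mem_conicsThrough {N C : Matrix (Fin 3) (Fin 3) k}
    (hC : C ∈ conicsThrough fun i => N *ᵥ u i) : Nᵀ * C * N ∈ conicsThrough u := by
  refine ⟨?_, fun i => ?_⟩
  · rw [IsSymm, transpose_mul, transpose_mul, transpose_transpose, hC.1.eq, Matrix.mul_assoc]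
  · rw [← mulVec_mulVec, ← mulVec_mulVec, dotProduct_mulVec, vecMul_transpose]
    exact hC.2 i

end MovingFrames

section RationalMaps

/-- The action of the linear automorphisms over `F` on the quadruples of geometric vectors. -/
noncomputable def moveFrame (g : GL (Fin 3) F) (u : Fin 4 → Fin 3 → Ω) (i : Fin 4) : Fin 3 → Ω :=
  (g : Matrix (Fin 3) (Fin 3) F).map (algebraMap F Ω) *ᵥ u i

variable {u v : Fin 4 → Fin 3 → AlgebraicClosure F} (g : GL (Fin 3) F)

theorem isUnit_map_algebraMap : IsUnit ((g : Matrix (Fin 3) (Fin 3) F).map (algebraMap F Ω)) :=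
  g.isUnit.map (algebraMap F Ω).mapMatrix

theorem IsFrame.moveFrame (hu : IsFrame u) : IsFrame (moveFrame g u) :=
  hu.mulVec (isUnit_map_algebraMap g)

theorem IsFrame.moveFrame_injective (hu : IsFrame u) :
    Function.Injective fun g : GL (Fin 3) F => Poncelet.moveFrame g u := fun _ _ h =>
  Units.ext (map_injective (algebraMap F Ω).injective (hu.eq_of_mulVec_eq (congrFun h)))

theorem exists_mem_framePencil_of_moveFrame {B : Conic F} (hB : B ∈ framePencil (moveFrame g u)) :
    ∃ B' ∈ framePencil u, ∃ c : Ω, c ≠ 0 ∧ B'.geomMatrix =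
      c • (((g : Matrix (Fin 3) (Fin 3) F).map (algebraMap F Ω))ᵀ * B.geomMatrix *
        (g : Matrix (Fin 3) (Fin 3) F).map (algebraMap F Ω)) := by
  have hmap : ((g : Matrix (Fin 3) (Fin 3) F)ᵀ * (B.rep : Matrix (Fin 3) (Fin 3) F) * g).map
      (algebraMap F Ω) = ((g : Matrix (Fin 3) (Fin 3) F).map (algebraMap F Ω))ᵀ * B.geomMatrix *
        (g : Matrix (Fin 3) (Fin 3) F).map (algebraMap F Ω) := by
    simp only [Matrix.map_mul, transpose_map, Conic.geomMatrix]
  rw [← hmap]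
  refine exists_mem_framePencil (fun h => B.rep_nonzero (Subtype.ext ?_)) ?_
    (hmap ▸ conj_mem_conicsThrough hB)
  · have hg : IsUnit (g : Matrix (Fin 3) (Fin 3) F)ᵀ := (isUnit_transpose _).mpr g.isUnit
    rwa [g.isUnit.mul_left_eq_zero, hg.mul_right_eq_zero] at h
  · have hB : (B.rep : Matrix (Fin 3) (Fin 3) F)ᵀ = B.rep := B.rep.2
    rw [IsSymm, transpose_mul, transpose_mul, transpose_transpose, hB, Matrix.mul_assoc]

theorem exists_pair_framePencil_of_moveFrame
    (h : ∃ B ∈ framePencil (moveFrame g u), ∃ C ∈ framePencil (moveFrame g u),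
      C ≠ B ∧ B.IsSmooth) :
    ∃ B ∈ framePencil u, ∃ C ∈ framePencil u, C ≠ B ∧ B.IsSmooth := by
  obtain ⟨B, hB, C, hC, hCB, hBs⟩ := h
  obtain ⟨B', hB', b, hb, hgB⟩ := exists_mem_framePencil_of_moveFrame g hB
  obtain ⟨C', hC', c, hc, hgC⟩ := exists_mem_framePencil_of_moveFrame g hC
  have hg := isUnit_map_algebraMap g
  refine ⟨B', hB', C', hC', ?_, ?_⟩
  · rintro rfl
    refine hCB (Conic.eq_of_geomMatrix_mem_span (Submodule.mem_span_singleton.mpr ⟨c⁻¹ * b, ?_⟩))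
    rw [mul_smul, inv_smul_eq_iff₀ hc]
    apply ((isUnit_transpose _).mpr hg).mul_left_cancel
    apply hg.mul_right_cancel
    simpa only [Matrix.mul_smul, Matrix.smul_mul] using hgB.symm.trans hgC
  · rw [Conic.isSmooth_iff] at hBs ⊢
    have hdet := ((isUnit_iff_isUnit_det _).mp hg).ne_zero
    rw [hgB, det_smul, det_mul, det_mul, det_transpose]
    exact mul_ne_zero (pow_ne_zero _ hb) (mul_ne_zero (mul_ne_zero hdet hBs) hdet)

variable [Fintype F] {σ ρ : Equiv.Perm (Fin 4)}

variable {g} in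
theorem IsTwisted.moveFrame (hσ : IsTwisted σ u) : IsTwisted σ (moveFrame g u) := by
  intro i j
  let φ := FiniteField.frobeniusAlgHom F Ω
  have hφ (i : Fin 4) (j : Fin 3) : φ (u i j) = u (σ i) j := hσ i j
  change φ _ = _
  simp only [Poncelet.moveFrame, mulVec, dotProduct, map_sum, map_mul, hφ, map_apply,
    AlgHom.commutes]

theorem IsTwisted.exists_moveFrame_eq (hσu : IsTwisted σ u) (hσv : IsTwisted σ v) (hu : IsFrame u)
    (hv : IsFrame v) : ∃ g : GL (Fin 3) F, Poncelet.moveFrame g u = v := by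
  let φ := FiniteField.frobeniusAlgHom F Ω
  have hφu (i : Fin 4) (j : Fin 3) : φ (u i j) = u (σ i) j := hσu i j
  have hφv (i : Fin 4) (j : Fin 3) : φ (v i j) = v (σ i) j := hσv i j
  obtain ⟨N, hN⟩ := hu.exists_mulVec_eq hv
  have hφN : (N : Matrix (Fin 3) (Fin 3) Ω).map φ = N := by
    refine hu.eq_of_mulVec_eq fun i => ?_
    obtain ⟨i, rfl⟩ := σ.surjective i
    rw [hN]
    ext j
    rw [← hφv, ← hN]
    simp only [mulVec, dotProduct, map_sum, map_mul, hφu, map_apply]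
  have hrational (i j : Fin 3) : ∃ y : F, algebraMap F Ω y = (N : Matrix (Fin 3) (Fin 3) Ω) i j :=
    exists_algebraMap_eq_of_pow_card (congrFun (congrFun hφN i) j)
  choose g hg using hrational
  have hgN : (of g).map (algebraMap F Ω) = N := by
    ext i j
    exact hg i j
  have hunit : IsUnit (of g) := by
    rw [isUnit_iff_isUnit_det, isUnit_iff_ne_zero, ← map_ne_zero (algebraMap F Ω),
      RingHom.map_det, RingHom.mapMatrix_apply, hgN]
    exact ((isUnit_iff_isUnit_det _).mp N.isUnit).ne_zero
  refine ⟨hunit.unit, funext fun i => ?_⟩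
  rw [Poncelet.moveFrame, hunit.unit_spec, hgN, hN]

theorem IsTwisted.unique (hσ : IsTwisted σ u) (hρ : IsTwisted ρ u) (hu : IsFrame u) : σ = ρ := by
  ext1 i
  by_contra hne
  refine hu.notMem_span hne (Submodule.mem_span_singleton.mpr ⟨1, ?_⟩)
  rw [one_smul]
  ext j
  rw [← hσ, ← hρ]

theorem IsTwisted.smul_comp (hσ : IsTwisted σ u) (c : F) (π : Equiv.Perm (Fin 4)) :
    IsTwisted (π⁻¹ * σ * π) fun i => algebraMap F Ω c • u (π i) := by
  intro i j
  beta_reduce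
  rw [Pi.smul_apply, smul_eq_mul, mul_pow, ← map_pow, FiniteField.pow_card, hσ]
  simp [-algebraMap_smul]

end RationalMaps

section TwistedFrames

variable {u v : Fin 4 → Fin 3 → AlgebraicClosure F} {σ ρ : Equiv.Perm (Fin 4)}

theorem framePencil_smul_comp {c : Ω} (hc : c ≠ 0) (π : Equiv.Perm (Fin 4)) :
    framePencil (fun i => c • u (π i)) = framePencil u := by
  have hle : conicsThrough u ≤ conicsThrough fun i => c • u (π i) :=
    conicsThrough_le fun i => ⟨π i, Submodule.smul_mem _ _ (Submodule.mem_span_singleton_self _)⟩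
  have hge : conicsThrough (fun i => c • u (π i)) ≤ conicsThrough u :=
    conicsThrough_le fun i => ⟨π.symm i, Submodule.mem_span_singleton.mpr ⟨c⁻¹, by simp [hc]⟩⟩
  exact Set.ext fun C => ⟨fun hC => hge hC, fun hC => hle hC⟩

variable [Fintype F]

theorem exists_isFrame_isTwisted [NeZero (2 : F)] [NeZero (3 : F)] (σ : Equiv.Perm (Fin 4)) :
    ∃ w : Fin 4 → Fin 3 → Ω, IsFrame w ∧ IsTwisted σ w := by
  obtain ⟨t, ht, hσ⟩ := exists_injective_pow_card_eq (F := F) σ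
  exact ⟨conicFrame t, isFrame_conicFrame ht, isTwisted_conicFrame hσ⟩

theorem IsTwisted.exists_pair_framePencil [NeZero (2 : F)] [NeZero (3 : F)] (hσ : IsTwisted σ u)
    (hu : IsFrame u) : ∃ B ∈ framePencil u, ∃ C ∈ framePencil u, C ≠ B ∧ B.IsSmooth := by
  obtain ⟨t, ht, htσ⟩ := exists_injective_pow_card_eq (F := F) σ
  obtain ⟨g, hg⟩ := hσ.exists_moveFrame_eq (isTwisted_conicFrame htσ) hu (isFrame_conicFrame ht)
  exact exists_pair_framePencil_of_moveFrame g (hg ▸ exists_pair_framePencil_conicFrame htσ)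

theorem three_lt_card [NeZero (2 : F)] [NeZero (3 : F)] : 3 < Fintype.card F := by
  obtain ⟨t, ht, -⟩ := exists_semiconj_one (RingHom.id F)
  simpa [Nat.succ_le_iff] using Fintype.card_le_of_injective t ht

theorem IsTwisted.nonempty_smoothPairsIn [NeZero (2 : F)] [NeZero (3 : F)] (hσ : IsTwisted σ u)
    (hu : IsFrame u) : (smoothPairsIn (framePencil u)).Nonempty := by
  obtain ⟨B, hB, C, hC, hCB, hBs⟩ := hσ.exists_pair_framePencil hu
  have hcard := ncard_fiber_smoothPairsIn hu hσ ⟨C, hC, B, hB, hCB⟩ hB hBs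
  have hq := three_lt_card (F := F)
  have hfixed := fixedPairs_le σ
  obtain ⟨A, hA⟩ := Set.nonempty_of_ncard_ne_zero
    (s := {A | (A, B) ∈ smoothPairsIn (framePencil u)}) (by lia)
  exact ⟨(A, B), hA⟩

theorem IsTwisted.exists_smul_comp_eq [NeZero (2 : F)] [NeZero (3 : F)] (hσ : IsTwisted σ u)
    (hρ : IsTwisted ρ v) (hu : IsFrame u) (hv : IsFrame v) (h : framePencil v = framePencil u) :
    ∃ (π : Equiv.Perm (Fin 4)) (c : Fˣ), (fun i => algebraMap F Ω c • u (π i)) = v := by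
  obtain ⟨B, hB, C, hC, hCB, -⟩ := hσ.exists_pair_framePencil hu
  have hcommon (i : Fin 4) : ∃ j, v i ∈ Ω ∙ u j :=
    hu.exists_mem_span_of_isotropic hC hB (Conic.linearIndependent_geomMatrix hCB)
      ((h ▸ hC : C ∈ framePencil v).2 i) ((h ▸ hB : B ∈ framePencil v).2 i)
  obtain ⟨π, d, hd, hv'⟩ := hu.exists_perm_smul_eq hv hcommon
  have hfrob (i : Fin 4) : d ^ Fintype.card F • u (σ (π i)) = d • u (π (ρ i)) := by
    rw [← hv']
    ext j
    rw [← hρ, hv', Pi.smul_apply, Pi.smul_apply, smul_eq_mul, smul_eq_mul, mul_pow, hσ]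
  have hcomm : π (ρ 0) = σ (π 0) := by
    by_contra hne
    refine hu.notMem_span (Ne.symm hne) (Submodule.mem_span_singleton.mpr
      ⟨d⁻¹ * d ^ Fintype.card F, ?_⟩)
    rw [mul_smul, hfrob, inv_smul_smul₀ hd]
  obtain ⟨c, rfl⟩ := exists_algebraMap_eq_of_pow_card
    (smul_left_injective _ (hu.ne_zero (σ (π 0))) (hcomm ▸ hfrob 0))
  exact ⟨π, Units.mk0 c fun h0 => hd (by rw [h0, map_zero]), funext fun i => (hv' i).symm⟩

end TwistedFrames

section CountingPencils

theorem IsFrame.smul_comp_injective {k : Type*} [Field k] {u : Fin 4 → Fin 3 → k}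
    (hu : IsFrame u) :
    Function.Injective fun (x : Equiv.Perm (Fin 4) × kˣ) i => (x.2 : k) • u (x.1 i) := by
  rintro ⟨π, c⟩ ⟨ρ, d⟩ h
  have h (i : Fin 4) : (c : k) • u (π i) = (d : k) • u (ρ i) := congrFun h i
  obtain rfl : π = ρ := by
    ext1 i
    by_contra hne
    refine hu.notMem_span hne (Submodule.mem_span_singleton.mpr ⟨(d : k)⁻¹ * c, ?_⟩)
    rw [mul_smul, h, inv_smul_smul₀ d.ne_zero]
  rw [Units.ext (smul_left_injective _ (hu.ne_zero _) (h 0))]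

variable [Fintype F]

/-- The frames permuted by the `q`-power Frobenius through one of the permutations in `S`. -/
def framesOf (F : Type*) [Field F] [Fintype F] (S : Finset (Equiv.Perm (Fin 4))) :
    Set (Fin 4 → Fin 3 → AlgebraicClosure F) :=
  {u | IsFrame u ∧ ∃ σ ∈ S, IsTwisted σ u}

/-- The pencils through the frames permuted by the `q`-power Frobenius through one of the
permutations in `S`. -/
def pencilsOf (F : Type*) [Field F] [Fintype F] (S : Finset (Equiv.Perm (Fin 4))) :
    Set (Set (Conic F)) :=
  framePencil '' framesOf F S

variable [NeZero (2 : F)] [NeZero (3 : F)] {S : Finset (Equiv.Perm (Fin 4))}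

theorem ncard_framesOf (S : Finset (Equiv.Perm (Fin 4))) :
    (framesOf F S).ncard = Nat.card (GL (Fin 3) F) * S.card := by
  choose w hw hσw using exists_isFrame_isTwisted (F := F)
  have himage : framesOf F S =
      (fun x : GL (Fin 3) F × Equiv.Perm (Fin 4) => moveFrame x.1 (w x.2)) ''
        (Set.univ ×ˢ (S : Set (Equiv.Perm (Fin 4)))) := by
    ext u
    constructor
    · rintro ⟨hu, σ, hσ, hσu⟩
      obtain ⟨g, rfl⟩ := (hσw σ).exists_moveFrame_eq hσu (hw σ) hu
      exact ⟨(g, σ), ⟨Set.mem_univ g, hσ⟩, rfl⟩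
    · rintro ⟨⟨g, σ⟩, ⟨-, hσ⟩, rfl⟩
      exact ⟨(hw σ).moveFrame g, σ, hσ, (hσw σ).moveFrame⟩
  rw [himage, Set.ncard_image_of_injective, Set.ncard_prod, Set.ncard_univ, Set.ncard_coe_finset]
  rintro ⟨g, σ⟩ ⟨h, ρ⟩ (hgh : moveFrame g (w σ) = moveFrame h (w ρ))
  obtain rfl : σ = ρ :=
    (hσw σ).moveFrame.unique (hgh ▸ (hσw ρ).moveFrame) ((hw σ).moveFrame g)
  exact congrArg (·, σ) ((hw σ).moveFrame_injective hgh)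

theorem ncard_pencilsOf_mul (hS : ∀ σ ∈ S, ∀ π, π⁻¹ * σ * π ∈ S) :
    (pencilsOf F S).ncard * (24 * Nat.card Fˣ) = (framesOf F S).ncard := by
  have hex (W : Set (Conic F)) (hW : W ∈ pencilsOf F S) : ∃ u ∈ framesOf F S, framePencil u = W :=
    hW
  choose! f hf hfW using hex
  let e (x : Set (Conic F) × Equiv.Perm (Fin 4) × Fˣ) (i : Fin 4) : Fin 3 → Ω :=
    algebraMap F Ω x.2.2 • f x.1 (x.2.1 i)
  have hc (c : Fˣ) : algebraMap F Ω c ≠ 0 := (map_ne_zero _).mpr c.ne_zero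
  have himage : framesOf F S = e '' (pencilsOf F S ×ˢ Set.univ) := by
    ext v
    constructor
    · rintro ⟨hv, ρ, hρS, hρ⟩
      have hW : framePencil v ∈ pencilsOf F S := ⟨v, ⟨hv, ρ, hρS, hρ⟩, rfl⟩
      obtain ⟨hu, σ, -, hσ⟩ := hf _ hW
      obtain ⟨π, c, h⟩ := hσ.exists_smul_comp_eq hρ hu hv (hfW _ hW).symm
      exact ⟨(framePencil v, π, c), ⟨hW, Set.mem_univ _⟩, h⟩
    · rintro ⟨⟨W, π, c⟩, ⟨hW, -⟩, rfl⟩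
      obtain ⟨hu, σ, hσS, hσ⟩ := hf W hW
      exact ⟨(hu.comp π).smul (hc c), _, hS σ hσS π, hσ.smul_comp c π⟩
  have hinj : Set.InjOn e (pencilsOf F S ×ˢ Set.univ) := by
    rintro ⟨W, π, c⟩ ⟨hW, -⟩ ⟨W', π', c'⟩ ⟨hW', -⟩ h
    obtain rfl : W = W' := by
      rw [← hfW W hW, ← hfW W' hW', ← framePencil_smul_comp (hc c) π,
        ← framePencil_smul_comp (u := f W') (hc c') π']
      exact congrArg framePencil h
    let φ : Fˣ →* Ωˣ := Units.map (algebraMap F Ω)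
    have hπc : (π, φ c) = (π', φ c') := (hf W hW).1.smul_comp_injective h
    obtain ⟨rfl, hcc'⟩ := Prod.mk.inj hπc
    rw [Units.map_injective (algebraMap F Ω).injective hcc']
  rw [himage, hinj.ncard_image, Set.ncard_prod, Set.ncard_univ, Nat.card_prod, Nat.card_perm,
    Nat.card_fin]
  rfl

theorem ncard_pencilsOf (hS : ∀ σ ∈ S, ∀ π, π⁻¹ * σ * π ∈ S) :
    24 * (pencilsOf F S).ncard = S.card * (pencilsOf F Finset.univ).ncard := by
  have hcard := ncard_pencilsOf_mul (F := F) hS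
  have hcard_univ := ncard_pencilsOf_mul (F := F) (S := Finset.univ) fun _ _ _ => Finset.mem_univ _
  rw [ncard_framesOf] at hcard hcard_univ
  rw [Finset.card_univ, Fintype.card_perm, Fintype.card_fin, show Nat.factorial 4 = 24 from rfl]
    at hcard_univ
  have hGL : Nat.card (GL (Fin 3) F) = (pencilsOf F Finset.univ).ncard * Nat.card Fˣ := by linarith
  apply Nat.eq_of_mul_eq_mul_right (Nat.card_pos (α := Fˣ))
  rw [hGL] at hcard
  linarith

theorem pencilsOf_nonempty (hS : S.Nonempty) : (pencilsOf F S).Nonempty := by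
  obtain ⟨σ, hσ⟩ := hS
  obtain ⟨w, hw, hσw⟩ := exists_isFrame_isTwisted (F := F) σ
  exact ⟨_, w, ⟨hw, σ, hσ, hσw⟩, rfl⟩

theorem pencils_eq : pencils F = pencilsOf F Finset.univ := by
  ext W
  constructor
  · rintro ⟨⟨A, B⟩, h, rfl⟩
    obtain ⟨σ, u, hu, hσ, hA, hB⟩ := exists_isTwisted h
    have hAB := ((mem_smoothPairs_iff hu hA hB).mp h).2.2
    exact ⟨u, ⟨hu, σ, Finset.mem_univ σ, hσ⟩, (pencil_eq_framePencil hu hA hB hAB).symm⟩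
  · rintro ⟨u, ⟨hu, σ, -, hσ⟩, rfl⟩
    obtain ⟨⟨A, B⟩, h, hA, hB⟩ := hσ.nonempty_smoothPairsIn hu
    have hAB := ((mem_smoothPairs_iff hu hA hB).mp h).2.2
    exact ⟨(A, B), h, (pencil_eq_framePencil hu hA hB hAB).symm⟩

theorem pencilsOfType_eq (τ : Multiset ℕ) :
    pencilsOfType F τ = pencilsOf F (Finset.univ.filter fun σ => σ.partition.parts = τ) := by
  ext W
  constructor
  · rintro ⟨⟨A, B⟩, ⟨h, hτ⟩, rfl⟩
    obtain ⟨σ, u, hu, hσ, hA, hB⟩ := exists_isTwisted h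
    have hAB := ((mem_smoothPairs_iff hu hA hB).mp h).2.2
    have hστ := (hasIntersectionType_iff hu hσ hA hB hAB).mp hτ
    exact ⟨u, ⟨hu, σ, by simpa using hστ, hσ⟩, (pencil_eq_framePencil hu hA hB hAB).symm⟩
  · rintro ⟨u, ⟨hu, σ, hστ, hσ⟩, rfl⟩
    obtain ⟨⟨A, B⟩, h, hA, hB⟩ := hσ.nonempty_smoothPairsIn hu
    have hAB := ((mem_smoothPairs_iff hu hA hB).mp h).2.2
    have hτ := (hasIntersectionType_iff hu hσ hA hB hAB).mpr (Finset.mem_filter.mp hστ).2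
    exact ⟨(A, B), ⟨h, hτ⟩, (pencil_eq_framePencil hu hA hB hAB).symm⟩

omit [Fintype F] in
theorem ncard_pencils_pos [Finite F] : 0 < (pencils F).ncard := by
  have := Fintype.ofFinite F
  rw [pencils_eq]
  exact (Set.ncard_pos (Set.toFinite _)).mpr (pencilsOf_nonempty Finset.univ_nonempty)

theorem ncard_pencilsOfType_pos {τ : Multiset ℕ}
    (hτ : ∃ σ : Equiv.Perm (Fin 4), σ.partition.parts = τ) : 0 < (pencilsOfType F τ).ncard := by
  obtain ⟨σ, hσ⟩ := hτ
  rw [pencilsOfType_eq]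
  exact (Set.ncard_pos (Set.toFinite _)).mpr (pencilsOf_nonempty ⟨σ, by simpa using hσ⟩)

theorem ncard_pencilsOfType (τ : Multiset ℕ) : 24 * (pencilsOfType F τ).ncard =
    (Finset.univ.filter fun σ : Equiv.Perm (Fin 4) => σ.partition.parts = τ).card *
      (pencils F).ncard := by
  rw [pencilsOfType_eq, pencils_eq]
  refine ncard_pencilsOf fun σ hσ π => ?_
  have hconj : IsConj σ (π⁻¹ * σ * π) := isConj_iff.mpr ⟨π⁻¹, by rw [inv_inv]⟩
  rw [Finset.mem_filter, ← Equiv.Perm.partition_eq_of_isConj.mp hconj]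
  exact ⟨Finset.mem_univ _, (Finset.mem_filter.mp hσ).2⟩

theorem proportion_pencilsOfType (τ : Multiset ℕ) : proportion (pencilsOfType F τ) (pencils F) =
    (Finset.univ.filter fun σ : Equiv.Perm (Fin 4) => σ.partition.parts = τ).card / 24 := by
  have hsub : pencilsOfType F τ ⊆ pencils F := fun _ ⟨x, hx, hW⟩ => ⟨x, hx.1, hW⟩
  have hpos : ((pencils F).ncard : ℝ) ≠ 0 := Nat.cast_ne_zero.mpr ncard_pencils_pos.ne'
  rw [proportion, Set.inter_eq_left.mpr hsub, div_eq_div_iff hpos (by norm_num), mul_comm]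
  exact_mod_cast ncard_pencilsOfType τ

end CountingPencils

/-! ### Densities -/

section CycleTypes

/-- The number of the three splittings of four points into two pairs that are preserved by a
permutation of cycle type `τ`. -/
def fixedPairsOfType (τ : Multiset ℕ) : ℕ :=
  if τ = {3, 1} then 0 else if τ = {2, 1, 1} ∨ τ = {4} then 1 else 3

/-- The cycle types of the permutations of four points. -/
def cycleTypes : Finset (Multiset ℕ) :=
  Finset.univ.image fun σ : Equiv.Perm (Fin 4) => σ.partition.parts

theorem fixedPairs_eq_fixedPairsOfType :
    ∀ σ : Equiv.Perm (Fin 4), fixedPairs σ = fixedPairsOfType σ.partition.parts := by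
  decide

theorem sum_fixedPairs {M : Type*} [AddCommMonoid M] (g : ℕ → M) :
    ∑ σ, g (fixedPairs σ) = 8 • g 0 + (12 • g 1 + 4 • g 3) := by
  rw [Finset.sum_comp g fixedPairs, show Finset.univ.image fixedPairs = {0, 1, 3} by decide,
    Finset.sum_insert (by decide), Finset.sum_pair (by decide)]
  congr 3

end CycleTypes

section CountingPairs

theorem ncard_biUnion_finset {α ι : Type*} [Finite α] {I : Finset ι} {Y : ι → Set α}
    (hY : (I : Set ι).PairwiseDisjoint Y) : (⋃ i ∈ I, Y i).ncard = ∑ i ∈ I, (Y i).ncard :=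
  (I.finite_toSet.ncard_biUnion (fun i _ => (Y i).toFinite) hY).trans
    (finsum_mem_coe_finset _ _)

variable [Fintype F] [NeZero (2 : F)] {P : Set (Conic F × Conic F)} {τ : Multiset ℕ}
  {W : Set (Conic F)}

theorem smoothPairs_eq_biUnion : smoothPairs F = ⋃ τ ∈ cycleTypes, smoothPairsOfType F τ := by
  ext ⟨A, B⟩
  simp only [Set.mem_iUnion, exists_prop]
  constructor
  · intro h
    obtain ⟨σ, u, hu, hσ, hA, hB⟩ := exists_isTwisted h
    have hAB := ((mem_smoothPairs_iff hu hA hB).mp h).2.2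
    exact ⟨_, Finset.mem_image_of_mem _ (Finset.mem_univ σ), h,
      (hasIntersectionType_iff hu hσ hA hB hAB).mpr rfl⟩
  · rintro ⟨τ, -, h⟩
    exact h.1

theorem pairwise_disjoint_smoothPairsOfType : Pairwise (Disjoint.onFun (smoothPairsOfType F)) := by
  refine fun τ τ' hne => Set.disjoint_left.mpr ?_
  rintro ⟨A, B⟩ ⟨h, hτ⟩ ⟨-, hτ'⟩
  obtain ⟨σ, u, hu, hσ, hA, hB⟩ := exists_isTwisted h
  have hAB := ((mem_smoothPairs_iff hu hA hB).mp h).2.2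
  rw [hasIntersectionType_iff hu hσ hA hB hAB] at hτ hτ'
  exact hne (hτ.symm.trans hτ')

theorem ncard_inter_smoothPairs (P : Set (Conic F × Conic F)) :
    (P ∩ smoothPairs F).ncard = ∑ τ ∈ cycleTypes, (P ∩ smoothPairsOfType F τ).ncard := by
  rw [smoothPairs_eq_biUnion, Set.inter_iUnion₂]
  exact ncard_biUnion_finset fun τ _ τ' _ hne =>
    (pairwise_disjoint_smoothPairsOfType hne).mono Set.inter_subset_right Set.inter_subset_right

variable [NeZero (3 : F)]

theorem exists_isTwisted_of_mem_pencilsOfType (hW : W ∈ pencilsOfType F τ) :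
    ∃ σ u, IsFrame u ∧ IsTwisted σ u ∧ σ.partition.parts = τ ∧ framePencil u = W := by
  rw [pencilsOfType_eq] at hW
  obtain ⟨u, ⟨hu, σ, hτ, hσ⟩, rfl⟩ := hW
  exact ⟨σ, u, hu, hσ, (Finset.mem_filter.mp hτ).2, rfl⟩

theorem smoothPairsOfType_eq_biUnion (τ : Multiset ℕ) :
    smoothPairsOfType F τ = ⋃ W ∈ pencilsOfType F τ, smoothPairsIn W := by
  ext ⟨A, B⟩
  simp only [Set.mem_iUnion, exists_prop]
  constructor
  · rintro ⟨h, hτ⟩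
    obtain ⟨σ, u, hu, -, hA, hB⟩ := exists_isTwisted h
    have hAB := ((mem_smoothPairs_iff hu hA hB).mp h).2.2
    have hpencil := pencil_eq_framePencil hu hA hB hAB
    exact ⟨_, ⟨(A, B), ⟨h, hτ⟩, rfl⟩, h, hpencil ▸ hA, hpencil ▸ hB⟩
  · rintro ⟨W, hW, h, hA, hB⟩
    obtain ⟨σ, u, hu, hσ, hτ, rfl⟩ := exists_isTwisted_of_mem_pencilsOfType hW
    have hAB := ((mem_smoothPairs_iff hu hA hB).mp h).2.2
    exact ⟨h, (hasIntersectionType_iff hu hσ hA hB hAB).mpr hτ⟩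

theorem pencil_eq_of_mem_smoothPairsIn (hW : W ∈ pencilsOfType F τ) {x : Conic F × Conic F}
    (hx : x ∈ smoothPairsIn W) : x.1.pencil x.2 = W := by
  obtain ⟨h, hA, hB⟩ := hx
  obtain ⟨σ, u, hu, -, -, rfl⟩ := exists_isTwisted_of_mem_pencilsOfType hW
  exact pencil_eq_framePencil hu hA hB ((mem_smoothPairs_iff hu hA hB).mp h).2.2

theorem ncard_inter_smoothPairsOfType (P : Set (Conic F × Conic F)) (τ : Multiset ℕ) :
    (P ∩ smoothPairsOfType F τ).ncard =
      ∑ W ∈ (pencilsOfType F τ).toFinite.toFinset, (P ∩ smoothPairsIn W).ncard := by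
  rw [smoothPairsOfType_eq_biUnion, Set.inter_iUnion₂, ← ncard_biUnion_finset]
  · simp only [Set.Finite.mem_toFinset]
  · refine fun W hW W' hW' hne => Set.disjoint_left.mpr fun x hx hx' => hne ?_
    rw [Set.Finite.coe_toFinset] at hW hW'
    rw [← pencil_eq_of_mem_smoothPairsIn hW hx.2, pencil_eq_of_mem_smoothPairsIn hW' hx'.2]

theorem ncard_inter_smoothPairsOfType_le {n : ℝ}
    (h : ∀ W ∈ pencilsOfType F τ, ((P ∩ smoothPairsIn W).ncard : ℝ) ≤ n) :
    ((P ∩ smoothPairsOfType F τ).ncard : ℝ) ≤ (pencilsOfType F τ).ncard * n := by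
  rw [ncard_inter_smoothPairsOfType, Nat.cast_sum, ← nsmul_eq_mul, Set.ncard_eq_toFinset_card]
  exact Finset.sum_le_card_nsmul _ _ _ fun W hW => h W ((Set.Finite.mem_toFinset _).mp hW)

theorem le_ncard_inter_smoothPairsOfType {n : ℝ}
    (h : ∀ W ∈ pencilsOfType F τ, n ≤ ((P ∩ smoothPairsIn W).ncard : ℝ)) :
    (pencilsOfType F τ).ncard * n ≤ ((P ∩ smoothPairsOfType F τ).ncard : ℝ) := by
  rw [ncard_inter_smoothPairsOfType, Nat.cast_sum, ← nsmul_eq_mul, Set.ncard_eq_toFinset_card]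
  exact Finset.card_nsmul_le_sum _ _ _ fun W hW => h W ((Set.Finite.mem_toFinset _).mp hW)

end CountingPairs

section DensityEstimates

theorem abs_div_sub_div_le {q M N T c K L : ℝ} (hq : 1 ≤ q) (hM : 0 < M) (hK : 0 < K)
    (hN : q ^ 2 * M ≤ K * N) (h : |q * T - c * N| ≤ L * (q * M)) :
    |T / N - c / q| ≤ K * L * q ^ (-(3 / 2) : ℝ) := by
  have hq0 : 0 < q := one_pos.trans_le hq
  have hN0 : 0 < N := pos_of_mul_pos_right ((by positivity : 0 < q ^ 2 * M).trans_le hN) hK.le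
  have hL : 0 ≤ L := nonneg_of_mul_nonneg_left ((abs_nonneg _).trans h) (by positivity)
  calc |T / N - c / q| = |q * T - c * N| / (q * N) := by
        rw [div_sub_div _ _ hN0.ne' hq0.ne', abs_div, abs_of_pos (mul_pos hN0 hq0), mul_comm T,
          mul_comm N, mul_comm N]
    _ ≤ K * L * q ^ (-2 : ℝ) := by
        rw [Real.rpow_neg hq0.le, Real.rpow_two, ← div_eq_mul_inv, div_le_div_iff₀ (by positivity)
          (by positivity)]
        calc |q * T - c * N| * q ^ 2 ≤ L * (q * M) * q ^ 2 := by gcongr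
          _ = L * q * (q ^ 2 * M) := by ring
          _ ≤ L * q * (K * N) := by gcongr
          _ = K * L * (q * N) := by ring
    _ ≤ K * L * q ^ (-(3 / 2) : ℝ) := by
        gcongr ?_ * q ^ ?_
        norm_num

theorem abs_div_sub_fixedPairs_div_le {q M N T s : ℝ} (hq : 4 ≤ q) (hM : 0 < M)
    (hs : s = 0 ∨ s = 1 ∨ s = 3) (hN : N = M * ((q + 1 - s) * (q - s)))
    (hle : T ≤ M * (s * (q + 1 - s))) (hge : M * (s * (q + 1 - s - 3)) ≤ T) :
    |T / N - s / q| ≤ 108 * q ^ (-(3 / 2) : ℝ) := by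
  have hsq : q ^ 2 ≤ 12 * ((q + 1 - s) * (q - s)) ∧ s ^ 2 * (q + 1 - s) ≤ 9 * q ∧
      -(9 * q) ≤ s * (q * (q + 1 - s - 3) - (q + 1 - s) * (q - s)) := by
    rcases hs with rfl | rfl | rfl <;> refine ⟨?_, ?_, ?_⟩ <;> nlinarith
  obtain ⟨hsize, hupper, hlower⟩ := hsq
  rw [show (108 : ℝ) = 12 * 9 by norm_num]
  refine abs_div_sub_div_le (M := M) (by linarith) hM (by norm_num) ?_ (abs_le.mpr ⟨?_, ?_⟩)
  · rw [hN]
    linarith [mul_le_mul_of_nonneg_left hsize hM.le]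
  · rw [hN]
    linarith [mul_le_mul_of_nonneg_left hlower hM.le,
      mul_le_mul_of_nonneg_left hge (by linarith : 0 ≤ q)]
  · rw [hN]
    linarith [mul_le_mul_of_nonneg_left hupper hM.le,
      mul_le_mul_of_nonneg_left hle (by linarith : 0 ≤ q)]

end DensityEstimates

section Densities

variable [Fintype F] [NeZero (2 : F)] [NeZero (3 : F)] {τ : Multiset ℕ} {W : Set (Conic F)}

theorem ncard_smoothPairsIn_of_mem (hW : W ∈ pencilsOfType F τ) :
    ((smoothPairsIn W).ncard : ℝ) =
      (Fintype.card F + 1 - fixedPairsOfType τ) * (Fintype.card F - fixedPairsOfType τ) := by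
  obtain ⟨σ, u, hu, hσ, rfl, rfl⟩ := exists_isTwisted_of_mem_pencilsOfType hW
  rw [← fixedPairs_eq_fixedPairsOfType]
  exact ncard_smoothPairsIn hu hσ (hσ.nonempty_smoothPairsIn hu)

theorem ncard_ponceletPairs_inter_smoothPairsIn_mem_Icc (hW : W ∈ pencilsOfType F τ) :
    ((ponceletPairs F 4 ∩ smoothPairsIn W).ncard : ℝ) ∈
      Set.Icc (fixedPairsOfType τ * (Fintype.card F + 1 - fixedPairsOfType τ - 3 : ℝ))
        (fixedPairsOfType τ * (Fintype.card F + 1 - fixedPairsOfType τ)) := by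
  obtain ⟨σ, u, hu, hσ, rfl, rfl⟩ := exists_isTwisted_of_mem_pencilsOfType hW
  rw [← fixedPairs_eq_fixedPairsOfType]
  exact ⟨le_ncard_ponceletPairs_inter_smoothPairsIn hu hσ (hσ.nonempty_smoothPairsIn hu),
    ncard_ponceletPairs_inter_smoothPairsIn_le hu hσ (hσ.nonempty_smoothPairsIn hu)⟩

variable (F τ) in
theorem ncard_smoothPairsOfType :
    ((smoothPairsOfType F τ).ncard : ℝ) = (pencilsOfType F τ).ncard *
      ((Fintype.card F + 1 - fixedPairsOfType τ) * (Fintype.card F - fixedPairsOfType τ)) := by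
  have h := le_antisymm
    (ncard_inter_smoothPairsOfType_le (P := Set.univ) fun W (hW : W ∈ pencilsOfType F τ) =>
      (Set.univ_inter (smoothPairsIn W)).symm ▸ (ncard_smoothPairsIn_of_mem hW).le)
    (le_ncard_inter_smoothPairsOfType fun W hW =>
      (Set.univ_inter (smoothPairsIn W)).symm ▸ (ncard_smoothPairsIn_of_mem hW).ge)
  rwa [Set.univ_inter] at h

variable (F τ) in
theorem ncard_ponceletPairs_inter_smoothPairsOfType_le :
    ((ponceletPairs F 4 ∩ smoothPairsOfType F τ).ncard : ℝ) ≤ (pencilsOfType F τ).ncard *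
      (fixedPairsOfType τ * (Fintype.card F + 1 - fixedPairsOfType τ)) :=
  ncard_inter_smoothPairsOfType_le fun _ hW =>
    (ncard_ponceletPairs_inter_smoothPairsIn_mem_Icc hW).2

variable (F τ) in
theorem le_ncard_ponceletPairs_inter_smoothPairsOfType :
    (pencilsOfType F τ).ncard *
        (fixedPairsOfType τ * (Fintype.card F + 1 - fixedPairsOfType τ - 3 : ℝ)) ≤
      (ponceletPairs F 4 ∩ smoothPairsOfType F τ).ncard :=
  le_ncard_inter_smoothPairsOfType fun _ hW =>
    (ncard_ponceletPairs_inter_smoothPairsIn_mem_Icc hW).1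

theorem disjoint_ponceletPairs_smoothPairsOfType (hτ : fixedPairsOfType τ = 0) :
    Disjoint (ponceletPairs F 4) (smoothPairsOfType F τ) := by
  have h := ncard_ponceletPairs_inter_smoothPairsOfType_le F τ
  rw [hτ, Nat.cast_zero, zero_mul, mul_zero] at h
  rw [Set.disjoint_iff_inter_eq_empty, ← Set.ncard_eq_zero]
  exact_mod_cast h.antisymm (Nat.cast_nonneg _)

theorem tetragonDensity (hτ : ∃ σ : Equiv.Perm (Fin 4), σ.partition.parts = τ) {s : ℕ}
    (hs : fixedPairsOfType τ = s) : TetragonDensity F 108 τ s := by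
  subst hs
  have hq : (4 : ℝ) ≤ Fintype.card F := mod_cast three_lt_card
  have hs : (fixedPairsOfType τ : ℝ) = 0 ∨ (fixedPairsOfType τ : ℝ) = 1 ∨
      (fixedPairsOfType τ : ℝ) = 3 := by
    rw [fixedPairsOfType]
    split_ifs <;> norm_num
  refine ⟨abs_div_sub_fixedPairs_div_le hq (Nat.cast_pos.mpr (ncard_pencilsOfType_pos hτ)) hs
    (ncard_smoothPairsOfType F τ) (ncard_ponceletPairs_inter_smoothPairsOfType_le F τ)
    (le_ncard_ponceletPairs_inter_smoothPairsOfType F τ), fun W hW => ?_⟩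
  have hcard := ncard_ponceletPairs_inter_smoothPairsIn_mem_Icc hW
  refine abs_div_sub_fixedPairs_div_le (M := 1) hq one_pos hs ?_ ?_ ?_
  · rw [one_mul, ncard_smoothPairsIn_of_mem hW]
  · rw [one_mul]
    exact hcard.2
  · rw [one_mul]
    exact hcard.1

theorem sum_ncard_pencilsOfType_mul (g : ℕ → ℝ) :
    ∑ τ ∈ cycleTypes, (pencilsOfType F τ).ncard * g (fixedPairsOfType τ) =
      (pencils F).ncard * ((8 * g 0 + 12 * g 1 + 4 * g 3) / 24) := by
  have hcount (τ : Multiset ℕ) : ((pencilsOfType F τ).ncard : ℝ) = (pencils F).ncard / 24 *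
      (Finset.univ.filter fun σ : Equiv.Perm (Fin 4) => σ.partition.parts = τ).card := by
    have h := congrArg (Nat.cast : ℕ → ℝ) (ncard_pencilsOfType (F := F) τ)
    push_cast at h
    linarith
  have hsum := sum_fixedPairs g
  simp only [fixedPairs_eq_fixedPairsOfType, nsmul_eq_mul] at hsum
  rw [Finset.sum_comp (fun τ => g (fixedPairsOfType τ))
    fun σ : Equiv.Perm (Fin 4) => σ.partition.parts] at hsum
  simp only [hcount, mul_assoc]
  rw [← Finset.mul_sum]
  simp only [nsmul_eq_mul] at hsum
  rw [cycleTypes, hsum]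
  push_cast
  ring

variable (F) in
theorem ncard_smoothPairs : ((smoothPairs F).ncard : ℝ) =
    (pencils F).ncard * ((Fintype.card F : ℝ) ^ 2 - Fintype.card F + 1) := by
  have h := ncard_inter_smoothPairs (F := F) Set.univ
  simp only [Set.univ_inter] at h
  rw [h, Nat.cast_sum, Finset.sum_congr rfl fun τ _ => ncard_smoothPairsOfType F τ,
    sum_ncard_pencilsOfType_mul fun s => ((Fintype.card F : ℝ) + 1 - s) * (Fintype.card F - s)]
  push_cast
  ring

variable (F) in
theorem ncard_ponceletPairs_inter_smoothPairs_mem_Icc :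
    ((ponceletPairs F 4 ∩ smoothPairs F).ncard : ℝ) ∈
      Set.Icc ((pencils F).ncard * (Fintype.card F - 4 : ℝ))
        ((pencils F).ncard * (Fintype.card F - 1 : ℝ)) := by
  rw [ncard_inter_smoothPairs, Nat.cast_sum]
  constructor
  · refine le_of_eq_of_le ?_ (Finset.sum_le_sum fun τ _ =>
      le_ncard_ponceletPairs_inter_smoothPairsOfType F τ)
    rw [sum_ncard_pencilsOfType_mul fun s => (s : ℝ) * (Fintype.card F + 1 - s - 3)]
    push_cast
    ring
  · refine (Finset.sum_le_sum fun τ _ =>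
      ncard_ponceletPairs_inter_smoothPairsOfType_le F τ).trans_eq ?_
    rw [sum_ncard_pencilsOfType_mul fun s => (s : ℝ) * (Fintype.card F + 1 - s)]
    push_cast
    ring

variable (F) in
theorem abs_proportion_smoothPairs_sub_le :
    |proportion (ponceletPairs F 4) (smoothPairs F) - 1 / (Fintype.card F : ℝ)| ≤
      108 * (Fintype.card F : ℝ) ^ (-(3 / 2) : ℝ) := by
  have hq : (4 : ℝ) ≤ Fintype.card F := mod_cast three_lt_card
  obtain ⟨hge, hle⟩ := ncard_ponceletPairs_inter_smoothPairs_mem_Icc F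
  have hN := ncard_smoothPairs F
  have hM : (0 : ℝ) < (pencils F).ncard := Nat.cast_pos.mpr ncard_pencils_pos
  rw [show (108 : ℝ) = 12 * 9 by norm_num]
  refine abs_div_sub_div_le (M := (pencils F).ncard) (by linarith) hM (by norm_num) ?_
    (abs_le.mpr ⟨?_, ?_⟩) <;> rw [hN] <;> nlinarith

end Densities

theorem neZero_of_lt_ringChar {n : ℕ} (hn : n ≠ 0) (h : n < ringChar F) : NeZero (n : F) :=
  ⟨fun h0 => h.not_ge (Nat.le_of_dvd hn.bot_lt ((ringChar.spec F n).mp h0))⟩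

theorem card_filter_partition_parts :
    (Finset.univ.filter fun σ : Equiv.Perm (Fin 4) => σ.partition.parts = {1, 1, 1, 1}).card = 1 ∧
    (Finset.univ.filter fun σ : Equiv.Perm (Fin 4) => σ.partition.parts = {2, 1, 1}).card = 6 ∧
    (Finset.univ.filter fun σ : Equiv.Perm (Fin 4) => σ.partition.parts = {2, 2}).card = 3 ∧
    (Finset.univ.filter fun σ : Equiv.Perm (Fin 4) => σ.partition.parts = {3, 1}).card = 8 ∧
    (Finset.univ.filter fun σ : Equiv.Perm (Fin 4) => σ.partition.parts = {4}).card = 6 := by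
  decide

end Poncelet

theorem mainTheorem4 :
    ∃ C : ℝ, ∀ (F : Type*) [Field F] [Fintype F], 3 < ringChar F →
      -- the density `|Γ₄| / |Ψ|`
      |Poncelet.proportion (Poncelet.ponceletPairs F 4) (Poncelet.smoothPairs F)
            - 1 / (Fintype.card F : ℝ)|
          ≤ C * (Fintype.card F : ℝ) ^ (-(3 / 2) : ℝ) ∧
      -- the density of the pencils of each type
      Poncelet.proportion (Poncelet.pencilsOfType F {1, 1, 1, 1}) (Poncelet.pencils F) = 1 / 24 ∧
      Poncelet.proportion (Poncelet.pencilsOfType F {2, 1, 1}) (Poncelet.pencils F) = 1 / 4 ∧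
      Poncelet.proportion (Poncelet.pencilsOfType F {2, 2}) (Poncelet.pencils F) = 1 / 8 ∧
      Poncelet.proportion (Poncelet.pencilsOfType F {3, 1}) (Poncelet.pencils F) = 1 / 3 ∧
      Poncelet.proportion (Poncelet.pencilsOfType F {4}) (Poncelet.pencils F) = 1 / 4 ∧
      -- the density of the pairs satisfying the tetragon condition, for each type
      Poncelet.TetragonDensity F C {1, 1, 1, 1} 3 ∧
      Poncelet.TetragonDensity F C {2, 1, 1} 1 ∧
      Poncelet.TetragonDensity F C {2, 2} 3 ∧
      Poncelet.TetragonDensity F C {4} 1 ∧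
      -- for type `(3, 1)` the density is exactly zero
      Disjoint (Poncelet.ponceletPairs F 4) (Poncelet.smoothPairsOfType F {3, 1}) := by
  refine ⟨108, fun F _ _ hF => ?_⟩
  have : NeZero (2 : F) := Poncelet.neZero_of_lt_ringChar two_ne_zero (by lia)
  have : NeZero (3 : F) := Poncelet.neZero_of_lt_ringChar three_ne_zero hF
  obtain ⟨h1111, h211, h22, h31, h4⟩ := Poncelet.card_filter_partition_parts
  refine ⟨Poncelet.abs_proportion_smoothPairs_sub_le F, ?_, ?_, ?_, ?_, ?_, ?_, ?_, ?_, ?_,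
    Poncelet.disjoint_ponceletPairs_smoothPairsOfType (by decide)⟩
  · exact (Poncelet.proportion_pencilsOfType _).trans (by rw [h1111]; norm_num)
  · exact (Poncelet.proportion_pencilsOfType _).trans (by rw [h211]; norm_num)
  · exact (Poncelet.proportion_pencilsOfType _).trans (by rw [h22]; norm_num)
  · exact (Poncelet.proportion_pencilsOfType _).trans (by rw [h31]; norm_num)
  · exact (Poncelet.proportion_pencilsOfType _).trans (by rw [h4]; norm_num)
  · exact mod_cast Poncelet.tetragonDensity (F := F) (s := 3) (by decide) (by decide)
  · exact mod_cast Poncelet.tetragonDensity (F := F) (s := 1) (by decide) (by decide)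
  · exact mod_cast Poncelet.tetragonDensity (F := F) (s := 3) (by decide) (by decide)
  · exact mod_cast Poncelet.tetragonDensity (F := F) (s := 1) (by decide) (by decide)
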